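/- **Setting.** Let $n\ge 2$, let $\mathcal V$ be a simply connected Hausdorff manifold spread over $\mathbb C^n$ (a local homeomorphism $p=(z_1,\dots,z_n):\mathcal V\to\mathbb C^n$ gives the coordinates), let $\varsigma\in\mathcal V$, let $\xi_{i,j}$ ($1\le i<j\le n$) be holomorphic functions on $\mathcal V$ and $\omega_{i,j}=d\xi_{i,j}$. Let $\mathcal T_n=\{t_{i,j}\}_{1\le i<j\le n}=T_n\sqcup\mathcal T_{n-1}$ with $T_n=\{t_{k,n}\}_{k<n}$. Series in the noncommuting letters of $\mathcal T_n$ are differentiated and integrated coefficientwise and carry the distance $2^{-\mathrm{ord}(S-R)}$. Fix a $C^1$ path $\gamma:[0,1]\to\mathcal V$ with $\gamma(0)=\varsigma$. All integrals are taken along $\gamma$; a point of the path is denoted by its parameter, and $z$ is the running point. Put $\alpha^z(1)=1$ and $\alpha^z(t_{i,j}w)=\int_\varsigma^z\omega_{i,j}(s)\,\alpha^s(w)$, extended linearly to polynomials. Order the letters by $t_{i,j}\prec t_{k,l}$ iff $j>l$, or $j=l$ and $i>k$, and words lexicographically. For Lyndon words $l$ over $T_n$, let $P_t=t$ for a letter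 and $P_l=[P_{l_1},P_{l_2}]$, where $l=l_1l_2$ and $l_2$ is the longest proper Lyndon suffix. Let $S_1=1$; $S_l=tS_{l'}$ for a Lyndon word $l=tl'$; and, for a non-Lyndon word $w=l_1^{i_1}\cdots l_m^{i_m}$ with $l_1\succ\dots\succ l_m$ Lyndon, let $S_w$ be the shuffle product in which each $S_{l_q}$ occurs $i_q$ times, divided by $i_1!\cdots i_m!$. Define $$V_0(z)=\sum_{w\in T_n^*}\alpha^z(w)\,w,\qquad \hat V_0(z)=\exp\Big(\sum_{t\in T_n}\alpha^z(t)\,t\Big),$$ and let $V_k$ ($k\ge1$) be defined from $V_0$ by $$V_k(z)=V_0(z)\sum_{t_{i,j}\in\mathcal T_{n-1}}\int_\varsigma^z\omega_{i,j}(s)\,V_0(s)^{-1}\,t_{i,j}\,V_{k-1}(s),$$ and $\hat V_k$ by the same recursion from $\hat V_0$. For $t\in\mathcal T_{n-1}$ let $\varphi^{(s)}_{T_n}(t)$ be the result of applying to $t$ successively all automorphisms $e^{\operatorname{ad}_{-\alpha^s(S_l)P_l}}$, $l$ running through the Lyndon words over $T_n$ in decreasing order (the largest first), and let $\hat\varphi^{(s)}_{T_n}(t)=e^{\sum_{x\in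 T_n}\operatorname{ad}_{-\alpha^s(x)x}}\,t$; both maps are the identity on $T_n$. For $w=t_1\cdots t_k\in\mathcal T_{n-1}^*$ and points $s_1,\dots,s_k$ of the path put $\varphi_{T_n}(w)=\varphi_{T_n}^{(s_1)}(t_1)\cdots\varphi_{T_n}^{(s_k)}(t_k)$ and $\kappa_w(z,s)=V_0(z)\varphi_{T_n}(w)$, and similarly $\hat\kappa_w=\hat V_0\hat\varphi_{T_n}(w)$. **Proposition.** For every such path: 1. For $t\in\mathcal T_{n-1}$ and every point $s$ of the path, $\varphi^{(s)}_{T_n}(t)=e^{\operatorname{ad}_{-\log V_0(s)}}t=V_0(s)^{-1}\,t\,V_0(s)$ and $\hat\varphi^{(s)}_{T_n}(t)=e^{\operatorname{ad}_{-\log\hat V_0(s)}}t=\hat V_0(s)^{-1}\,t\,\hat V_0(s)$. 2. There are series $H,\hat H$, with coefficients differentiable along the path, satisfying along the path $$dH=\Big(\sum_{t_{i,j}\in\mathcal T_{n-1}}\omega_{i,j}\,\varphi_{T_n}(t_{i,j})\Big)H,\qquad d\hat H=\Big(\sum_{t_{i,j}\in\mathcal T_{n-1}}\omega_{i,j}\,\hat\varphi_{T_n}(t_{i,j})\Big)\hat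 H,$$ such that $\sum_{k\ge0}V_k=V_0H$ and $\sum_{k\ge0}\hat V_k=\hat V_0\hat H$. 3. For all $k\ge0$, $$V_k(z)=\sum_{w=t_{i_1,j_1}\cdots t_{i_k,j_k}\in\mathcal T_{n-1}^*}\int_\varsigma^z\omega_{i_1,j_1}(s_1)\cdots\int_\varsigma^{s_{k-1}}\omega_{i_k,j_k}(s_k)\,\kappa_w(z,s),$$ and the same holds for $\hat V_k$ with $\hat\kappa_w$. 4. Write $\sum\omega_{i,j}t_{i,j}=\sum_lA_l\,dz_l$, and let $\mathcal J_n$ be the closed two-sided ideal generated by all values (at points of $\mathcal V$) of $\partial_lA_m-\partial_mA_l-[A_l,A_m]$. Then 1 (in its exponential form), 2 and 3 hold as congruences modulo $\mathcal J_n$ when $\varphi_{T_n},\hat\varphi_{T_n}$ are replaced by their reductions $\varphi_n,\hat\varphi_n$ modulo $\mathcal J_n$, that is, by any representatives of these reductions with coefficients continuous along the path. 5. Suppose moreover that all iterated integrals $\alpha^z(w)$, $w\in\mathcal T_n^*$, depend only on the end point $z$ of the path and are holomorphic on $\mathcal V$. Then there are $H,\hat H$ with holomorphic coefficients on $\mathcal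 V$ such that $\sum_kV_k=V_0H$ and $\sum_k\hat V_k=\hat V_0\hat H$ along every path, and the two equations in 2 hold as identities of differential forms on $\mathcal V$. -/

import Mathlib

open Set Filter Topology

noncomputable section

namespace NCVolterra

/-! ### Noncommutative formal power series with complex coefficients -/

/-- Noncommutative series over the alphabet `X`: the coefficient of the word `w` in `S` is `S w`. -/
def Series (X : Type*) := List X → ℂ

namespace Series

variable {X : Type*}

instance : AddCommGroup (Series X) := inferInstanceAs (AddCommGroup (List X → ℂ))

instance : Module ℂ (Series X) := inferInstanceAs (Module ℂ (List X → ℂ))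

@[ext] theorem ext {S R : Series X} (h : ∀ w, S w = R w) : S = R := funext h

@[simp] theorem add_apply (S R : Series X) (w : List X) : (S + R) w = S w + R w := rfl

@[simp] theorem sub_apply (S R : Series X) (w : List X) : (S - R) w = S w - R w := rfl

@[simp] theorem neg_apply (S : Series X) (w : List X) : (-S) w = -S w := rfl

@[simp] theorem zero_apply (w : List X) : (0 : Series X) w = 0 := rfl

@[simp] theorem smul_apply (c : ℂ) (S : Series X) (w : List X) : (c • S) w = c * S w := rfl

/-- The empty word as a series. -/
instance : One (Series X) := ⟨fun w => match w with
  | [] => 1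
  | _ :: _ => 0⟩

/-- Concatenation (Cauchy) product: sum over all factorisations `w = u v`. -/
instance : Mul (Series X) :=
  ⟨fun S R w => ∑ i ∈ Finset.range (w.length + 1), S (w.take i) * R (w.drop i)⟩

theorem mul_apply (S R : Series X) (w : List X) :
    (S * R) w = ∑ i ∈ Finset.range (w.length + 1), S (w.take i) * R (w.drop i) := rfl

@[simp] theorem one_nil : (1 : Series X) [] = 1 := rfl

@[simp] theorem one_cons (x : X) (w : List X) : (1 : Series X) (x :: w) = 0 := rfl

@[simp] theorem mul_nil (S R : Series X) : (S * R) [] = S [] * R [] := by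
  simp [mul_apply]

/-- The series with coefficients `f`. -/
def ofFun (f : List X → ℂ) : Series X := f

@[simp] theorem ofFun_apply (f : List X → ℂ) (w : List X) : ofFun f w = f w := rfl

theorem mul_cons (S R : Series X) (x : X) (w : List X) :
    (S * R) (x :: w) = S [] * R (x :: w) + (ofFun (fun u => S (x :: u)) * R) w := by
  rw [mul_apply, mul_apply, List.length_cons, Finset.sum_range_succ' _ (w.length + 1)]
  simp [add_comm]

protected theorem add_mul' (S T R : Series X) : (S + T) * R = S * R + T * R := by
  ext w
  simp [mul_apply, add_mul, Finset.sum_add_distrib]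

protected theorem mul_add' (S T R : Series X) : S * (T + R) = S * T + S * R := by
  ext w
  simp [mul_apply, mul_add, Finset.sum_add_distrib]

protected theorem smul_mul' (c : ℂ) (S R : Series X) : (c • S) * R = c • (S * R) := by
  ext w
  simp [mul_apply, Finset.mul_sum, mul_assoc]

protected theorem zero_mul' (R : Series X) : 0 * R = 0 := by
  ext w
  simp [mul_apply]

protected theorem mul_zero' (R : Series X) : R * 0 = 0 := by
  ext w
  simp [mul_apply]

protected theorem one_mul' (R : Series X) : 1 * R = R := by
  ext w
  cases w with
  | nil => simp
  | cons x w =>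
    rw [mul_cons]
    have h : ofFun (fun u => (1 : Series X) (x :: u)) = 0 := rfl
    rw [h, Series.zero_mul']
    simp

protected theorem mul_one' (R : Series X) : R * 1 = R := by
  ext w
  induction w generalizing R with
  | nil => simp
  | cons x w ih =>
    rw [mul_cons, ih]
    simp

protected theorem mul_assoc' (S T R : Series X) : S * T * R = S * (T * R) := by
  ext w
  induction w generalizing S with
  | nil => simp [mul_assoc]
  | cons x w ih =>
    rw [mul_cons, mul_cons, mul_cons, ← ih]
    have h : ofFun (fun u => (S * T) (x :: u))
        = S [] • ofFun (fun u => T (x :: u)) + ofFun (fun u => S (x :: u)) * T := by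
      ext u
      rw [ofFun_apply, mul_cons]
      rfl
    rw [h, Series.add_mul', Series.smul_mul']
    simp
    ring

instance : Ring (Series X) :=
  { (inferInstance : AddCommGroup (Series X)), (inferInstance : One (Series X)),
    (inferInstance : Mul (Series X)) with
    left_distrib := Series.mul_add'
    right_distrib := Series.add_mul'
    zero_mul := Series.zero_mul'
    mul_zero := Series.mul_zero'
    mul_assoc := Series.mul_assoc'
    one_mul := Series.one_mul'
    mul_one := Series.mul_one' }

end Series

section Algebra

variable {X : Type*}

open Classical in
/-- The letter `t` as a series. -/
def letter (t : X) : Series X := fun w => if w = [t] then 1 else 0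

/-- `ad_S R = [S, R]`. -/
def ad (S R : Series X) : Series X := S * R - R * S

/-- The exponential `e^D R = ∑ₖ Dᵏ R / k!` of an operator `D` on series that raises the order of
every series by at least one. The terms with `k` larger than the length of a word do not contribute
to its coefficient. -/
def opExp (D : Series X → Series X) (R : Series X) : Series X := fun w =>
  ∑ k ∈ Finset.range (w.length + 1), ((k.factorial : ℂ)⁻¹) * (D^[k] R) w

/-- The exponential `∑ₖ Sᵏ / k!` of a series without constant term. -/
def seriesExp (S : Series X) : Series X := fun w =>
  ∑ k ∈ Finset.range (w.length + 1), ((k.factorial : ℂ)⁻¹) * (S ^ k) w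

/-- The logarithm `∑ₖ≥₁ (-1)ᵏ⁻¹ (S - 1)ᵏ / k` of a series with constant term `1`. -/
def seriesLog (S : Series X) : Series X := fun w =>
  ∑ k ∈ Finset.Icc 1 w.length, ((-1 : ℂ) ^ (k + 1) / (k : ℂ)) * ((S - 1) ^ k) w

/-- Shuffle product of two words. -/
def shuffleWord : List X → List X → (List X →₀ ℂ)
  | [], v => Finsupp.single v 1
  | x :: u, [] => Finsupp.single (x :: u) 1
  | x :: u, y :: v =>
      (shuffleWord u (y :: v)).mapDomain (List.cons x)
        + (shuffleWord (x :: u) v).mapDomain (List.cons y)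
  termination_by u v => u.length + v.length

/-- Shuffle product of two polynomials. -/
def shuffle (P Q : List X →₀ ℂ) : List X →₀ ℂ :=
  P.sum fun u a => Q.sum fun v b => (a * b) • shuffleWord u v

/-- Linear extension to polynomials of a function on words. -/
def evalPoly (a : List X → ℂ) (P : List X →₀ ℂ) : ℂ := P.sum fun w c => c * a w

end Algebra

/-! ### Lyndon words and the dual bases attached to them -/

section Lyndon

variable {X : Type*} [LinearOrder X]

/-- A Lyndon word: nonempty and lexicographically smaller than each of its proper nonempty
suffixes. -/
def IsLyndon (w : List X) : Prop :=
  w ≠ [] ∧ ∀ u v : List X, u ≠ [] → v ≠ [] → w = u ++ v → w < v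

/-- Position of the standard factorisation: the start of the longest proper Lyndon suffix. -/
def stdIndex (w : List X) : ℕ := sInf {i : ℕ | 0 < i ∧ IsLyndon (w.drop i)}

/-- The Lie polynomial `P_l` of a Lyndon word: `P_t = t` for a letter, and
`P_l = [P_{l₁}, P_{l₂}]` where `(l₁, l₂)` is the standard factorisation of `l`.
(The value at words that are not Lyndon is irrelevant.) -/
def lyndonP (w : List X) : Series X :=
  match w with
  | [] => 0
  | [t] => letter t
  | x :: y :: v =>
    if h : 0 < stdIndex (x :: y :: v) ∧ stdIndex (x :: y :: v) < (x :: y :: v).length then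
      ad (lyndonP ((x :: y :: v).take (stdIndex (x :: y :: v))))
        (lyndonP ((x :: y :: v).drop (stdIndex (x :: y :: v))))
    else 0
  termination_by w.length
  decreasing_by
    · simp only [List.length_take]
      exact lt_of_le_of_lt (min_le_left _ _) h.2
    · simp only [List.length_drop]
      have := h.1
      have := h.2
      omega

open Classical in
/-- Length of the longest Lyndon prefix. -/
def lyndonPrefixLength (w : List X) : ℕ :=
  Nat.findGreatest (fun i => IsLyndon (w.take i)) w.length

/-- The factorisation `w = l₁ l₂ ⋯ lₖ` into a nonincreasing sequence of Lyndon words, obtained by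
splitting off longest Lyndon prefixes; the first argument bounds the number of factors. -/
def lyndonFactorsAux : ℕ → List X → List (List X)
  | 0, _ => []
  | _ + 1, [] => []
  | m + 1, x :: v =>
    (x :: v).take (lyndonPrefixLength (x :: v))
      :: lyndonFactorsAux m ((x :: v).drop (lyndonPrefixLength (x :: v)))

/-- The factorisation of a word into a nonincreasing sequence of Lyndon words. -/
def lyndonFactors (w : List X) : List (List X) := lyndonFactorsAux w.length w

open Classical in
/-- The polynomials `S_w`, with an upper bound for the length of `w` as first argument:
`S_1 = 1`; `S_l = t S_{l'}` for a Lyndon word `l = t l'`;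
`S_w = (S_{l₁}^{⧢ i₁} ⧢ ⋯ ⧢ S_{lₖ}^{⧢ iₖ}) / (i₁! ⋯ iₖ!)` for a word `w = l₁^{i₁} ⋯ lₖ^{iₖ}`,
`l₁ > ⋯ > lₖ` Lyndon, that is not Lyndon. -/
def lyndonSAux : ℕ → List X → (List X →₀ ℂ)
  | 0, _ => Finsupp.single [] 1
  | _ + 1, [] => Finsupp.single [] 1
  | m + 1, x :: v =>
    if IsLyndon (x :: v) then (lyndonSAux m v).mapDomain (List.cons x)
    else
      ((∏ l ∈ (lyndonFactors (x :: v)).toFinset,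
          (((lyndonFactors (x :: v)).count l).factorial : ℂ))⁻¹) •
        ((lyndonFactors (x :: v)).map (lyndonSAux m)).foldr shuffle (Finsupp.single [] 1)

/-- The polynomials `S_w`; `(S_w)` is the basis dual to the Poincaré–Birkhoff–Witt basis built on
the `P_l`. -/
def lyndonS (w : List X) : List X →₀ ℂ := lyndonSAux w.length w

end Lyndon

/-! ### The alphabet `t_{i,j}`, `i < j` -/

/-- The letter `t_{i,j}`, `i < j`, with indices in `Fin n`. -/
@[ext] structure Letter (n : ℕ) where
  i : Fin n
  j : Fin n
  lt : i < j

namespace Letter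

variable {n : ℕ}

/-- The key that orders the letters: `t_{i,j} < t_{k,l}` iff `j > l`, or `j = l` and `i > k`. -/
def key (t : Letter n) : (Fin n)ᵒᵈ ×ₗ (Fin n)ᵒᵈ :=
  toLex (OrderDual.toDual t.j, OrderDual.toDual t.i)

theorem key_injective : Function.Injective (key (n := n)) := by
  intro s t h
  have h' := congrArg ofLex h
  simp only [key, ofLex_toLex, Prod.mk.injEq, OrderDual.toDual_inj] at h'
  exact Letter.ext h'.2 h'.1

instance : LinearOrder (Letter n) := LinearOrder.lift' key key_injective

instance : Fintype (Letter n) := Fintype.ofInjective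
  (fun t : Letter n => (t.i, t.j)) (fun s t h => by
    simp only [Prod.mk.injEq] at h
    exact Letter.ext h.1 h.2)

/-- The letters `t_{k,n}` (last index maximal). The other letters are the `t_{i,j}`, `j ≤ n - 1`. -/
def IsTop (t : Letter n) : Prop := (t.j : ℕ) + 1 = n

end Letter

section Words

variable {n : ℕ}

open Classical in
/-- The letters `t_{k,n}`, `1 ≤ k ≤ n - 1`. -/
def topLetters (n : ℕ) : Finset (Letter n) := Finset.univ.filter fun t => t.IsTop

open Classical in
/-- The letters `t_{i,j}`, `1 ≤ i < j ≤ n - 1`. -/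
def lowLetters (n : ℕ) : Finset (Letter n) := Finset.univ.filter fun t => ¬ t.IsTop

/-- All words of length `k`. -/
def wordsOfLength (n k : ℕ) : Finset (List (Letter n)) :=
  Finset.univ.image fun f : Fin k → Letter n => List.ofFn f

open Classical in
/-- All words of length `k` in the letters `t_{i,j}`, `1 ≤ i < j ≤ n - 1`. -/
def lowWords (n k : ℕ) : Finset (List (Letter n)) :=
  (wordsOfLength n k).filter fun w => ∀ t ∈ w, t ∈ lowLetters n

open Classical in
/-- The Lyndon words of length at most `N` in the letters `t_{k,n}`. -/
def topLyndon (n N : ℕ) : Finset (List (Letter n)) :=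
  ((Finset.range (N + 1)).biUnion (wordsOfLength n)).filter
    fun l => IsLyndon l ∧ ∀ t ∈ l, t ∈ topLetters n

end Words

/-! ### The starting series and the twisting maps

In this section `a` is the function that sends a word to its iterated integral along a fixed
path. -/

section Twist

variable {n : ℕ}

open Classical in
/-- `V₀ = ∑ a(w) w`, over all words `w` in the letters `t_{k,n}`. -/
def startSeries (a : List (Letter n) → ℂ) : Series (Letter n) := fun w =>
  if ∀ t ∈ w, t ∈ topLetters n then a w else 0

/-- `V̂₀ = exp (∑ₖ a(t_{k,n}) t_{k,n})`. -/
def startSeriesHat (a : List (Letter n) → ℂ) : Series (Letter n) :=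
  seriesExp (∑ t ∈ topLetters n, a [t] • letter t)

/-- Apply `e^{ad_{-a(S_l) P_l}}` to `R` successively for the Lyndon words `l` of length at most `N`
in the letters `t_{k,n}`, in decreasing lexicographic order, the largest one first. -/
def twistUpTo (a : List (Letter n) → ℂ) (N : ℕ) (R : Series (Letter n)) : Series (Letter n) :=
  ((topLyndon n N).sort (· ≥ ·)).foldl
    (fun T l => opExp (ad (-(evalPoly a (lyndonS l) • lyndonP l))) T) R

open Classical in
/-- The twisting map on letters: the identity on the letters `t_{k,n}`, and on the other letters the
infinite product of the automorphisms `e^{ad_{-a(S_l) P_l}}`, `l` running through all Lyndon words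
in the letters `t_{k,n}` in decreasing order, the largest one being applied first. As `P_l` is
homogeneous of degree the length of `l`, only Lyndon words of length at most the length of `w`
influence the coefficient of `w`. -/
def twist (a : List (Letter n) → ℂ) (t : Letter n) : Series (Letter n) := fun w =>
  if t ∈ topLetters n then letter t w else twistUpTo a w.length (letter t) w

open Classical in
/-- The abelianised twisting map on letters: the identity on the letters `t_{k,n}`, and
`e^{∑ₖ ad_{-a(t_{k,n}) t_{k,n}}}` on the other letters. -/
def twistHat (a : List (Letter n) → ℂ) (t : Letter n) : Series (Letter n) :=
  if t ∈ topLetters n then letter t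
  else opExp (fun R => ∑ s ∈ topLetters n, ad (-(a [s] • letter s)) R) (letter t)

end Twist

/-! ### Iterated integrals, the Volterra recursion and its kernels

`u t` is the function with `γ^*ω_t = u t (s) ds` on the parameter interval `[0, 1]` of a path. -/

section Integrals

variable {n : ℕ}

/-- `∫₀^τ u_{t₁}(s₁) ds₁ ∫₀^{s₁} u_{t₂}(s₂) ds₂ ⋯ ∫₀^{s_{k-1}} u_{tₖ}(sₖ) dsₖ G [s₁, …, sₖ]`
for the word `[t₁, …, tₖ]`. -/
def iterInt {X : Type*} (u : X → ℝ → ℂ) : List X → (List ℝ → ℂ) → ℝ → ℂ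
  | [], G, _ => G []
  | t :: w, G, τ => ∫ s in (0 : ℝ)..τ, u t s * iterInt u w (fun σ => G (s :: σ)) s

/-- The iterated integral `α(w)` along the path, up to the parameter `τ`. -/
def alpha {X : Type*} (u : X → ℝ → ℂ) (τ : ℝ) (w : List X) : ℂ := iterInt u w (fun _ => 1) τ

/-- The Volterra recursion
`V_k(τ) = V₀(τ) ∑_{t = t_{i,j}, j ≤ n - 1} ∫₀^τ u_t(s) V₀(s)⁻¹ t V_{k-1}(s) ds`,
with coefficientwise integrals. -/
def volterra (u : Letter n → ℝ → ℂ) (V₀ : ℝ → Series (Letter n)) : ℕ → ℝ → Series (Letter n)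
  | 0 => V₀
  | k + 1 => fun τ => V₀ τ * Series.ofFun fun w => ∑ t ∈ lowLetters n, ∫ s in (0 : ℝ)..τ,
      u t s * (Ring.inverse (V₀ s) * letter t * volterra u V₀ k s) w

/-- Chronological extension of a twisting map to words:
`φ(t₁ ⋯ tₖ) = φ^{(s₁)}(t₁) ⋯ φ^{(sₖ)}(tₖ)`. -/
def twistWord (φ : ℝ → Letter n → Series (Letter n)) (w : List (Letter n)) (σ : List ℝ) :
    Series (Letter n) :=
  ((w.zip σ).map fun q => φ q.2 q.1).prod

/-- The kernel `κ_w(τ, s) = V₀(τ) φ(w)`. -/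
def kernel (V₀ : ℝ → Series (Letter n)) (φ : ℝ → Letter n → Series (Letter n))
    (w : List (Letter n)) (τ : ℝ) (σ : List ℝ) : Series (Letter n) :=
  V₀ τ * twistWord φ w σ

/-- `∑_{|w| = k} ∫₀^τ u_{t₁}(s₁) ds₁ ⋯ ∫₀^{s_{k-1}} u_{tₖ}(sₖ) dsₖ κ_w(τ, s)`, over the words
`w = t₁ ⋯ tₖ` in the letters `t_{i,j}`, `j ≤ n - 1`. -/
def kernelIntegral (u : Letter n → ℝ → ℂ) (V₀ : ℝ → Series (Letter n))
    (φ : ℝ → Letter n → Series (Letter n)) (k : ℕ) (τ : ℝ) : Series (Letter n) := fun v =>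
  ∑ w ∈ lowWords n k, iterInt u w (fun σ => kernel V₀ φ w τ σ v) τ

/-- `∑ₖ V_k = S` on `[0, 1]`: convergence for the distance `2^{-(order of the difference)}`. -/
def IsSeriesSum (W : ℕ → ℝ → Series (Letter n)) (S : ℝ → Series (Letter n)) : Prop :=
  ∀ m : ℕ, ∃ K : ℕ, ∀ N ≥ K, ∀ τ ∈ Icc (0 : ℝ) 1, ∀ w : List (Letter n), w.length ≤ m →
    (∑ k ∈ Finset.range N, W k τ) w = S τ w

/-- `D` is the coefficientwise derivative of `H` on `[0, 1]`. -/
def HasSeriesDeriv (H D : ℝ → Series (Letter n)) : Prop :=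
  ∀ τ ∈ Icc (0 : ℝ) 1, ∀ w : List (Letter n),
    HasDerivWithinAt (fun s => H s w) (D τ w) (Icc (0 : ℝ) 1) τ

/-- The right-hand side `M_{n-1}^φ H = ∑_{j ≤ n - 1} ω_{i,j} φ(t_{i,j}) H` along the path. -/
def twistedRHS (u : Letter n → ℝ → ℂ) (φ : ℝ → Letter n → Series (Letter n))
    (H : ℝ → Series (Letter n)) (τ : ℝ) : Series (Letter n) :=
  (∑ t ∈ lowLetters n, u t τ • φ τ t) * H τ

end Integrals

/-! ### Manifolds spread over `ℂⁿ`

`p : V → ℂⁿ` is a local homeomorphism; its components are the coordinates `z₁, …, zₙ`. -/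

section Manifold

variable {n : ℕ} {V : Type*} [TopologicalSpace V]

/-- `f` has differential `L` at `x`, read in the local coordinates `p`. -/
def HasDifferentialAt (p : V → Fin n → ℂ) (f : V → ℂ) (L : (Fin n → ℂ) →L[ℂ] ℂ) (x : V) : Prop :=
  ∃ g : (Fin n → ℂ) → ℂ, HasFDerivAt g L (p x) ∧ f =ᶠ[𝓝 x] g ∘ p

open Classical in
/-- The differential `df` at `x` (zero if there is none). -/
def differential (p : V → Fin n → ℂ) (f : V → ℂ) (x : V) : (Fin n → ℂ) →L[ℂ] ℂ :=
  if h : ∃ L, HasDifferentialAt p f L x then h.choose else 0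

/-- The partial derivative `∂ᵢ f`. -/
def partialDeriv (p : V → Fin n → ℂ) (i : Fin n) (f : V → ℂ) (x : V) : ℂ :=
  differential p f x (Pi.single i 1)

/-- Holomorphic functions on `V`. -/
def Holomorphic (p : V → Fin n → ℂ) (f : V → ℂ) : Prop :=
  ∀ x, ∃ g : (Fin n → ℂ) → ℂ, AnalyticAt ℂ g (p x) ∧ f =ᶠ[𝓝 x] g ∘ p

/-- A path of class `C¹` in `V`, parametrised by `[0, 1]` and starting at `x₀`. -/
def IsPathFrom (p : V → Fin n → ℂ) (x₀ : V) (γ : ℝ → V) : Prop :=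
  γ 0 = x₀ ∧ ContinuousOn γ (Icc 0 1) ∧ ContDiffOn ℝ 1 (p ∘ γ) (Icc 0 1)

/-- The pullback `γ^* dξ_t = (formAlong p ξ γ t s) ds`. -/
def formAlong (p : V → Fin n → ℂ) (ξ : Letter n → V → ℂ) (γ : ℝ → V) (t : Letter n) (s : ℝ) : ℂ :=
  differential p (ξ t) (γ s) (derivWithin (p ∘ γ) (Icc 0 1) s)

/-- The coefficient `A_l` of `dz_l` in the connection `∑ dξ_t t = ∑ A_l dz_l`, at the point `x`. -/
def connCoeff (p : V → Fin n → ℂ) (ξ : Letter n → V → ℂ) (l : Fin n) (x : V) : Series (Letter n) :=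
  ∑ t : Letter n, partialDeriv p l (ξ t) x • letter t

/-- The value at `x` of `∂_l A_m - ∂_m A_l - [A_l, A_m]`. -/
def relator (p : V → Fin n → ℂ) (ξ : Letter n → V → ℂ) (l m : Fin n) (x : V) : Series (Letter n) :=
  (∑ t : Letter n, (partialDeriv p l (partialDeriv p m (ξ t)) x
      - partialDeriv p m (partialDeriv p l (ξ t)) x) • letter t)
    - (connCoeff p ξ l x * connCoeff p ξ m x - connCoeff p ξ m x * connCoeff p ξ l x)

/-- The closed two-sided ideal of relators among the letters induced by the integrability condition
`∂_l A_m - ∂_m A_l = [A_l, A_m]` (identically on `V`): the closure of the two-sided ideal generated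
by all values of `∂_l A_m - ∂_m A_l - [A_l, A_m]`. -/
def relatorIdeal (p : V → Fin n → ℂ) (ξ : Letter n → V → ℂ) : Set (Series (Letter n)) :=
  {S | ∀ m : ℕ, ∃ R ∈ TwoSidedIdeal.span {Q | ∃ (k l : Fin n) (x : V), Q = relator p ξ k l x},
    ∀ w : List (Letter n), w.length ≤ m → S w = R w}

end Manifold

/-! ### The two forms of the expansion -/

section Expansion

variable {n : ℕ}

/-- `∑ V_k = V₀ H` for some solution `H` of the twisted equation `dH = M_{n-1}^φ H` along the path,
and each `V_k` is the iterated integral with kernels `κ_w = V₀ φ(w)`. -/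
def VolterraExpansion (u : Letter n → ℝ → ℂ) (V₀ : ℝ → Series (Letter n))
    (φ : ℝ → Letter n → Series (Letter n)) : Prop :=
  (∃ H : ℝ → Series (Letter n), HasSeriesDeriv H (twistedRHS u φ H) ∧
    IsSeriesSum (volterra u V₀) (fun τ => V₀ τ * H τ)) ∧
  ∀ k : ℕ, ∀ τ ∈ Icc (0 : ℝ) 1, volterra u V₀ k τ = kernelIntegral u V₀ φ k τ

/-- The same statement modulo `J`. -/
def VolterraExpansionMod (J : Set (Series (Letter n))) (u : Letter n → ℝ → ℂ)
    (V₀ : ℝ → Series (Letter n)) (φ : ℝ → Letter n → Series (Letter n)) : Prop :=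
  (∃ H D S : ℝ → Series (Letter n), HasSeriesDeriv H D ∧ IsSeriesSum (volterra u V₀) S ∧
    ∀ τ ∈ Icc (0 : ℝ) 1, D τ - twistedRHS u φ H τ ∈ J ∧ S τ - V₀ τ * H τ ∈ J) ∧
  ∀ k : ℕ, ∀ τ ∈ Icc (0 : ℝ) 1, volterra u V₀ k τ - kernelIntegral u V₀ φ k τ ∈ J

/-- `ψ` represents, with continuous coefficients, the reduction of `φ` modulo `J`. -/
def RepresentsMod (J : Set (Series (Letter n))) (φ ψ : ℝ → Letter n → Series (Letter n)) : Prop :=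
  (∀ t w, ContinuousOn (fun τ => ψ τ t w) (Icc (0 : ℝ) 1)) ∧
    ∀ τ ∈ Icc (0 : ℝ) 1, ∀ t, ψ τ t - φ τ t ∈ J

end Expansion

end NCVolterra

end

open NCVolterra

/-!
Along a path everything reduces to linear differential equations `dF = M F`, where the series `M` has
no constant term: their solutions are determined, degree by degree, by the initial value
(`eqUpTo_of_hasSeriesDeriv`).

* The twisting map is conjugation by the starting series. For `V̂₀` this is the identity
  `e^{ad A} R = e^A R e^{-A}` (`opExp_ad_eq`). For `V₀` it follows from the factorisation
  `∑ α(w) w = ∏ exp (α(S_l) P_l)` over the Lyndon words in decreasing order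
  (`startSeries_eqUpTo_lyndonProd`). The left side solves `dV = (∑ ω_t t) V`, and so does the right
  side: iterated integrals are multiplicative for the shuffle product
  (`evalPoly_alpha_shuffle`), hence for a Lyndon word `l = t l'` with
  `l' = m₁^{i₁} ⋯ m_r^{i_r}` one has `dα(S_l) = ω_t ∏ α(S_{m_q})^{i_q} / i_q!`. On the other hand
  `P_l = [⋯[[t, P_{m₁}], P_{m₁}], …, P_{m_r}]`, because the standard factorisation of `l` splits off
  the last Lyndon factor of `l'` (`lyndonP_cons_flatten_append`). Conjugating the sum of the
  `ω_t t` by the factors `exp (α(S_m) P_m)`, the largest `m` first, therefore produces exactly the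
  terms `dα(S_l) P_l`, one at a time (`opExp_lyndonDriftPart`, `exists_hasSeriesDeriv_lyndonProd`).

* Once `φ(t) = V₀⁻¹ t V₀`, the recursion gives `V_k = V₀ H_k`, where `H_k` is the sum over the words
  of length `k` of the iterated integrals of `φ(w)` (`IsConjugation.volterra_eq`). As `H_k` has
  order at least `k`, the `H_k` can be summed, and the sum solves the twisted equation
  (`hasSeriesDeriv_chronSol`).

* A closed two-sided ideal is stable under products and under coefficientwise integration
  (`integral_mem_closedIdeal`), so replacing `φ` by a congruent map changes the iterated integrals
  by elements of the ideal only.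

* The coefficients of `H` are linear combinations of iterated integrals, the same for every path
  (`IsTwistingPair.isIteratedSeries_chronSol`). If the latter are holomorphic functions of the end
  point, so is `H`. Its differential at a point is computed on the velocities of `C¹` paths ending
  there, which exhaust all directions (`exists_path_to_with_velocity`).
-/

noncomputable section

namespace NCVolterra

/-! ### The order filtration on noncommutative series -/

namespace Series

variable {X : Type*}

protected theorem mul_smul' (c : ℂ) (S R : Series X) : S * (c • R) = c • (S * R) := by
  ext w
  simp [mul_apply, Finset.mul_sum, mul_left_comm]

instance : Algebra ℂ (Series X) := Algebra.ofModule Series.smul_mul' Series.mul_smul'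

/-- The coefficient of a word, as a linear form. -/
def coeffHom (w : List X) : Series X →ₗ[ℂ] ℂ where
  toFun S := S w
  map_add' _ _ := rfl
  map_smul' _ _ := rfl

@[simp] theorem sum_apply {ι : Type*} (s : Finset ι) (F : ι → Series X) (w : List X) :
    (∑ i ∈ s, F i) w = ∑ i ∈ s, F i w :=
  map_sum (coeffHom w) F s

/-- `S` has order at least `k`: no word of length less than `k` occurs in it. -/
def OrdGE (k : ℕ) (S : Series X) : Prop := ∀ w : List X, w.length < k → S w = 0

theorem ordGE_zero (S : Series X) : OrdGE 0 S := fun _ h => absurd h (Nat.not_lt_zero _)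

theorem ordGE_one {S : Series X} (h : S [] = 0) : OrdGE 1 S := fun w hw => by
  rw [List.length_eq_zero_iff.1 (Nat.lt_one_iff.1 hw), h]

theorem OrdGE.mul {S R : Series X} {k l : ℕ} (hS : OrdGE k S) (hR : OrdGE l R) :
    OrdGE (k + l) (S * R) := fun w hw => by
  rw [mul_apply]
  refine Finset.sum_eq_zero fun i hi => ?_
  rw [Finset.mem_range] at hi
  by_cases h : i < k
  · rw [hS _ (by rw [List.length_take]; omega), zero_mul]
  · rw [hR _ (by rw [List.length_drop]; omega), mul_zero]

theorem OrdGE.smul {S : Series X} {k : ℕ} (hS : OrdGE k S) (c : ℂ) : OrdGE k (c • S) :=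
  fun w hw => by rw [smul_apply, hS w hw, mul_zero]

theorem OrdGE.sub {S R : Series X} {k : ℕ} (hS : OrdGE k S) (hR : OrdGE k R) : OrdGE k (S - R) :=
  fun w hw => by rw [sub_apply, hS w hw, hR w hw, sub_zero]

theorem OrdGE.sum {ι : Type*} {s : Finset ι} {F : ι → Series X} {k : ℕ}
    (h : ∀ i ∈ s, OrdGE k (F i)) : OrdGE k (∑ i ∈ s, F i) := fun w hw => by
  rw [sum_apply]
  exact Finset.sum_eq_zero fun i hi => h i hi w hw

theorem OrdGE.pow {S : Series X} (hS : S [] = 0) (k : ℕ) : OrdGE k (S ^ k) := by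
  induction k with
  | zero => exact ordGE_zero _
  | succ k ih => rw [pow_succ]; exact ih.mul (ordGE_one hS)

/-- `S` and `R` have the same coefficients at all words of length at most `N`. -/
def EqUpTo (N : ℕ) (S R : Series X) : Prop := ∀ w : List X, w.length ≤ N → S w = R w

theorem EqUpTo.refl (N : ℕ) (S : Series X) : EqUpTo N S S := fun _ _ => rfl

theorem EqUpTo.symm {N : ℕ} {S R : Series X} (h : EqUpTo N S R) : EqUpTo N R S :=
  fun w hw => (h w hw).symm

theorem EqUpTo.trans {N : ℕ} {S R T : Series X} (h : EqUpTo N S R) (h' : EqUpTo N R T) :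
    EqUpTo N S T := fun w hw => (h w hw).trans (h' w hw)

theorem EqUpTo.add {N : ℕ} {S R S' R' : Series X} (h : EqUpTo N S R) (h' : EqUpTo N S' R') :
    EqUpTo N (S + S') (R + R') := fun w hw => by rw [add_apply, add_apply, h w hw, h' w hw]

theorem EqUpTo.smul {N : ℕ} {S R : Series X} (h : EqUpTo N S R) (c : ℂ) :
    EqUpTo N (c • S) (c • R) := fun w hw => by rw [smul_apply, smul_apply, h w hw]

theorem EqUpTo.sum {ι : Type*} {s : Finset ι} {F G : ι → Series X} {N : ℕ}
    (h : ∀ i ∈ s, EqUpTo N (F i) (G i)) : EqUpTo N (∑ i ∈ s, F i) (∑ i ∈ s, G i) := fun w hw => by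
  rw [sum_apply, sum_apply]
  exact Finset.sum_congr rfl fun i hi => h i hi w hw

theorem EqUpTo.mul {N : ℕ} {S R S' R' : Series X} (h : EqUpTo N S R) (h' : EqUpTo N S' R') :
    EqUpTo N (S * S') (R * R') := fun w hw => by
  rw [mul_apply, mul_apply]
  refine Finset.sum_congr rfl fun i hi => ?_
  rw [h _ (by rw [List.length_take]; omega), h' _ (by rw [List.length_drop]; omega)]

theorem eq_of_forall_eqUpTo {S R : Series X} (h : ∀ N, EqUpTo N S R) : S = R := by
  ext w
  exact h _ w le_rfl

/-- The sum of a sequence of series whose `k`-th term has order at least `k`. -/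
def gradedSum (x : ℕ → Series X) : Series X := fun w => ∑ k ∈ Finset.range (w.length + 1), x k w

theorem gradedSum_eqUpTo {x : ℕ → Series X} (hx : ∀ k, OrdGE k (x k)) (N : ℕ) {M : ℕ}
    (hM : N ≤ M) : EqUpTo N (gradedSum x) (∑ k ∈ Finset.range (M + 1), x k) := fun w hw => by
  rw [sum_apply]
  refine Finset.sum_subset (Finset.range_mono (by omega)) fun k _ hk => hx k w ?_
  rw [Finset.mem_range] at hk
  omega

theorem gradedSum_mul {x y : ℕ → Series X} (hx : ∀ k, OrdGE k (x k)) (hy : ∀ k, OrdGE k (y k)) :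
    gradedSum x * gradedSum y
      = gradedSum fun n => ∑ p ∈ Finset.HasAntidiagonal.antidiagonal n, x p.1 * y p.2 := by
  refine eq_of_forall_eqUpTo fun N => ?_
  refine ((gradedSum_eqUpTo hx N le_rfl).mul (gradedSum_eqUpTo hy N le_rfl)).trans ?_
  refine EqUpTo.trans ?_ (gradedSum_eqUpTo (fun n => OrdGE.sum fun p hp => ?_) N le_rfl).symm
  · intro w hw
    rw [Finset.sum_mul_sum, ← Finset.sum_product', sum_apply, sum_apply]
    simp only [sum_apply]
    rw [Finset.sum_sigma']
    symm
    refine Finset.sum_bij_ne_zero (fun q _ _ => q.2) ?_ ?_ ?_ ?_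
    · rintro ⟨n, i, j⟩ h _
      simp only [Finset.mem_sigma, Finset.mem_range, Finset.HasAntidiagonal.mem_antidiagonal] at h
      simp only [Finset.mem_product, Finset.mem_range]
      omega
    · rintro ⟨n, i, j⟩ h _ ⟨n', i', j'⟩ h' _ hq
      simp only [Finset.mem_sigma, Finset.mem_range, Finset.HasAntidiagonal.mem_antidiagonal] at h h'
      simp only [Prod.mk.injEq] at hq
      obtain ⟨rfl, rfl⟩ := hq
      obtain rfl : n = n' := by omega
      rfl
    · rintro ⟨i, j⟩ _ hne
      have hij : i + j ≤ w.length := by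
        by_contra hlt
        exact hne ((hx i).mul (hy j) w (by omega))
      refine ⟨⟨i + j, i, j⟩, ?_, hne, rfl⟩
      simp only [Finset.mem_sigma, Finset.mem_range, Finset.HasAntidiagonal.mem_antidiagonal, and_true]
      omega
    · intros
      rfl
  · rw [← Finset.HasAntidiagonal.mem_antidiagonal.1 hp]
    exact (hx _).mul (hy _)

theorem gradedSum_eq_mul {x : ℕ → Series X} (hx : ∀ k, OrdGE k (x k)) (R : Series X) :
    gradedSum (fun k => x k * R) = gradedSum x * R := by
  refine eq_of_forall_eqUpTo fun N => ?_
  refine (gradedSum_eqUpTo (fun k => (hx k).mul (ordGE_zero R)) N le_rfl).trans ?_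
  rw [← Finset.sum_mul]
  exact ((gradedSum_eqUpTo hx N le_rfl).mul (EqUpTo.refl N R)).symm

end Series

open Series

/-! ### Exponential, logarithm and conjugation -/

section ExpLog

variable {X : Type*}

theorem seriesExp_eq_gradedSum (A : Series X) :
    seriesExp A = gradedSum fun k => ((k.factorial : ℂ)⁻¹) • A ^ k := rfl

theorem opExp_eq_gradedSum (D : Series X → Series X) (R : Series X) :
    opExp D R = gradedSum fun k => ((k.factorial : ℂ)⁻¹) • D^[k] R := rfl

theorem ordGE_expTerm {A : Series X} (hA : A [] = 0) (k : ℕ) :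
    OrdGE k (((k.factorial : ℂ)⁻¹) • A ^ k) := (OrdGE.pow hA k).smul _

theorem ordGE_ad_iterate {A : Series X} (hA : A [] = 0) (R : Series X) (k : ℕ) :
    OrdGE k ((ad A)^[k] R) := by
  induction k with
  | zero => exact ordGE_zero _
  | succ k ih =>
    rw [Function.iterate_succ_apply']
    refine OrdGE.sub ?_ (ih.mul (ordGE_one hA))
    rw [add_comm]
    exact (ordGE_one hA).mul ih

theorem seriesExp_nil (A : Series X) : seriesExp A [] = 1 := by
  simp [seriesExp]

theorem inv_factorial_mul_choose {n i j : ℕ} (h : i + j = n) :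
    ((n.factorial : ℂ)⁻¹) * (n.choose i : ℂ) = (i.factorial : ℂ)⁻¹ * (j.factorial : ℂ)⁻¹ := by
  subst h
  have h2 : ((i + j).choose i : ℂ) * i.factorial * j.factorial = (i + j).factorial := by
    rw [Nat.choose_symm_add]
    exact_mod_cast Nat.add_choose_mul_factorial_mul_factorial i j
  have hi : (i.factorial : ℂ) ≠ 0 := by exact_mod_cast i.factorial_ne_zero
  have hj : (j.factorial : ℂ) ≠ 0 := by exact_mod_cast j.factorial_ne_zero
  have hij : ((i + j).factorial : ℂ) ≠ 0 := by exact_mod_cast (i + j).factorial_ne_zero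
  field_simp
  rw [← h2]

theorem seriesExp_add_of_commute {A B : Series X} (hA : A [] = 0) (hB : B [] = 0)
    (h : Commute A B) : seriesExp (A + B) = seriesExp A * seriesExp B := by
  simp only [seriesExp_eq_gradedSum]
  rw [gradedSum_mul (ordGE_expTerm hA) (ordGE_expTerm hB)]
  congr 1
  funext n
  rw [h.add_pow', Finset.smul_sum]
  refine Finset.sum_congr rfl fun p hp => ?_
  rw [smul_mul_smul_comm,
    ← inv_factorial_mul_choose (Finset.HasAntidiagonal.mem_antidiagonal.1 hp), mul_smul,
    Nat.cast_smul_eq_nsmul]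

theorem seriesExp_zero : seriesExp (0 : Series X) = 1 := by
  refine eq_of_forall_eqUpTo fun N => ?_
  rw [seriesExp_eq_gradedSum]
  refine (gradedSum_eqUpTo (ordGE_expTerm (zero_apply _)) N le_rfl).trans ?_
  rw [Finset.sum_range_succ']
  simp [EqUpTo.refl]

theorem seriesExp_mul_neg {A : Series X} (hA : A [] = 0) :
    seriesExp A * seriesExp (-A) = 1 := by
  rw [← seriesExp_add_of_commute hA (by simp [hA]) (Commute.neg_right (Commute.refl A)),
    add_neg_cancel, seriesExp_zero]

theorem seriesExp_neg_mul {A : Series X} (hA : A [] = 0) :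
    seriesExp (-A) * seriesExp A = 1 := by
  simpa using seriesExp_mul_neg (A := -A) (by simp [hA])

/-- `A ^ n R` is expanded by the binomial theorem, left multiplication by `A` being the sum of the
commuting operators `ad A` and right multiplication by `A`. -/
theorem pow_mul_eq_sum_ad (A R : Series X) (n : ℕ) :
    A ^ n * R = ∑ p ∈ Finset.HasAntidiagonal.antidiagonal n,
      n.choose p.1 • ((ad A)^[p.1] R * A ^ p.2) := by
  have had : ⇑(LinearMap.mulLeft ℂ A - LinearMap.mulRight ℂ A) = ad A := by
    funext T
    simp [ad]
  have hcomm : Commute (LinearMap.mulLeft ℂ A - LinearMap.mulRight ℂ A)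
      (LinearMap.mulRight ℂ A) :=
    (LinearMap.commute_mulLeft_right A A).sub_left (Commute.refl _)
  have h := congrArg (fun f => f R) (hcomm.add_pow' n)
  rw [sub_add_cancel, LinearMap.pow_mulLeft, LinearMap.sum_apply] at h
  simp only [LinearMap.mulLeft_apply] at h
  rw [h]
  refine Finset.sum_congr rfl fun p _ => ?_
  rw [(hcomm.pow_pow p.1 p.2).eq, LinearMap.smul_apply, Module.End.mul_apply,
    LinearMap.pow_mulRight, LinearMap.mulRight_apply, Module.End.pow_apply, had]

theorem opExp_ad_mul_seriesExp {A : Series X} (hA : A [] = 0) (R : Series X) :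
    opExp (ad A) R * seriesExp A = seriesExp A * R := by
  rw [opExp_eq_gradedSum, seriesExp_eq_gradedSum,
    gradedSum_mul (fun k => (ordGE_ad_iterate hA R k).smul _) (ordGE_expTerm hA),
    ← gradedSum_eq_mul (ordGE_expTerm hA)]
  congr 1
  funext n
  rw [smul_mul_assoc, pow_mul_eq_sum_ad, Finset.smul_sum]
  refine Finset.sum_congr rfl fun p hp => ?_
  rw [smul_mul_smul_comm,
    ← inv_factorial_mul_choose (Finset.HasAntidiagonal.mem_antidiagonal.1 hp), mul_smul,
    Nat.cast_smul_eq_nsmul]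

theorem opExp_ad_eq {A : Series X} (hA : A [] = 0) (R : Series X) :
    opExp (ad A) R = seriesExp A * R * seriesExp (-A) := by
  rw [← opExp_ad_mul_seriesExp hA, mul_assoc, seriesExp_mul_neg hA, mul_one]

theorem seriesLog_nil (S : Series X) : seriesLog S [] = 0 := by
  simp [seriesLog]

open Polynomial in
/-- The truncated series of `log (1 + X)`. -/
def logPoly (N : ℕ) : ℂ[X] := ∑ k ∈ Finset.Icc 1 N, C ((-1 : ℂ) ^ (k + 1) / k) * Polynomial.X ^ k

open Polynomial in
/-- The truncated series of `exp`. -/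
def expPoly (N : ℕ) : ℂ[X] :=
  ∑ k ∈ Finset.range (N + 1), C ((k.factorial : ℂ)⁻¹) * Polynomial.X ^ k

open Polynomial in
theorem derivative_expPoly (N : ℕ) : derivative (expPoly (N + 1)) = expPoly N := by
  rw [expPoly, Finset.sum_range_succ', expPoly]
  simp only [derivative_add, derivative_sum, derivative_C_mul, derivative_X_pow]
  simp only [Nat.factorial_zero, Nat.cast_zero, C_0, zero_mul, mul_zero, add_zero]
  refine Finset.sum_congr rfl fun k _ => ?_
  rw [← mul_assoc, ← C_mul, Nat.add_sub_cancel, Nat.factorial_succ]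
  congr 2
  have : ((k : ℂ) + 1) ≠ 0 := by exact_mod_cast k.succ_ne_zero
  push_cast
  field_simp

open Polynomial in
theorem derivative_logPoly_mul (N : ℕ) :
    derivative (logPoly N) * (1 + Polynomial.X) = 1 - C ((-1) ^ N) * Polynomial.X ^ N := by
  induction N with
  | zero => simp [logPoly]
  | succ N ih =>
    rw [logPoly, Finset.sum_Icc_succ_top (by omega), ← logPoly, derivative_add, add_mul, ih,
      derivative_C_mul, derivative_X_pow]
    have h : C ((-1 : ℂ) ^ (N + 1 + 1) / ((N + 1 : ℕ) : ℂ)) * (C ((N + 1 : ℕ) : ℂ)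
        * Polynomial.X ^ (N + 1 - 1)) = C ((-1) ^ N) * Polynomial.X ^ N := by
      rw [← mul_assoc, ← C_mul, Nat.add_sub_cancel]
      congr 2
      have : ((N + 1 : ℕ) : ℂ) ≠ 0 := by exact_mod_cast N.succ_ne_zero
      field_simp
      ring
    rw [h]
    have h2 : C ((-1 : ℂ) ^ (N + 1)) = - C ((-1) ^ N) := by rw [pow_succ]; simp
    rw [h2]
    ring

open Polynomial in
/-- `exp (log (1 + X)) = 1 + X` up to degree `N`: both sides solve `(1 + X) Q' = Q`. -/
theorem coeff_expPoly_comp_logPoly (N k : ℕ) (hk : k ≤ N) :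
    ((expPoly N).comp (logPoly N)).coeff k = (1 + Polynomial.X : ℂ[X]).coeff k := by
  have hX : Polynomial.X ∣ logPoly N := by
    refine Finset.dvd_sum fun i hi => Dvd.dvd.mul_left (dvd_pow_self _ ?_) _
    have := (Finset.mem_Icc.1 hi).1
    omega
  have hL0 : (logPoly N).eval 0 = 0 := by
    rw [← coeff_zero_eq_eval_zero]
    exact X_dvd_iff.1 hX
  induction k with
  | zero =>
    rw [coeff_zero_eq_eval_zero, eval_comp, hL0]
    simp [expPoly, eval_finsetSum, Finset.sum_range_succ']
  | succ k ih =>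
    obtain ⟨M, rfl⟩ : ∃ M, N = M + 1 := ⟨N - 1, by omega⟩
    have ih' := ih (by omega)
    set Q := (expPoly (M + 1)).comp (logPoly (M + 1)) with hQ
    have hsplit : expPoly (M + 1)
        = expPoly M + C (((M + 1).factorial : ℂ)⁻¹) * Polynomial.X ^ (M + 1) :=
      Finset.sum_range_succ _ _
    -- `(1 + X) Q' = Q` modulo `X ^ N`
    have hode : (Polynomial.X : ℂ[X]) ^ (M + 1) ∣ derivative Q * (1 + Polynomial.X) - Q := by
      have h1 : derivative Q * (1 + Polynomial.X) = (expPoly M).comp (logPoly (M + 1))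
          * (1 - C ((-1) ^ (M + 1)) * Polynomial.X ^ (M + 1)) := by
        rw [hQ, derivative_comp, derivative_expPoly, ← derivative_logPoly_mul]
        ring
      have h2 : Q = (expPoly M).comp (logPoly (M + 1))
          + C (((M + 1).factorial : ℂ)⁻¹) * logPoly (M + 1) ^ (M + 1) := by
        rw [hQ, hsplit]
        simp
      obtain ⟨T, hT⟩ := pow_dvd_pow_of_dvd hX (M + 1)
      rw [h1, h2, hT]
      refine ⟨-((expPoly M).comp (logPoly (M + 1)) * C ((-1) ^ (M + 1)))
        - C (((M + 1).factorial : ℂ)⁻¹) * T, ?_⟩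
      ring
    have hc := (X_pow_dvd_iff.1 hode) k (by omega)
    have hc2 : (derivative Q * (1 + Polynomial.X)).coeff k
        = Q.coeff (k + 1) * (k + 1) + Q.coeff k * k := by
      rw [mul_add, mul_one, coeff_add, coeff_derivative]
      congr 1
      cases k with
      | zero => simp
      | succ j => rw [coeff_mul_X, coeff_derivative]; push_cast; rfl
    rw [coeff_sub, hc2, ih'] at hc
    have hne : ((k : ℂ) + 1) ≠ 0 := by exact_mod_cast k.succ_ne_zero
    apply mul_right_cancel₀ hne
    rcases k with _ | _ | j
    · simp [coeff_one, coeff_X] at hc ⊢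
      linear_combination hc
    · simp [coeff_one, coeff_X] at hc ⊢
      linear_combination hc
    · simpa [coeff_one, coeff_X] using hc

open Polynomial in
theorem seriesExp_seriesLog {S : Series X} (hS : S [] = 1) : seriesExp (seriesLog S) = S := by
  have hN : (S - 1) [] = 0 := by simp [hS]
  refine eq_of_forall_eqUpTo fun N => ?_
  have hlog : EqUpTo N (seriesLog S) (aeval (S - 1) (logPoly N)) := fun w hw => by
    simp only [logPoly, map_sum, map_mul, aeval_C, map_pow, aeval_X, sum_apply,
      ← Algebra.smul_def, smul_apply]
    refine Finset.sum_subset (Finset.Icc_subset_Icc_right hw) fun k hk hk' => ?_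
    rw [OrdGE.pow hN k w (by simp at hk hk'; omega), mul_zero]
  have hpow : ∀ k, EqUpTo N (seriesLog S ^ k) (aeval (S - 1) (logPoly N) ^ k) := by
    intro k
    induction k with
    | zero => simpa using EqUpTo.refl N _
    | succ k ih => rw [pow_succ, pow_succ]; exact ih.mul hlog
  have hexp : EqUpTo N (seriesExp (seriesLog S))
      (aeval (S - 1) ((expPoly N).comp (logPoly N))) := by
    rw [seriesExp_eq_gradedSum]
    refine (gradedSum_eqUpTo (ordGE_expTerm (seriesLog_nil S)) N le_rfl).trans ?_
    rw [aeval_comp]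
    simp only [expPoly, map_sum, map_mul, aeval_C, map_pow, aeval_X, ← Algebra.smul_def]
    exact EqUpTo.sum fun k _ => (hpow k).smul _
  refine hexp.trans ?_
  obtain ⟨T, hT⟩ : (Polynomial.X : ℂ[X]) ^ (N + 1)
      ∣ (expPoly N).comp (logPoly N) - (1 + Polynomial.X) := by
    rw [X_pow_dvd_iff]
    intro k hk
    rw [coeff_sub, coeff_expPoly_comp_logPoly N k (by omega), sub_self]
  intro w hw
  rw [eq_add_of_sub_eq hT]
  simp only [map_add, map_mul, map_pow, aeval_X, map_one, add_apply]
  rw [((OrdGE.pow hN (N + 1)).mul (ordGE_zero _)) w (by omega)]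
  simp

theorem ringInverse_eq_of_mul_eq_one {S R : Series X} (h : S * R = 1) (h' : R * S = 1) :
    Ring.inverse S = R := Ring.inverse_unit ⟨S, R, h, h'⟩

theorem ringInverse_eq {S : Series X} (hS : S [] = 1) :
    Ring.inverse S = seriesExp (-seriesLog S) := by
  refine ringInverse_eq_of_mul_eq_one ?_ ?_
  · conv_lhs => rw [← seriesExp_seriesLog hS]
    rw [seriesExp_seriesLog hS]
    exact (congrArg (· * seriesExp (-seriesLog S)) (seriesExp_seriesLog hS)).symm.trans
      (seriesExp_mul_neg (seriesLog_nil S))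
  · exact (congrArg (seriesExp (-seriesLog S) * ·) (seriesExp_seriesLog hS)).symm.trans
      (seriesExp_neg_mul (seriesLog_nil S))

theorem ringInverse_mul_self {S : Series X} (hS : S [] = 1) : Ring.inverse S * S = 1 := by
  rw [ringInverse_eq hS]
  exact (congrArg (seriesExp (-seriesLog S) * ·) (seriesExp_seriesLog hS)).symm.trans
    (seriesExp_neg_mul (seriesLog_nil S))

theorem mul_ringInverse_self {S : Series X} (hS : S [] = 1) : S * Ring.inverse S = 1 := by
  rw [ringInverse_eq hS]
  exact (congrArg (· * seriesExp (-seriesLog S)) (seriesExp_seriesLog hS)).symm.trans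
    (seriesExp_mul_neg (seriesLog_nil S))

theorem ringInverse_seriesExp {A : Series X} (hA : A [] = 0) :
    Ring.inverse (seriesExp A) = seriesExp (-A) :=
  ringInverse_eq_of_mul_eq_one (seriesExp_mul_neg hA) (seriesExp_neg_mul hA)

theorem opExp_ad_neg_seriesLog {S : Series X} (hS : S [] = 1) (R : Series X) :
    opExp (ad (-seriesLog S)) R = Ring.inverse S * R * S := by
  rw [opExp_ad_eq (by simp [seriesLog_nil]), neg_neg, seriesExp_seriesLog hS, ringInverse_eq hS]

end ExpLog

/-! ### Lyndon words -/

section LyndonWords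

variable {X : Type*} [LinearOrder X]

theorem list_le_append (x y : List X) : x ≤ x ++ y := by
  induction x with
  | nil => exact not_lt.1 (List.not_lt_nil _)
  | cons a x ih =>
    refine not_lt.1 fun h => ?_
    rw [List.cons_append, List.cons_lt_cons_iff] at h
    rcases h with h | h
    · exact lt_irrefl _ h
    · exact absurd h.2 (not_lt.2 ih)

theorem list_lt_append (x : List X) {y : List X} (hy : y ≠ []) : x < x ++ y :=
  lt_of_le_of_ne (list_le_append x y) fun h => hy (by simpa using h)

theorem list_append_lt_append_iff (u x y : List X) : u ++ x < u ++ y ↔ x < y := by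
  induction u with
  | nil => rfl
  | cons a u ih => simp [ih]

theorem list_append_lt_append {u v : List X} (h : u < v) (hp : ¬ u <+: v) (x y : List X) :
    u ++ x < v ++ y := by
  induction u generalizing v with
  | nil => exact absurd List.nil_prefix hp
  | cons a u ih =>
    cases v with
    | nil => exact absurd h (List.not_lt_nil _)
    | cons b v =>
      rw [List.cons_append, List.cons_append, List.cons_lt_cons_iff]
      rcases List.cons_lt_cons_iff.1 h with h' | ⟨rfl, h'⟩
      · exact Or.inl h'
      · exact Or.inr ⟨rfl, ih h' fun hpre => hp (List.cons_prefix_cons.2 ⟨rfl, hpre⟩)⟩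

theorem IsLyndon.lt_of_append {u v : List X} (h : IsLyndon (u ++ v)) (hu : u ≠ []) (hv : v ≠ []) :
    u ++ v < v := h.2 u v hu hv rfl

theorem IsLyndon.le_of_append {u v : List X} (h : IsLyndon (u ++ v)) (hv : v ≠ []) :
    u ++ v ≤ v := by
  rcases eq_or_ne u [] with rfl | hu
  · exact le_rfl
  · exact (h.lt_of_append hu hv).le

theorem isLyndon_singleton (a : X) : IsLyndon [a] := by
  refine ⟨List.cons_ne_nil _ _, fun u v hu hv h => ?_⟩
  have h1 := congrArg List.length h
  have := List.length_pos_of_ne_nil hu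
  have := List.length_pos_of_ne_nil hv
  simp at h1
  omega

theorem IsLyndon.append {l m : List X} (hl : IsLyndon l) (hm : IsLyndon m) (h : l < m) :
    IsLyndon (l ++ m) := by
  have key : l ++ m < m := by
    by_cases hp : l <+: m
    · obtain ⟨m', rfl⟩ := hp
      have hm' : m' ≠ [] := by
        rintro rfl
        simp at h
      rw [list_append_lt_append_iff]
      exact hm.lt_of_append hl.1 hm'
    · simpa using list_append_lt_append h hp m []
  refine ⟨by simp [hl.1], fun u v hu hv huv => ?_⟩
  rcases List.append_eq_append_iff.1 huv with ⟨s, rfl, rfl⟩ | ⟨s, rfl, rfl⟩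
  · -- the suffix lies inside `m`
    exact lt_of_lt_of_le key (hm.le_of_append hv)
  · -- the suffix is `s ++ m`, where `s` is a suffix of `l`
    rcases eq_or_ne s [] with rfl | hs
    · simpa using key
    · refine list_append_lt_append (hl.lt_of_append hu hs) (fun hp => ?_) m m
      have h1 := hp.length_le
      have := List.length_pos_of_ne_nil hu
      rw [List.length_append] at h1
      omega

/-- A nonincreasing sequence of Lyndon words. -/
def IsLyndonFactorization (F : List (List X)) : Prop :=
  (∀ l ∈ F, IsLyndon l) ∧ F.Pairwise fun a b => b ≤ a

theorem isLyndonFactorization_cons {l : List X} {F : List (List X)} :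
    IsLyndonFactorization (l :: F)
      ↔ IsLyndon l ∧ (∀ m ∈ F, m ≤ l) ∧ IsLyndonFactorization F := by
  simp only [IsLyndonFactorization, List.forall_mem_cons, List.pairwise_cons]
  tauto

theorem isLyndonFactorization_concat {m : List X} {F : List (List X)} :
    IsLyndonFactorization (F ++ [m])
      ↔ IsLyndonFactorization F ∧ IsLyndon m ∧ ∀ l ∈ F, m ≤ l := by
  simp only [IsLyndonFactorization, List.forall_mem_append, List.pairwise_append,
    List.forall_mem_singleton, List.pairwise_singleton, true_and]
  tauto

theorem exists_factorization_append {F : List (List X)} (hF : IsLyndonFactorization F)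
    {l : List X} (hl : IsLyndon l) :
    ∃ G, IsLyndonFactorization G ∧ G.flatten = l ++ F.flatten := by
  induction F generalizing l with
  | nil => exact ⟨[l], by simp [IsLyndonFactorization, hl], by simp⟩
  | cons m F ih =>
    rw [isLyndonFactorization_cons] at hF
    rcases lt_or_ge l m with h | h
    · obtain ⟨G, hG, hGf⟩ := ih hF.2.2 (hl.append hF.1 h)
      exact ⟨G, hG, by simp [hGf]⟩
    · refine ⟨l :: m :: F, isLyndonFactorization_cons.2 ⟨hl, ?_, isLyndonFactorization_cons.2 hF⟩,
        by simp⟩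
      rintro x (_ | ⟨_, hx⟩)
      · exact h
      · exact (hF.2.1 x hx).trans h

theorem exists_factorization (w : List X) :
    ∃ F, IsLyndonFactorization F ∧ F.flatten = w := by
  induction w with
  | nil => exact ⟨[], by simp [IsLyndonFactorization], rfl⟩
  | cons a w ih =>
    obtain ⟨F, hF, rfl⟩ := ih
    obtain ⟨G, hG, hGf⟩ := exists_factorization_append hF (isLyndon_singleton a)
    exact ⟨G, hG, by simpa using hGf⟩

theorem exists_suffix_le_of_prefix_flatten {F : List (List X)} {q : List X} (hq : q ≠ [])
    (h : q <+: F.flatten) : ∃ r s, q = r ++ s ∧ s ≠ [] ∧ ∃ g ∈ F, s ≤ g := by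
  induction F generalizing q with
  | nil => exact absurd (List.prefix_nil.1 h) hq
  | cons g F ih =>
    obtain ⟨t, ht⟩ := h
    rw [List.flatten_cons] at ht
    rcases List.append_eq_append_iff.1 ht with ⟨s, rfl, -⟩ | ⟨s, rfl, hs⟩
    · exact ⟨[], q, rfl, hq, q ++ s, by simp, list_le_append _ _⟩
    · rcases eq_or_ne s [] with rfl | hne
      · exact ⟨[], g ++ [], rfl, hq, g, by simp, by simp⟩
      · obtain ⟨r, s', rfl, hs', g', hg', hle⟩ := ih hne ⟨t, hs.symm⟩
        exact ⟨g ++ r, s', by simp, hs', g', by simp [hg'], hle⟩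

theorem le_of_suffix_flatten {F : List (List X)} (hF : ∀ l ∈ F, IsLyndon l) {m : List X}
    (hm : ∀ l ∈ F, m ≤ l) {x y : List X} (hy : y ≠ []) (h : F.flatten = x ++ y) : m ≤ y := by
  induction F generalizing x with
  | nil => simp at h; exact absurd h.2 hy
  | cons g F ih =>
    rw [List.forall_mem_cons] at hF hm
    rw [List.flatten_cons] at h
    rcases List.append_eq_append_iff.1 h with ⟨s, rfl, hs⟩ | ⟨s, rfl, rfl⟩
    · exact ih hF.2 hm.2 hs
    · rcases eq_or_ne s [] with rfl | hne
      · exact ih hF.2 hm.2 (x := []) (by simp)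
      · exact hm.1.trans ((hF.1.le_of_append hne).trans (list_le_append _ _))

/-- The longest Lyndon prefix of a nonincreasing product of Lyndon words is the first factor. -/
theorem lyndonPrefixLength_flatten {l : List X} {F : List (List X)}
    (hF : IsLyndonFactorization (l :: F)) :
    lyndonPrefixLength (l :: F).flatten = l.length := by
  classical
  rw [isLyndonFactorization_cons] at hF
  rw [lyndonPrefixLength, Nat.findGreatest_eq_iff]
  refine ⟨by simp, fun _ => by simpa using hF.1, fun n hn hn' hlyn => ?_⟩
  rw [List.flatten_cons, List.take_append, List.take_of_length_le hn.le] at hlyn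
  rw [List.flatten_cons, List.length_append] at hn'
  have hq : F.flatten.take (n - l.length) ≠ [] := by
    rw [← List.length_pos_iff_ne_nil, List.length_take]
    omega
  obtain ⟨r, s, hrs, hs, g, hg, hle⟩ :=
    exists_suffix_le_of_prefix_flatten hq (List.take_prefix _ _)
  rw [hrs, ← List.append_assoc] at hlyn
  have h1 := hlyn.lt_of_append (by simp [hF.1.1]) hs
  have h2 : l ≤ l ++ r ++ s := by rw [List.append_assoc]; exact list_le_append _ _
  exact absurd (h2.trans_lt h1) (not_lt.2 (hle.trans (hF.2.1 g hg)))

theorem lyndonFactorsAux_flatten {F : List (List X)} (hF : IsLyndonFactorization F) {m : ℕ}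
    (hm : F.flatten.length ≤ m) : lyndonFactorsAux m F.flatten = F := by
  induction F generalizing m with
  | nil => cases m <;> rfl
  | cons l F ih =>
    have hlen := lyndonPrefixLength_flatten hF
    rw [isLyndonFactorization_cons] at hF
    have hl := List.length_pos_of_ne_nil hF.1.1
    have hsplit : (l :: F).flatten = l ++ F.flatten := List.flatten_cons
    have hlen' := congrArg List.length hsplit
    rw [List.length_append] at hlen'
    obtain ⟨m, rfl⟩ : ∃ k, m = k + 1 := ⟨m - 1, by omega⟩
    obtain ⟨x, v, hxv⟩ : ∃ x v, (l :: F).flatten = x :: v :=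
      List.exists_cons_of_length_pos (by omega)
    rw [hxv, lyndonFactorsAux, ← hxv, hlen, hsplit, List.take_left, List.drop_left,
      ih hF.2.2 (by omega)]

theorem lyndonFactors_flatten {F : List (List X)} (hF : IsLyndonFactorization F) :
    lyndonFactors F.flatten = F := lyndonFactorsAux_flatten hF le_rfl

theorem isLyndonFactorization_lyndonFactors (w : List X) :
    IsLyndonFactorization (lyndonFactors w) := by
  obtain ⟨F, hF, rfl⟩ := exists_factorization w
  rwa [lyndonFactors_flatten hF]

theorem flatten_lyndonFactors (w : List X) : (lyndonFactors w).flatten = w := by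
  obtain ⟨F, hF, rfl⟩ := exists_factorization w
  rw [lyndonFactors_flatten hF]

theorem lyndonFactors_of_isLyndon {l : List X} (hl : IsLyndon l) : lyndonFactors l = [l] := by
  have h := lyndonFactors_flatten (F := [l]) (by simp [IsLyndonFactorization, hl])
  simpa using h

theorem lyndonFactors_append {w m : List X} (hm : IsLyndon m)
    (h : ∀ l ∈ lyndonFactors w, m ≤ l) : lyndonFactors (w ++ m) = lyndonFactors w ++ [m] := by
  have h' := lyndonFactors_flatten (isLyndonFactorization_concat.2
    ⟨isLyndonFactorization_lyndonFactors w, hm, h⟩)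
  simpa [flatten_lyndonFactors] using h'

/-- The factors of the tail of a Lyndon word are larger than the word. -/
theorem lt_of_mem_lyndonFactors_tail {a : X} {v : List X} (h : IsLyndon (a :: v)) {x : List X}
    (hx : x ∈ lyndonFactors v) : a :: v < x := by
  have hv := flatten_lyndonFactors v
  have hF := isLyndonFactorization_lyndonFactors v
  obtain ⟨F, m, hFm⟩ : ∃ F m, lyndonFactors v = F ++ [m] :=
    ⟨_, _, (List.dropLast_append_getLast (List.ne_nil_of_mem hx)).symm⟩
  rw [hFm] at hv hF hx
  rw [isLyndonFactorization_concat] at hF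
  have hlt : a :: v < m := by
    refine h.2 (a :: F.flatten) m (List.cons_ne_nil _ _) hF.2.1.1 ?_
    rw [← hv]
    simp
  rcases List.mem_append.1 hx with hx | hx
  · exact hlt.trans_le (hF.2.2 x hx)
  · rw [List.mem_singleton.1 hx]
    exact hlt

/-- A nonempty suffix of a nonincreasing product of Lyndon words that are `≥ m` stays above `m`
when `m` is appended. -/
theorem lt_suffix_append {F : List (List X)} {m : List X} (hF : IsLyndonFactorization (F ++ [m]))
    {x y : List X} (hy : y ≠ []) (h : F.flatten = x ++ y) : m < y ++ m := by
  rw [isLyndonFactorization_concat] at hF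
  exact (le_of_suffix_flatten hF.1.1 hF.2.2 hy h).trans_lt (list_lt_append y hF.2.1.1)

/-- Removing the last factor of the tail of a Lyndon word leaves a Lyndon word. -/
theorem isLyndon_of_cons_flatten_append {a : X} {F : List (List X)} {m : List X}
    (hF : IsLyndonFactorization (F ++ [m])) (h : IsLyndon (a :: (F.flatten ++ m))) :
    IsLyndon (a :: F.flatten) := by
  refine ⟨List.cons_ne_nil _ _, fun u s hu hs hus => ?_⟩
  by_contra hcon
  have h1 : (u ++ s) ++ m < s ++ m := by
    have hsplit : a :: (F.flatten ++ m) = u ++ (s ++ m) := by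
      rw [← List.append_assoc, ← hus, List.cons_append]
    rw [List.append_assoc, ← hsplit]
    exact h.2 u (s ++ m) hu (by simp [hs]) hsplit
  rw [← hus] at h1
  have hne : s ≠ a :: F.flatten := fun he => by
    rw [he] at hus
    exact hu (by simpa using hus)
  have hlt : s < a :: F.flatten := lt_of_le_of_ne (not_lt.1 hcon) hne
  -- `s` must be a prefix of the word, and what follows it is below its own suffix `m`
  by_cases hp : s <+: a :: F.flatten
  · obtain ⟨y, hy⟩ := hp
    have hy0 : y ≠ [] := by
      rintro rfl
      exact hne (by simpa using hy)
    rw [← hy, List.append_assoc, list_append_lt_append_iff] at h1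
    cases s with
    | nil => exact hs rfl
    | cons b s =>
      have hy' : F.flatten = s ++ y := by
        have := congrArg List.tail hy
        simpa using this.symm
      exact lt_asymm h1 (lt_suffix_append hF hy0 hy')
  · exact lt_asymm h1 (list_append_lt_append hlt hp m m)

theorem stdIndex_cons_flatten_append {a : X} {F : List (List X)} {m : List X}
    (hF : IsLyndonFactorization (F ++ [m])) :
    stdIndex (a :: (F.flatten ++ m)) = F.flatten.length + 1 := by
  refine IsLeast.csInf_eq ⟨⟨Nat.succ_pos _, ?_⟩, ?_⟩
  · simpa using (isLyndonFactorization_concat.1 hF).2.1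
  · rintro i ⟨hi, hlyn⟩
    by_contra hlt
    obtain ⟨j, rfl⟩ : ∃ j, i = j + 1 := ⟨i - 1, by omega⟩
    rw [List.drop_succ_cons, List.drop_append_of_le_length (by omega)] at hlyn
    have hy : F.flatten.drop j ≠ [] := by
      rw [← List.length_pos_iff_ne_nil, List.length_drop]
      omega
    exact lt_asymm (hlyn.lt_of_append hy (isLyndonFactorization_concat.1 hF).2.1.1)
      (lt_suffix_append hF hy (List.take_append_drop j _).symm)

theorem lyndonP_singleton (a : X) : lyndonP [a] = letter a := by
  rw [lyndonP]

/-- The standard factorisation of a Lyndon word splits off the last factor of its tail. -/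
theorem lyndonP_cons_flatten_append {a : X} {F : List (List X)} {m : List X}
    (hF : IsLyndonFactorization (F ++ [m])) :
    lyndonP (a :: (F.flatten ++ m)) = ad (lyndonP (a :: F.flatten)) (lyndonP m) := by
  have hm := List.length_pos_of_ne_nil (isLyndonFactorization_concat.1 hF).2.1.1
  have hidx := stdIndex_cons_flatten_append (a := a) hF
  obtain ⟨y, v, hyv⟩ : ∃ y v, F.flatten ++ m = y :: v :=
    List.exists_cons_of_length_pos (by rw [List.length_append]; omega)
  rw [hyv] at hidx
  rw [hyv, lyndonP, hidx, ← hyv, dif_pos ⟨by omega, by simp; omega⟩]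
  simp

theorem lyndonP_apply_of_length_ne (l w : List X) (h : w.length ≠ l.length) :
    lyndonP l w = 0 := by
  induction hn : l.length using Nat.strong_induction_on generalizing l w with
  | _ n ih =>
    have hmul : ∀ (l₁ l₂ : List X), l₁.length < n → l₂.length < n → l₁.length + l₂.length = n →
        (lyndonP l₁ * lyndonP l₂) w = 0 := by
      intro l₁ l₂ h₁ h₂ h₁₂
      rw [mul_apply]
      refine Finset.sum_eq_zero fun i hi => ?_
      rw [Finset.mem_range] at hi
      by_cases hi' : i = l₁.length
      · rw [ih _ h₂ l₂ (w.drop i) (by rw [List.length_drop]; omega) rfl, mul_zero]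
      · rw [ih _ h₁ l₁ (w.take i) (by rw [List.length_take]; omega) rfl, zero_mul]
    match l, hn with
    | [], _ => rw [lyndonP]; rfl
    | [t], _ =>
      rw [lyndonP, letter, if_neg]
      rintro rfl
      exact h rfl
    | x :: y :: v, hn =>
      rw [lyndonP]
      split_ifs with hs
      · rw [ad, sub_apply, hmul _ _ _ _ _, hmul _ _ _ _ _, sub_zero] <;>
          simp only [List.length_take, List.length_drop] <;> omega
      · rfl

theorem ordGE_lyndonP (l : List X) : OrdGE l.length (lyndonP l) := fun w hw =>
  lyndonP_apply_of_length_ne l w hw.ne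

theorem lyndonP_nil_apply (l : List X) : lyndonP l [] = 0 := by
  cases l with
  | nil => rw [lyndonP]; rfl
  | cons x l => exact lyndonP_apply_of_length_ne _ _ (by simp)

end LyndonWords

/-! ### Calculus on the unit interval -/

theorem hasDerivWithinAt_integral_Icc {f : ℝ → ℂ} (hf : ContinuousOn f (Icc 0 1)) {τ : ℝ}
    (hτ : τ ∈ Icc (0 : ℝ) 1) :
    HasDerivWithinAt (fun s => ∫ x in (0 : ℝ)..s, f x) (f τ) (Icc 0 1) τ := by
  set g : ℝ → ℂ := IccExtend zero_le_one ((Icc (0 : ℝ) 1).domRestrict f) with hg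
  have hgc : Continuous g := (continuousOn_iff_continuous_domRestrict.1 hf).Icc_extend'
  have hfg : ∀ s ∈ Icc (0 : ℝ) 1, g s = f s := fun s hs => by
    rw [hg, IccExtend_of_mem _ _ hs]
    rfl
  have h := (hgc.integral_hasStrictDerivAt 0 τ).hasDerivAt.hasDerivWithinAt (s := Icc (0 : ℝ) 1)
  rw [hfg τ hτ] at h
  refine h.congr_of_mem (fun s hs => intervalIntegral.integral_congr fun x hx => ?_) hτ
  rw [uIcc_of_le hs.1] at hx
  exact (hfg x ⟨hx.1, hx.2.trans hs.2⟩).symm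

theorem eqOn_Icc_of_hasDerivWithinAt {F G D : ℝ → ℂ}
    (hF : ∀ τ ∈ Icc (0 : ℝ) 1, HasDerivWithinAt F (D τ) (Icc 0 1) τ)
    (hG : ∀ τ ∈ Icc (0 : ℝ) 1, HasDerivWithinAt G (D τ) (Icc 0 1) τ) (h0 : F 0 = G 0) :
    ∀ τ ∈ Icc (0 : ℝ) 1, F τ = G τ := by
  have hu : UniqueDiffOn ℝ (Icc (0 : ℝ) 1) := uniqueDiffOn_Icc zero_lt_one
  refine eq_of_derivWithin_eq (fun τ hτ => (hF τ hτ).differentiableWithinAt)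
    (fun τ hτ => (hG τ hτ).differentiableWithinAt) (fun τ hτ => ?_) h0
  have hτ' := Ico_subset_Icc_self hτ
  rw [(hF τ hτ').derivWithin (hu τ hτ'), (hG τ hτ').derivWithin (hu τ hτ')]

theorem intervalIntegrable_of_continuousOn_Icc {f : ℝ → ℂ} (hf : ContinuousOn f (Icc 0 1))
    {τ : ℝ} (hτ : τ ∈ Icc (0 : ℝ) 1) : IntervalIntegrable f MeasureTheory.volume 0 τ := by
  refine (hf.mono ?_).intervalIntegrable
  rw [uIcc_of_le hτ.1]
  exact Icc_subset_Icc_right hτ.2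

/-! ### Iterated integrals and the shuffle product -/

section Alpha

variable {X : Type*} {u : X → ℝ → ℂ}

@[simp] theorem alpha_nil (u : X → ℝ → ℂ) (τ : ℝ) : alpha u τ [] = 1 := rfl

theorem alpha_cons (u : X → ℝ → ℂ) (τ : ℝ) (t : X) (w : List X) :
    alpha u τ (t :: w) = ∫ s in (0 : ℝ)..τ, u t s * alpha u s w := rfl

theorem alpha_zero_cons (u : X → ℝ → ℂ) (t : X) (w : List X) : alpha u 0 (t :: w) = 0 := by
  rw [alpha_cons, intervalIntegral.integral_same]

theorem continuousOn_alpha (hu : ∀ t, ContinuousOn (u t) (Icc 0 1)) (w : List X) :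
    ContinuousOn (fun s => alpha u s w) (Icc 0 1) := by
  induction w with
  | nil => exact continuousOn_const
  | cons t w ih =>
    exact fun τ hτ => (hasDerivWithinAt_integral_Icc ((hu t).mul ih) hτ).continuousWithinAt

theorem hasDerivWithinAt_alpha_cons (hu : ∀ t, ContinuousOn (u t) (Icc 0 1)) (t : X) (w : List X)
    {τ : ℝ} (hτ : τ ∈ Icc (0 : ℝ) 1) :
    HasDerivWithinAt (fun s => alpha u s (t :: w)) (u t τ * alpha u τ w) (Icc 0 1) τ :=
  hasDerivWithinAt_integral_Icc ((hu t).mul (continuousOn_alpha hu w)) hτ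

theorem evalPoly_eq_linearCombination (a : List X → ℂ) (P : List X →₀ ℂ) :
    evalPoly a P = Finsupp.linearCombination ℂ a P := rfl

theorem evalPoly_single (a : List X → ℂ) (w : List X) (c : ℂ) :
    evalPoly a (Finsupp.single w c) = c * a w := by
  rw [evalPoly_eq_linearCombination, Finsupp.linearCombination_single, smul_eq_mul]

theorem evalPoly_add (a : List X → ℂ) (P Q : List X →₀ ℂ) :
    evalPoly a (P + Q) = evalPoly a P + evalPoly a Q := by
  simp only [evalPoly_eq_linearCombination, map_add]

theorem evalPoly_smul (a : List X → ℂ) (c : ℂ) (P : List X →₀ ℂ) :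
    evalPoly a (c • P) = c * evalPoly a P := by
  simp only [evalPoly_eq_linearCombination, map_smul, smul_eq_mul]

theorem evalPoly_mapDomain (a : List X → ℂ) (f : List X → List X) (P : List X →₀ ℂ) :
    evalPoly a (P.mapDomain f) = evalPoly (fun w => a (f w)) P := by
  simp only [evalPoly_eq_linearCombination, Finsupp.linearCombination_mapDomain]
  rfl

theorem continuousOn_evalPoly (hu : ∀ t, ContinuousOn (u t) (Icc 0 1)) (P : List X →₀ ℂ) :
    ContinuousOn (fun s => evalPoly (alpha u s) P) (Icc 0 1) :=
  continuousOn_finsetSum _ fun w _ => continuousOn_const.mul (continuousOn_alpha hu w)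

theorem hasDerivWithinAt_evalPoly_cons (hu : ∀ t, ContinuousOn (u t) (Icc 0 1)) (t : X)
    (P : List X →₀ ℂ) {τ : ℝ} (hτ : τ ∈ Icc (0 : ℝ) 1) :
    HasDerivWithinAt (fun s => evalPoly (alpha u s) (P.mapDomain (List.cons t)))
      (u t τ * evalPoly (alpha u τ) P) (Icc 0 1) τ := by
  simp only [evalPoly_mapDomain]
  have h : u t τ * evalPoly (alpha u τ) P
      = ∑ w ∈ P.support, P w * (u t τ * alpha u τ w) := by
    rw [evalPoly, Finsupp.sum, Finset.mul_sum]
    exact Finset.sum_congr rfl fun w _ => by ring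
  rw [h]
  exact HasDerivWithinAt.fun_sum fun w _ => (hasDerivWithinAt_alpha_cons hu t w hτ).const_mul _

theorem evalPoly_alpha_zero_cons (t : X) (P : List X →₀ ℂ) :
    evalPoly (alpha u 0) (P.mapDomain (List.cons t)) = 0 := by
  rw [evalPoly_mapDomain]
  exact Finset.sum_eq_zero fun w _ => by simp only [alpha_zero_cons, mul_zero]

theorem integral_mul_evalPoly (hu : ∀ t, ContinuousOn (u t) (Icc 0 1)) (t : X)
    (P : List X →₀ ℂ) {τ : ℝ} (hτ : τ ∈ Icc (0 : ℝ) 1) :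
    ∫ s in (0 : ℝ)..τ, u t s * evalPoly (alpha u s) P
      = evalPoly (alpha u τ) (P.mapDomain (List.cons t)) :=
  eqOn_Icc_of_hasDerivWithinAt
    (fun _ h => hasDerivWithinAt_integral_Icc ((hu t).mul (continuousOn_evalPoly hu P)) h)
    (fun _ h => hasDerivWithinAt_evalPoly_cons hu t P h)
    (by rw [intervalIntegral.integral_same, evalPoly_alpha_zero_cons]) τ hτ

theorem evalPoly_alpha_shuffleWord (hu : ∀ t, ContinuousOn (u t) (Icc 0 1)) (v w : List X) :
    ∀ τ ∈ Icc (0 : ℝ) 1, evalPoly (alpha u τ) (shuffleWord v w) = alpha u τ v * alpha u τ w := by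
  induction v, w using shuffleWord.induct with
  | case1 w => intro τ _; rw [shuffleWord, evalPoly_single]; simp
  | case2 x v => intro τ _; rw [shuffleWord, evalPoly_single]; simp
  | case3 x v y w ih₁ ih₂ =>
    rw [shuffleWord]
    simp only [evalPoly_add]
    refine eqOn_Icc_of_hasDerivWithinAt (fun τ hτ =>
      (hasDerivWithinAt_evalPoly_cons hu x _ hτ).fun_add
        (hasDerivWithinAt_evalPoly_cons hu y _ hτ)) (fun τ hτ => ?_) ?_
    · rw [ih₁ τ hτ, ih₂ τ hτ]
      refine ((hasDerivWithinAt_alpha_cons hu x v hτ).fun_mul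
        (hasDerivWithinAt_alpha_cons hu y w hτ)).congr_deriv ?_
      ring
    · rw [evalPoly_alpha_zero_cons, evalPoly_alpha_zero_cons, alpha_zero_cons, zero_mul, add_zero]

/-- Iterated integrals form a character of the shuffle algebra. -/
theorem evalPoly_alpha_shuffle (hu : ∀ t, ContinuousOn (u t) (Icc 0 1)) (P Q : List X →₀ ℂ)
    {τ : ℝ} (hτ : τ ∈ Icc (0 : ℝ) 1) :
    evalPoly (alpha u τ) (shuffle P Q) = evalPoly (alpha u τ) P * evalPoly (alpha u τ) Q := by
  simp only [shuffle, Finsupp.sum]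
  simp only [evalPoly_eq_linearCombination, map_sum, map_smul]
  simp only [← evalPoly_eq_linearCombination, evalPoly_alpha_shuffleWord hu _ _ τ hτ]
  rw [evalPoly, evalPoly, Finsupp.sum, Finsupp.sum, Finset.sum_mul_sum]
  refine Finset.sum_congr rfl fun v _ => Finset.sum_congr rfl fun w _ => ?_
  rw [smul_eq_mul]
  ring

theorem evalPoly_alpha_foldr_shuffle (hu : ∀ t, ContinuousOn (u t) (Icc 0 1))
    (L : List (List X →₀ ℂ)) {τ : ℝ} (hτ : τ ∈ Icc (0 : ℝ) 1) :
    evalPoly (alpha u τ) (L.foldr shuffle (Finsupp.single [] 1))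
      = (L.map (evalPoly (alpha u τ))).prod := by
  induction L with
  | nil => simp [evalPoly_single]
  | cons P L ih =>
    rw [List.foldr_cons, evalPoly_alpha_shuffle hu _ _ hτ, ih, List.map_cons, List.prod_cons]

end Alpha

/-! ### The polynomials `S_w` -/

section LyndonS

variable {X : Type*} [LinearOrder X]

theorem length_lt_of_mem_lyndonFactors {w l : List X} (hw : ¬ IsLyndon w)
    (hl : l ∈ lyndonFactors w) : l.length < w.length := by
  obtain ⟨A, B, hAB⟩ := List.append_of_mem hl
  have h := flatten_lyndonFactors w
  rw [hAB, List.flatten_append, List.flatten_cons] at h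
  have hlen := congrArg List.length h
  simp only [List.length_append] at hlen
  refine lt_of_le_of_ne (by omega) fun heq => hw ?_
  have hA : A.flatten = [] := List.length_eq_zero_iff.1 (by omega)
  have hB : B.flatten = [] := List.length_eq_zero_iff.1 (by omega)
  rw [hA, hB, List.nil_append, List.append_nil] at h
  rw [← h]
  exact (isLyndonFactorization_lyndonFactors w).1 l hl

theorem lyndonSAux_congr {m m' : ℕ} {w : List X} (hm : w.length ≤ m) (hm' : w.length ≤ m') :
    lyndonSAux m w = lyndonSAux m' w := by
  induction hn : w.length using Nat.strong_induction_on generalizing m m' w with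
  | _ n ih =>
    cases w with
    | nil => cases m <;> cases m' <;> rfl
    | cons x v =>
      rw [List.length_cons] at hm hm' hn
      obtain ⟨m, rfl⟩ : ∃ k, m = k + 1 := ⟨m - 1, by omega⟩
      obtain ⟨m', rfl⟩ : ∃ k, m' = k + 1 := ⟨m' - 1, by omega⟩
      rw [lyndonSAux, lyndonSAux]
      split_ifs with h
      · exact congrArg _ (ih v.length (by omega) (by omega) (by omega) rfl)
      · congr 2
        refine List.map_congr_left fun l hl => ?_
        have h1 := length_lt_of_mem_lyndonFactors h hl
        rw [List.length_cons] at h1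
        exact ih l.length (by omega) (by omega) (by omega) rfl

theorem lyndonS_cons {x : X} {v : List X} (h : IsLyndon (x :: v)) :
    lyndonS (x :: v) = (lyndonS v).mapDomain (List.cons x) := by
  rw [lyndonS, List.length_cons, lyndonSAux, if_pos h, lyndonS]

/-- The number of permutations of a list of words that fix it. -/
def symmetryFactor (F : List (List X)) : ℂ := ∏ l ∈ F.toFinset, ((F.count l).factorial : ℂ)

theorem symmetryFactor_concat (F : List (List X)) (m : List X) :
    symmetryFactor (F ++ [m]) = (F.count m + 1) * symmetryFactor F := by
  have h : symmetryFactor F = ∏ l ∈ insert m F.toFinset, ((F.count l).factorial : ℂ) := by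
    refine Finset.prod_subset (Finset.subset_insert _ _) fun l _ hl => ?_
    rw [List.mem_toFinset] at hl
    rw [List.count_eq_zero_of_not_mem hl, Nat.factorial_zero, Nat.cast_one]
  have h' : (F ++ [m]).toFinset = insert m F.toFinset := by
    ext l
    simp
  rw [h, symmetryFactor, h', ← Finset.mul_prod_erase _ _ (Finset.mem_insert_self m F.toFinset),
    ← Finset.mul_prod_erase (insert m F.toFinset) (fun l => ((F.count l).factorial : ℂ))
      (Finset.mem_insert_self m F.toFinset), ← mul_assoc]
  congr 1
  · rw [List.count_append, List.count_singleton_self, Nat.factorial_succ]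
    push_cast
    ring
  · refine Finset.prod_congr rfl fun l hl => ?_
    rw [List.count_append, List.count_eq_zero_of_not_mem (l := [m]), add_zero]
    rw [List.mem_singleton]
    exact (Finset.mem_erase.1 hl).1

theorem symmetryFactor_ne_zero (F : List (List X)) : symmetryFactor F ≠ 0 :=
  Finset.prod_ne_zero_iff.2 fun l _ => by exact_mod_cast Nat.factorial_ne_zero _

theorem lyndonS_of_not_isLyndon {w : List X} (h : ¬ IsLyndon w) :
    lyndonS w = (symmetryFactor (lyndonFactors w))⁻¹ •
      ((lyndonFactors w).map lyndonS).foldr shuffle (Finsupp.single [] 1) := by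
  cases w with
  | nil => simp [lyndonS, lyndonSAux, lyndonFactors, lyndonFactorsAux, symmetryFactor]
  | cons x v =>
    rw [lyndonS, List.length_cons, lyndonSAux, if_neg h]
    congr 1
    · congr 1
      refine List.map_congr_left fun l hl => lyndonSAux_congr ?_ le_rfl
      have h1 := length_lt_of_mem_lyndonFactors h hl
      rw [List.length_cons] at h1
      omega

variable {u : X → ℝ → ℂ}

theorem evalPoly_alpha_lyndonS (hu : ∀ t, ContinuousOn (u t) (Icc 0 1)) (w : List X)
    {τ : ℝ} (hτ : τ ∈ Icc (0 : ℝ) 1) :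
    evalPoly (alpha u τ) (lyndonS w) = (symmetryFactor (lyndonFactors w))⁻¹ *
      ((lyndonFactors w).map fun l => evalPoly (alpha u τ) (lyndonS l)).prod := by
  by_cases h : IsLyndon w
  · rw [lyndonFactors_of_isLyndon h]
    simp [symmetryFactor]
  · rw [lyndonS_of_not_isLyndon h, evalPoly_smul, evalPoly_alpha_foldr_shuffle hu _ hτ,
      List.map_map]
    rfl

theorem evalPoly_alpha_lyndonS_append (hu : ∀ t, ContinuousOn (u t) (Icc 0 1)) {w m : List X}
    (hm : IsLyndon m) (h : ∀ l ∈ lyndonFactors w, m ≤ l) {τ : ℝ} (hτ : τ ∈ Icc (0 : ℝ) 1) :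
    ((lyndonFactors w).count m + 1) * evalPoly (alpha u τ) (lyndonS (w ++ m))
      = evalPoly (alpha u τ) (lyndonS m) * evalPoly (alpha u τ) (lyndonS w) := by
  rw [evalPoly_alpha_lyndonS hu (w ++ m) hτ, evalPoly_alpha_lyndonS hu w hτ,
    lyndonFactors_append hm h, symmetryFactor_concat, List.map_append, List.prod_append,
    List.map_singleton, List.prod_singleton]
  have h1 : (((lyndonFactors w).count m : ℂ) + 1) ≠ 0 := by
    exact_mod_cast Nat.succ_ne_zero ((lyndonFactors w).count m)
  have h2 := symmetryFactor_ne_zero (lyndonFactors w)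
  field_simp

end LyndonS

/-! ### Differential equations for series -/

section SeriesODE

theorem letter_mul_nil {X : Type*} (t : X) (S : Series X) : (letter t * S) [] = 0 := by
  simp [letter]

theorem letter_mul_cons {X : Type*} [DecidableEq X] (t : X) (S : Series X) (x : X) (w : List X) :
    (letter t * S) (x :: w) = if x = t then S w else 0 := by
  have h : ofFun (fun v => letter t (x :: v)) = if x = t then (1 : Series X) else 0 := by
    ext v
    split_ifs with hx
    · cases v <;> simp [letter, hx]
    · simp [letter, hx]
  rw [mul_cons, h]
  split_ifs <;> simp [letter]

variable {n : ℕ}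

theorem HasSeriesDeriv.mul {F G D E : ℝ → Series (Letter n)} (hF : HasSeriesDeriv F D)
    (hG : HasSeriesDeriv G E) :
    HasSeriesDeriv (fun s => F s * G s) (fun s => D s * G s + F s * E s) := fun τ hτ w => by
  simp only [mul_apply, add_apply]
  rw [← Finset.sum_add_distrib]
  exact HasDerivWithinAt.fun_sum fun i _ => (hF τ hτ _).fun_mul (hG τ hτ _)

theorem hasSeriesDeriv_one : HasSeriesDeriv (fun _ => (1 : Series (Letter n))) (fun _ => 0) :=
  fun _ _ _ => hasDerivWithinAt_const _ _ _

theorem hasSeriesDeriv_seriesExp {P : Series (Letter n)} (hP : P [] = 0) {f f' : ℝ → ℂ}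
    (hf : ∀ τ ∈ Icc (0 : ℝ) 1, HasDerivWithinAt f (f' τ) (Icc 0 1) τ) :
    HasSeriesDeriv (fun s => seriesExp (f s • P))
      (fun s => f' s • (P * seriesExp (f s • P))) := fun τ hτ w => by
  have h0 : (f τ • P) [] = 0 := by rw [smul_apply, hP, mul_zero]
  have hterm : ∀ k ∈ Finset.range (w.length + 1), HasDerivWithinAt
      (fun s => ((k.factorial : ℂ)⁻¹) * ((f s • P) ^ k) w)
      (((k.factorial : ℂ)⁻¹) * (((k : ℂ) * f τ ^ (k - 1) * f' τ) * (P ^ k) w)) (Icc 0 1) τ := by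
    intro k _
    simp only [smul_pow, smul_apply]
    exact (((hf τ hτ).fun_pow k).mul_const _).const_mul _
  refine (HasDerivWithinAt.fun_sum hterm).congr_deriv ?_
  have hexp : (P * seriesExp (f τ • P)) w
      = (P * ∑ k ∈ Finset.range (w.length + 1), ((k.factorial : ℂ)⁻¹) • (f τ • P) ^ k) w :=
    (EqUpTo.refl w.length P).mul (gradedSum_eqUpTo (ordGE_expTerm h0) w.length le_rfl) w le_rfl
  beta_reduce
  rw [smul_apply, hexp, Finset.mul_sum, sum_apply, Finset.sum_range_succ', Finset.sum_range_succ,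
    mul_smul_comm, smul_pow, mul_smul_comm, ← pow_succ', smul_apply, smul_apply,
    OrdGE.pow hP (w.length + 1) w (Nat.lt_succ_self _)]
  simp only [Nat.cast_zero, zero_mul, mul_zero, add_zero]
  rw [Finset.mul_sum]
  refine Finset.sum_congr rfl fun k _ => ?_
  rw [mul_smul_comm, smul_pow, mul_smul_comm, ← pow_succ', smul_apply, smul_apply,
    Nat.factorial_succ, Nat.add_sub_cancel]
  have h1 : ((k : ℂ) + 1) ≠ 0 := by exact_mod_cast k.succ_ne_zero
  have h2 : (k.factorial : ℂ) ≠ 0 := by exact_mod_cast k.factorial_ne_zero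
  push_cast
  field_simp

/-- Uniqueness for `F' = M F` modulo series of order greater than `N`, when `M` has no constant
term. -/
theorem eqUpTo_of_hasSeriesDeriv {F G D E M : ℝ → Series (Letter n)} {N : ℕ}
    (hF : HasSeriesDeriv F D) (hG : HasSeriesDeriv G E) (hM : ∀ τ, M τ [] = 0)
    (hD : ∀ τ ∈ Icc (0 : ℝ) 1, EqUpTo N (D τ) (M τ * F τ))
    (hE : ∀ τ ∈ Icc (0 : ℝ) 1, EqUpTo N (E τ) (M τ * G τ)) (h0 : EqUpTo N (F 0) (G 0))
    {τ : ℝ} (hτ : τ ∈ Icc (0 : ℝ) 1) : EqUpTo N (F τ) (G τ) := by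
  suffices h : ∀ k, ∀ w : List (Letter n), w.length = k → k ≤ N →
      ∀ τ ∈ Icc (0 : ℝ) 1, F τ w = G τ w from fun w hw => h _ w rfl hw τ hτ
  intro k
  induction k using Nat.strong_induction_on with
  | _ k ih =>
    intro w hw hk
    refine eqOn_Icc_of_hasDerivWithinAt (fun τ hτ => hF τ hτ w) (fun τ hτ => ?_)
      (h0 w (hw.trans_le hk))
    refine (hG τ hτ w).congr_deriv ?_
    rw [hD τ hτ w (hw.trans_le hk), hE τ hτ w (hw.trans_le hk), mul_apply, mul_apply]
    refine Finset.sum_congr rfl fun i hi => ?_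
    rw [Finset.mem_range] at hi
    rcases Nat.eq_zero_or_pos i with rfl | hi0
    · rw [List.take_zero, hM, zero_mul, zero_mul]
    · rw [ih (w.drop i).length (by rw [List.length_drop]; omega) _ rfl
        (by rw [List.length_drop]; omega) τ hτ]

end SeriesODE

/-! ### The factorisation of the generating series of iterated integrals over Lyndon words -/

section Factorisation

variable {n : ℕ}

theorem mem_wordsOfLength {k : ℕ} {w : List (Letter n)} : w ∈ wordsOfLength n k ↔ w.length = k := by
  rw [wordsOfLength, Finset.mem_image]
  constructor
  · rintro ⟨f, -, rfl⟩
    exact List.length_ofFn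
  · rintro rfl
    exact ⟨w.get, Finset.mem_univ _, List.ofFn_get w⟩

theorem mem_topLyndon {N : ℕ} {l : List (Letter n)} :
    l ∈ topLyndon n N ↔ l.length ≤ N ∧ IsLyndon l ∧ ∀ t ∈ l, t ∈ topLetters n := by
  simp [topLyndon, mem_wordsOfLength]

variable (u : Letter n → ℝ → ℂ)

/-- The coordinate `α(S_l)` of the second kind. -/
def lyndonCoord (τ : ℝ) (l : List (Letter n)) : ℂ := evalPoly (alpha u τ) (lyndonS l)

/-- The derivative `u_t α(S_{l'})` of the coordinate attached to a Lyndon word `l = t l'`. -/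
def lyndonRate (τ : ℝ) : List (Letter n) → ℂ
  | [] => 0
  | t :: v => u t τ * lyndonCoord u τ v

/-- The product of the exponentials `exp (α(S_l) P_l)` over a list of words. -/
def lyndonProd (τ : ℝ) (R : List (List (Letter n))) : Series (Letter n) :=
  (R.map fun l => seriesExp (lyndonCoord u τ l • lyndonP l)).prod

/-- The logarithmic derivative of the product of exponentials over a final segment `R` of the
Lyndon words: the sum of `α(S_l)' P_l` over the words `l` of `R` such that no Lyndon factor of the
tail of `l` belongs to `R`. -/
def lyndonDrift (τ : ℝ) (R : List (List (Letter n))) : Series (Letter n) :=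
  ∑ l ∈ R.toFinset with ∀ x ∈ lyndonFactors l.tail, x ∉ R, lyndonRate u τ l • lyndonP l

/-- The part of the drift of `R` carried by the words whose tail has the factor `m` with
multiplicity `i`. -/
def lyndonDriftPart (τ : ℝ) (R : List (List (Letter n))) (m : List (Letter n)) (i : ℕ) :
    Series (Letter n) :=
  ∑ l ∈ R.toFinset with (∀ x ∈ lyndonFactors l.tail, x ∉ R) ∧ (lyndonFactors l.tail).count m = i,
    lyndonRate u τ l • lyndonP l

/-- A decreasing list of Lyndon words of length at most `N` in the letters `t_{k,n}` that contains
every such word below one of its members. -/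
structure IsLyndonSegment (N : ℕ) (R : List (List (Letter n))) : Prop where
  sorted : R.Pairwise (· > ·)
  mem : ∀ l ∈ R, l ∈ topLyndon n N
  lower : ∀ l ∈ topLyndon n N, ∀ r ∈ R, l ≤ r → l ∈ R

variable {u}

theorem lyndonCoord_smul_lyndonP_nil (τ : ℝ) (l : List (Letter n)) :
    (lyndonCoord u τ l • lyndonP l) [] = 0 := by
  rw [smul_apply, lyndonP_nil_apply, mul_zero]

theorem lyndonProd_cons (τ : ℝ) (l : List (Letter n)) (R : List (List (Letter n))) :
    lyndonProd u τ (l :: R) = seriesExp (lyndonCoord u τ l • lyndonP l) * lyndonProd u τ R := rfl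

theorem hasDerivWithinAt_lyndonCoord (hu : ∀ t, ContinuousOn (u t) (Icc 0 1))
    {l : List (Letter n)} (hl : IsLyndon l) {τ : ℝ} (hτ : τ ∈ Icc (0 : ℝ) 1) :
    HasDerivWithinAt (fun s => lyndonCoord u s l) (lyndonRate u τ l) (Icc 0 1) τ := by
  cases l with
  | nil => exact absurd rfl hl.1
  | cons t v =>
    simp only [lyndonCoord, lyndonS_cons hl]
    exact hasDerivWithinAt_evalPoly_cons hu t _ hτ

theorem lyndonCoord_zero {l : List (Letter n)} (hl : IsLyndon l) : lyndonCoord u 0 l = 0 := by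
  cases l with
  | nil => exact absurd rfl hl.1
  | cons t v => rw [lyndonCoord, lyndonS_cons hl, evalPoly_alpha_zero_cons]

theorem IsLyndonSegment.tail {N : ℕ} {m : List (Letter n)} {R : List (List (Letter n))}
    (h : IsLyndonSegment N (m :: R)) : IsLyndonSegment N R where
  sorted := (List.pairwise_cons.1 h.sorted).2
  mem l hl := h.mem l (List.mem_cons_of_mem _ hl)
  lower l hl r hr hlr := by
    have hrm : r < m := (List.pairwise_cons.1 h.sorted).1 r hr
    rcases List.mem_cons.1 (h.lower l hl r (List.mem_cons_of_mem _ hr) hlr) with rfl | h'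
    · exact absurd hrm (not_lt.2 hlr)
    · exact h'

theorem IsLyndonSegment.lt_head {N : ℕ} {m : List (Letter n)} {R : List (List (Letter n))}
    (h : IsLyndonSegment N (m :: R)) {l : List (Letter n)} (hl : l ∈ R) : l < m :=
  (List.pairwise_cons.1 h.sorted).1 l hl

theorem IsLyndonSegment.mem_tail {N : ℕ} {m : List (Letter n)} {R : List (List (Letter n))}
    (h : IsLyndonSegment N (m :: R)) {l : List (Letter n)} (hl : l ∈ topLyndon n N) (hlm : l < m) :
    l ∈ R := by
  rcases List.mem_cons.1 (h.lower l hl m List.mem_cons_self hlm.le) with rfl | h'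
  · exact absurd hlm (lt_irrefl _)
  · exact h'

theorem mem_topLyndon_of_mem_lyndonFactors {N : ℕ} {a : Letter n} {v x : List (Letter n)}
    (hl : a :: v ∈ topLyndon n N) (hx : x ∈ lyndonFactors v) : x ∈ topLyndon n N := by
  have hsub : x.Sublist v := by
    have h := List.sublist_flatten_of_mem hx
    rwa [flatten_lyndonFactors] at h
  rw [mem_topLyndon] at hl ⊢
  refine ⟨?_, (isLyndonFactorization_lyndonFactors v).1 x hx, fun t ht =>
    hl.2.2 t (List.mem_cons_of_mem _ (hsub.subset ht))⟩
  have h1 := hsub.length_le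
  have h2 := hl.1
  rw [List.length_cons] at h2
  omega

theorem IsLyndonSegment.head_le {N : ℕ} {m : List (Letter n)} {R : List (List (Letter n))}
    (h : IsLyndonSegment N (m :: R)) {a : Letter n} {v x : List (Letter n)}
    (hl : a :: v ∈ topLyndon n N) (hx : x ∈ lyndonFactors v) (hxR : x ∉ R) : m ≤ x :=
  not_lt.1 fun hlt => hxR (h.mem_tail (mem_topLyndon_of_mem_lyndonFactors hl hx) hlt)

theorem exists_cons_of_mem_topLyndon {N : ℕ} {l : List (Letter n)} (hl : l ∈ topLyndon n N) :
    ∃ a v, l = a :: v := List.exists_cons_of_ne_nil (mem_topLyndon.1 hl).2.1.1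

theorem lyndonDrift_cons {N : ℕ} {m : List (Letter n)} {R : List (List (Letter n))}
    (h : IsLyndonSegment N (m :: R)) (τ : ℝ) :
    lyndonDrift u τ (m :: R) = lyndonRate u τ m • lyndonP m + lyndonDriftPart u τ R m 0 := by
  have hmR : m ∉ R := fun hm => lt_irrefl _ (h.lt_head hm)
  have hm : ∀ x ∈ lyndonFactors m.tail, x ∉ m :: R := by
    obtain ⟨a, v, rfl⟩ := exists_cons_of_mem_topLyndon (h.mem m List.mem_cons_self)
    intro x hx hxR
    have h1 := lt_of_mem_lyndonFactors_tail (mem_topLyndon.1 (h.mem _ List.mem_cons_self)).2.1 hx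
    rcases List.mem_cons.1 hxR with rfl | hxR
    · exact lt_irrefl _ h1
    · exact lt_asymm h1 (h.lt_head hxR)
  rw [lyndonDrift, List.toFinset_cons, Finset.filter_insert, if_pos hm, Finset.sum_insert,
    lyndonDriftPart]
  · congr 1
    refine Finset.sum_congr (Finset.filter_congr fun l _ => ?_) fun _ _ => rfl
    rw [List.count_eq_zero]
    constructor
    · exact fun hx => ⟨fun x hx1 hx2 => hx x hx1 (List.mem_cons_of_mem _ hx2),
        fun hm => hx m hm List.mem_cons_self⟩
    · rintro ⟨h1, h2⟩ x hx hxR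
      rcases List.mem_cons.1 hxR with rfl | hxR
      · exact h2 hx
      · exact h1 x hx hxR
  · intro hmem
    exact hmR (List.mem_toFinset.1 (Finset.mem_filter.1 hmem).1)

theorem length_lyndonFactors_le {X : Type*} [LinearOrder X] (w : List X) :
    (lyndonFactors w).length ≤ w.length := by
  have h : ∀ F : List (List X), (∀ l ∈ F, l ≠ []) → F.length ≤ F.flatten.length := by
    intro F
    induction F with
    | nil => simp
    | cons l F ih =>
      intro hF
      rw [List.forall_mem_cons] at hF
      have h1 := ih hF.2
      have h2 := List.length_pos_of_ne_nil hF.1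
      rw [List.flatten_cons, List.length_append, List.length_cons]
      omega
  have h' := h _ fun l hl => ((isLyndonFactorization_lyndonFactors w).1 l hl).1
  rwa [flatten_lyndonFactors] at h'

theorem lyndonDrift_eq_sum_parts {N : ℕ} {m : List (Letter n)} {R : List (List (Letter n))}
    (h : IsLyndonSegment N R) (τ : ℝ) :
    lyndonDrift u τ R = ∑ i ∈ Finset.range (N + 1), lyndonDriftPart u τ R m i := by
  rw [lyndonDrift, ← Finset.sum_fiberwise_of_maps_to
    (g := fun l => (lyndonFactors l.tail).count m) (t := Finset.range (N + 1))]
  · simp only [lyndonDriftPart, Finset.filter_filter]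
  · intro l hl
    have h1 := (mem_topLyndon.1 (h.mem l (List.mem_toFinset.1 (Finset.mem_filter.1 hl).1))).1
    have h2 := length_lyndonFactors_le l.tail
    have h3 := List.count_le_length (a := m) (l := lyndonFactors l.tail)
    rw [List.length_tail] at h2
    rw [Finset.mem_range]
    omega

theorem ad_sum_left {ι : Type*} (s : Finset ι) (F : ι → Series (Letter n))
    (R : Series (Letter n)) : ad (∑ i ∈ s, F i) R = ∑ i ∈ s, ad (F i) R := by
  simp only [ad, Finset.sum_mul, Finset.mul_sum, Finset.sum_sub_distrib]

theorem ad_smul_left {X : Type*} (c : ℂ) (S R : Series X) : ad (c • S) R = c • ad S R := by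
  simp only [ad, smul_mul_assoc, mul_smul_comm, smul_sub]

/-- Bracketing with `P_m` raises the multiplicity of `m`: for `l` in the `i`-th part, `l m` is a
Lyndon word with standard factorisation `(l, m)`, and every word of the next part arises once. -/
theorem smul_ad_lyndonDriftPart (hu : ∀ t, ContinuousOn (u t) (Icc 0 1)) {N : ℕ}
    {m : List (Letter n)} {R : List (List (Letter n))} (h : IsLyndonSegment N (m :: R)) (i : ℕ)
    {τ : ℝ} (hτ : τ ∈ Icc (0 : ℝ) 1) :
    EqUpTo N (lyndonCoord u τ m • ad (lyndonDriftPart u τ R m i) (lyndonP m))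
      (((i : ℂ) + 1) • lyndonDriftPart u τ R m (i + 1)) := by
  have hmL := mem_topLyndon.1 (h.mem m List.mem_cons_self)
  rw [lyndonDriftPart, lyndonDriftPart, ad_sum_left, Finset.smul_sum, Finset.smul_sum]
  set A := R.toFinset.filter fun l : List (Letter n) =>
    (∀ x ∈ lyndonFactors l.tail, x ∉ R) ∧ (lyndonFactors l.tail).count m = i with hA
  -- the words of the part with the properties used below
  have hAspec : ∀ l ∈ A, ∃ a v, l = a :: v ∧ a :: v ∈ topLyndon n N ∧ a :: v < m ∧
      (∀ x ∈ lyndonFactors v, x ∉ R) ∧ (∀ x ∈ lyndonFactors v, m ≤ x) ∧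
      (lyndonFactors v).count m = i := by
    intro l hl
    rw [hA, Finset.mem_filter, List.mem_toFinset] at hl
    have hlT := h.tail.mem l hl.1
    obtain ⟨a, v, rfl⟩ := exists_cons_of_mem_topLyndon hlT
    exact ⟨a, v, rfl, hlT, h.lt_head hl.1, hl.2.1,
      fun x hx => h.head_le hlT hx (hl.2.1 x hx), hl.2.2⟩
  have hbracket : ∀ l ∈ A, lyndonCoord u τ m • ad (lyndonRate u τ l • lyndonP l) (lyndonP m)
      = ((i : ℂ) + 1) • (lyndonRate u τ (l ++ m) • lyndonP (l ++ m)) := by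
    intro l hl
    obtain ⟨a, v, rfl, hT, hlt, -, hle, hcount⟩ := hAspec l hl
    have hF := isLyndonFactorization_concat.2
      ⟨isLyndonFactorization_lyndonFactors v, hmL.2.1, hle⟩
    have hP := lyndonP_cons_flatten_append (a := a) hF
    rw [flatten_lyndonFactors] at hP
    have hrate := evalPoly_alpha_lyndonS_append hu hmL.2.1 hle hτ
    rw [hcount] at hrate
    rw [List.cons_append, hP, ad_smul_left, smul_smul, smul_smul]
    congr 1
    simp only [lyndonRate, lyndonCoord]
    linear_combination (-(u a τ)) * hrate
  -- words that become too long do not contribute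
  have htrunc : EqUpTo N
      (∑ l ∈ A, lyndonCoord u τ m • ad (lyndonRate u τ l • lyndonP l) (lyndonP m))
      (∑ l ∈ A with (l ++ m).length ≤ N,
        lyndonCoord u τ m • ad (lyndonRate u τ l • lyndonP l) (lyndonP m)) := by
    intro w hw
    rw [sum_apply, sum_apply]
    symm
    refine Finset.sum_subset (Finset.filter_subset _ _) fun l hl hl' => ?_
    rw [hbracket l hl, smul_apply, smul_apply,
      ordGE_lyndonP (l ++ m) w (by
        by_contra hcon
        exact hl' (Finset.mem_filter.2 ⟨hl, by omega⟩)), mul_zero, mul_zero]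
  refine htrunc.trans ?_
  rw [Finset.sum_congr rfl fun l hl => hbracket l (Finset.mem_filter.1 hl).1]
  rw [Finset.sum_bij (t := R.toFinset.filter fun l : List (Letter n) =>
    (∀ x ∈ lyndonFactors l.tail, x ∉ R) ∧ (lyndonFactors l.tail).count m = i + 1)
    (g := fun l => ((i : ℂ) + 1) • (lyndonRate u τ l • lyndonP l)) (fun l _ => l ++ m)]
  · exact EqUpTo.refl _ _
  · intro l hl
    rw [Finset.mem_filter] at hl
    have hlen := hl.2
    obtain ⟨a, v, rfl, hT, hlt, hnot, hle, hcount⟩ := hAspec l hl.1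
    have hT' := mem_topLyndon.1 hT
    have hLyn : IsLyndon (a :: v ++ m) := hT'.2.1.append hmL.2.1 hlt
    rw [Finset.mem_filter, List.mem_toFinset]
    refine ⟨h.mem_tail (mem_topLyndon.2 ⟨hlen, hLyn, ?_⟩)
      (hLyn.lt_of_append (List.cons_ne_nil _ _) hmL.2.1.1), ?_⟩
    · intro t ht
      rcases List.mem_append.1 ht with ht | ht
      · exact hT'.2.2 t ht
      · exact hmL.2.2 t ht
    · rw [List.cons_append, List.tail_cons, lyndonFactors_append hmL.2.1 hle]
      refine ⟨fun x hx => ?_, ?_⟩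
      · rcases List.mem_append.1 hx with hx | hx
        · exact hnot x hx
        · rw [List.mem_singleton.1 hx]
          exact fun hm => lt_irrefl _ (h.lt_head hm)
      · rw [List.count_append, hcount, List.count_singleton_self]
  · intro l _ l' _ heq
    exact List.append_cancel_right heq
  · intro l' hl'
    rw [Finset.mem_filter, List.mem_toFinset] at hl'
    have hlT := h.tail.mem l' hl'.1
    have hlt' := h.lt_head hl'.1
    obtain ⟨a, v, rfl⟩ := exists_cons_of_mem_topLyndon hlT
    rw [List.tail_cons] at hl'
    have hle : ∀ x ∈ lyndonFactors v, m ≤ x := fun x hx => h.head_le hlT hx (hl'.2.1 x hx)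
    have hmem : m ∈ lyndonFactors v := List.count_pos_iff.1 (by rw [hl'.2.2]; omega)
    -- the last factor of the tail is `m`
    obtain ⟨F, x, hFx⟩ : ∃ F x, lyndonFactors v = F ++ [x] :=
      ⟨_, _, (List.dropLast_append_getLast (List.ne_nil_of_mem hmem)).symm⟩
    have hfac := isLyndonFactorization_lyndonFactors v
    have hflat := flatten_lyndonFactors v
    rw [hFx] at hfac hflat hmem
    have hxm : x = m := by
      refine le_antisymm ?_ (hle x (by rw [hFx]; simp))
      rcases List.mem_append.1 hmem with hm | hm
      · exact (isLyndonFactorization_concat.1 hfac).2.2 m hm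
      · exact (List.mem_singleton.1 hm).symm.le
    subst hxm
    have hv : v = F.flatten ++ x := by
      rw [← hflat]
      simp
    have hF := (isLyndonFactorization_concat.1 hfac).1
    have hT' := mem_topLyndon.1 hlT
    have hLyn : IsLyndon (a :: F.flatten) :=
      isLyndon_of_cons_flatten_append hfac (hv ▸ hT'.2.1)
    have happ : a :: F.flatten ++ x = a :: v := by rw [hv, List.cons_append]
    have hlen : (a :: F.flatten).length ≤ N := by
      have h1 := congrArg List.length happ
      rw [List.length_append] at h1
      omega
    have hlt : a :: F.flatten < x := (list_le_append _ x).trans_lt (by rw [happ]; exact hlt')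
    refine ⟨a :: F.flatten, ?_, happ⟩
    rw [Finset.mem_filter, hA, Finset.mem_filter, List.mem_toFinset, List.tail_cons,
      lyndonFactors_flatten hF, happ]
    refine ⟨⟨h.mem_tail (mem_topLyndon.2 ⟨hlen, hLyn, fun t ht => hT'.2.2 t ?_⟩) hlt,
      fun y hy => hl'.2.1 y ?_, ?_⟩, hT'.1⟩
    · rw [← happ]
      exact List.mem_append_left _ ht
    · rw [hFx]
      exact List.mem_append_left _ hy
    · have h1 := hl'.2.2
      rw [hFx, List.count_append, List.count_singleton_self] at h1
      omega
  · intro l _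
    rfl

theorem Series.EqUpTo.ad {N : ℕ} {A S R : Series (Letter n)} (h : EqUpTo N S R) :
    EqUpTo N (NCVolterra.ad A S) (NCVolterra.ad A R) := by
  intro w hw
  rw [NCVolterra.ad, NCVolterra.ad, sub_apply, sub_apply, (EqUpTo.refl N A).mul h w hw,
    h.mul (EqUpTo.refl N A) w hw]

/-- Conjugation by `exp (α(S_m) P_m)` turns the part of the drift free of `m` into the drift of the
words after `m`. -/
theorem opExp_lyndonDriftPart (hu : ∀ t, ContinuousOn (u t) (Icc 0 1)) {N : ℕ}
    {m : List (Letter n)} {R : List (List (Letter n))} (h : IsLyndonSegment N (m :: R))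
    {τ : ℝ} (hτ : τ ∈ Icc (0 : ℝ) 1) :
    EqUpTo N (opExp (ad (-(lyndonCoord u τ m • lyndonP m))) (lyndonDriftPart u τ R m 0))
      (lyndonDrift u τ R) := by
  have h0 : (-(lyndonCoord u τ m • lyndonP m)) [] = 0 := by
    rw [neg_apply, lyndonCoord_smul_lyndonP_nil, neg_zero]
  have hiter : ∀ i : ℕ, EqUpTo N
      ((ad (-(lyndonCoord u τ m • lyndonP m)))^[i] (lyndonDriftPart u τ R m 0))
      ((i.factorial : ℂ) • lyndonDriftPart u τ R m i) := by
    intro i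
    induction i with
    | zero => simpa using EqUpTo.refl N _
    | succ i ih =>
      rw [Function.iterate_succ_apply']
      refine ih.ad.trans ?_
      have h1 : ad (-(lyndonCoord u τ m • lyndonP m))
          ((i.factorial : ℂ) • lyndonDriftPart u τ R m i)
          = (i.factorial : ℂ) • (lyndonCoord u τ m •
            ad (lyndonDriftPart u τ R m i) (lyndonP m)) := by
        simp only [ad, neg_mul, mul_neg, smul_mul_assoc, mul_smul_comm, smul_sub, smul_neg]
        rw [smul_comm (lyndonCoord u τ m) (i.factorial : ℂ)]
        abel
      rw [h1]
      refine ((smul_ad_lyndonDriftPart hu h i hτ).smul _).trans ?_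
      rw [smul_smul, Nat.factorial_succ]
      push_cast
      rw [mul_comm]
      exact EqUpTo.refl _ _
  rw [opExp_eq_gradedSum, lyndonDrift_eq_sum_parts (m := m) h.tail]
  refine (gradedSum_eqUpTo (fun k => (ordGE_ad_iterate h0 _ k).smul _) N le_rfl).trans ?_
  refine EqUpTo.sum fun i _ => ((hiter i).smul _).trans ?_
  rw [smul_smul, inv_mul_cancel₀ (by exact_mod_cast i.factorial_ne_zero), one_smul]
  exact EqUpTo.refl _ _

/-- The product of exponentials over a segment solves the equation given by its drift. -/
theorem exists_hasSeriesDeriv_lyndonProd (hu : ∀ t, ContinuousOn (u t) (Icc 0 1)) {N : ℕ}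
    {R : List (List (Letter n))} (h : IsLyndonSegment N R) :
    ∃ D, HasSeriesDeriv (fun s => lyndonProd u s R) D ∧ ∀ τ ∈ Icc (0 : ℝ) 1,
      EqUpTo N (D τ) (lyndonDrift u τ R * lyndonProd u τ R) := by
  induction R with
  | nil =>
    refine ⟨fun _ => 0, hasSeriesDeriv_one, fun τ _ => ?_⟩
    simp only [lyndonDrift, List.toFinset_nil, Finset.filter_empty, Finset.sum_empty, zero_mul]
    exact EqUpTo.refl _ _
  | cons m R ih =>
    obtain ⟨D, hD, hDeq⟩ := ih h.tail
    have hm := (mem_topLyndon.1 (h.mem m List.mem_cons_self)).2.1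
    refine ⟨_, (hasSeriesDeriv_seriesExp (lyndonP_nil_apply m)
      fun τ hτ => hasDerivWithinAt_lyndonCoord hu hm hτ).mul hD, fun τ hτ => ?_⟩
    have h0 := lyndonCoord_smul_lyndonP_nil (u := u) τ m
    have hconj := opExp_lyndonDriftPart hu h hτ
    rw [opExp_ad_eq (by rw [neg_apply, h0, neg_zero]), neg_neg] at hconj
    set e := seriesExp (lyndonCoord u τ m • lyndonP m) with he
    set e' := seriesExp (-(lyndonCoord u τ m • lyndonP m)) with he'
    have hee' : e * e' = 1 := seriesExp_mul_neg h0
    rw [lyndonDrift_cons h, add_mul, lyndonProd_cons, smul_mul_assoc, smul_mul_assoc, mul_assoc]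
    refine (EqUpTo.refl _ _).add ?_
    refine ((EqUpTo.refl N e).mul ((hDeq τ hτ).trans
      (hconj.symm.mul (EqUpTo.refl N _)))).trans ?_
    have h1 : e * (e' * lyndonDriftPart u τ R m 0 * e * lyndonProd u τ R)
        = lyndonDriftPart u τ R m 0 * (e * lyndonProd u τ R) := by
      rw [mul_assoc, mul_assoc, ← mul_assoc, hee', one_mul]
    rw [h1]
    exact EqUpTo.refl _ _

theorem hasSeriesDeriv_startSeries (hu : ∀ t, ContinuousOn (u t) (Icc 0 1)) :
    HasSeriesDeriv (fun s => startSeries (alpha u s))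
      (fun s => (∑ t ∈ topLetters n, u t s • letter t) * startSeries (alpha u s)) := by
  intro τ hτ w
  beta_reduce
  rw [Finset.sum_mul, sum_apply]
  cases w with
  | nil =>
    simp only [startSeries, List.not_mem_nil, false_implies, implies_true, if_true, alpha_nil,
      smul_mul_assoc, smul_apply, letter_mul_nil, mul_zero, Finset.sum_const_zero]
    exact hasDerivWithinAt_const _ _ _
  | cons x w =>
    classical
    simp only [smul_mul_assoc, smul_apply, letter_mul_cons, mul_ite, mul_zero]
    rw [Finset.sum_ite_eq]
    simp only [startSeries, List.forall_mem_cons]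
    by_cases hx : x ∈ topLetters n
    · by_cases hw : ∀ t ∈ w, t ∈ topLetters n
      · simp only [hx, true_and, if_true, if_pos hw]
        exact hasDerivWithinAt_alpha_cons hu x w hτ
      · simp only [hw, and_false, if_false, mul_zero, ite_self]
        exact hasDerivWithinAt_const _ _ _
    · simp only [hx, false_and, if_false]
      exact hasDerivWithinAt_const _ _ _

theorem startSeries_nil (τ : ℝ) : startSeries (alpha u τ) [] = 1 := by
  simp [startSeries]

theorem startSeries_zero : startSeries (alpha u 0) = 1 := by
  ext w
  cases w with
  | nil => simp [startSeries]
  | cons x w => simp [startSeries, alpha_zero_cons]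

theorem lyndonProd_zero {R : List (List (Letter n))} (hR : ∀ l ∈ R, IsLyndon l) :
    lyndonProd u 0 R = 1 := by
  induction R with
  | nil => rfl
  | cons l R ih =>
    rw [List.forall_mem_cons] at hR
    rw [lyndonProd_cons, ih hR.2, lyndonCoord_zero hR.1, zero_smul, seriesExp_zero, one_mul]

theorem isLyndonSegment_sort (n N : ℕ) :
    IsLyndonSegment N ((topLyndon n N).sort (· ≥ ·)) where
  sorted := by
    have h1 : ((topLyndon n N).sort (· ≥ ·)).Pairwise (· ≥ ·) := Finset.pairwise_sort _ _
    have h2 : ((topLyndon n N).sort (· ≥ ·)).Pairwise (· ≠ ·) := Finset.sort_nodup _ _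
    exact (h1.and h2).imp fun h => lt_of_le_of_ne h.1 h.2.symm
  mem l hl := (Finset.mem_sort _).1 hl
  lower l hl _ _ _ := (Finset.mem_sort _).2 hl

theorem lyndonDrift_sort (N : ℕ) (τ : ℝ) :
    EqUpTo N (lyndonDrift u τ ((topLyndon n N).sort (· ≥ ·)))
      (∑ t ∈ topLetters n, u t τ • letter t) := by
  rcases Nat.eq_zero_or_pos N with rfl | hN
  · intro w hw
    obtain rfl := List.length_eq_zero_iff.1 (Nat.le_zero.1 hw)
    rw [lyndonDrift, sum_apply, sum_apply]
    simp [lyndonP_nil_apply, letter]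
  · rw [lyndonDrift]
    rw [← Finset.sum_bij (s := topLetters n) (f := fun t => u t τ • letter t) (fun t _ => [t])]
    · exact EqUpTo.refl _ _
    · intro t ht
      rw [Finset.mem_filter, List.mem_toFinset, Finset.mem_sort, mem_topLyndon]
      exact ⟨⟨hN, isLyndon_singleton t, by simpa using ht⟩,
        by simp [lyndonFactors, lyndonFactorsAux]⟩
    · intro t _ t' _ h
      simpa using h
    · intro l hl
      rw [Finset.mem_filter, List.mem_toFinset, Finset.mem_sort] at hl
      obtain ⟨a, v, rfl⟩ := exists_cons_of_mem_topLyndon hl.1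
      have hnil : lyndonFactors v = [] := List.eq_nil_iff_forall_not_mem.2 fun x hx =>
        hl.2 x hx ((Finset.mem_sort _).2 (mem_topLyndon_of_mem_lyndonFactors hl.1 hx))
      have hv := flatten_lyndonFactors v
      rw [hnil] at hv
      obtain rfl : v = [] := hv.symm
      exact ⟨a, (mem_topLyndon.1 hl.1).2.2 a (by simp), rfl⟩
    · intro t _
      simp [lyndonRate, lyndonCoord, lyndonP_singleton, lyndonS, lyndonSAux, evalPoly_single]

/-- The factorisation `∑ α(w) w = ∏ exp (α(S_l) P_l)` over the Lyndon words in decreasing order, up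
to degree `N`: both sides solve the same differential equation. -/
theorem startSeries_eqUpTo_lyndonProd (hu : ∀ t, ContinuousOn (u t) (Icc 0 1)) (N : ℕ)
    {τ : ℝ} (hτ : τ ∈ Icc (0 : ℝ) 1) :
    EqUpTo N (startSeries (alpha u τ)) (lyndonProd u τ ((topLyndon n N).sort (· ≥ ·))) := by
  have hseg := isLyndonSegment_sort n N
  obtain ⟨D, hD, hDeq⟩ := exists_hasSeriesDeriv_lyndonProd hu hseg
  refine eqUpTo_of_hasSeriesDeriv (hasSeriesDeriv_startSeries hu) hD
    (M := fun s => ∑ t ∈ topLetters n, u t s • letter t) (fun s => ?_)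
    (fun _ _ => EqUpTo.refl _ _)
    (fun s hs => (hDeq s hs).trans ((lyndonDrift_sort N s).mul (EqUpTo.refl _ _))) ?_ hτ
  · rw [sum_apply]
    simp [letter]
  · rw [startSeries_zero, lyndonProd_zero fun l hl => (mem_topLyndon.1 (hseg.mem l hl)).2.1]
    exact EqUpTo.refl _ _

theorem lyndonProd_nil_apply (τ : ℝ) (R : List (List (Letter n))) : lyndonProd u τ R [] = 1 := by
  induction R with
  | nil => rfl
  | cons l R ih => rw [lyndonProd_cons, mul_nil, ih, seriesExp_nil, one_mul]

theorem lyndonProd_mul_foldl (τ : ℝ) (R : List (List (Letter n))) (S : Series (Letter n)) :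
    lyndonProd u τ R * R.foldl
        (fun T l => opExp (ad (-(evalPoly (alpha u τ) (lyndonS l) • lyndonP l))) T) S
      = S * lyndonProd u τ R := by
  induction R generalizing S with
  | nil => simp [lyndonProd]
  | cons l R ih =>
    have h0 := lyndonCoord_smul_lyndonP_nil (u := u) τ l
    rw [List.foldl_cons, lyndonProd_cons, mul_assoc, ih, ← mul_assoc, ← mul_assoc]
    congr 1
    change seriesExp (lyndonCoord u τ l • lyndonP l) *
      opExp (ad (-(lyndonCoord u τ l • lyndonP l))) S = _
    rw [opExp_ad_eq (by rw [neg_apply, h0, neg_zero]), neg_neg, ← mul_assoc, ← mul_assoc,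
      seriesExp_mul_neg h0, one_mul]

theorem Series.EqUpTo.ringInverse {N : ℕ} {S R : Series (Letter n)} (hS : S [] = 1) (hR : R [] = 1)
    (h : EqUpTo N S R) : EqUpTo N (Ring.inverse S) (Ring.inverse R) := by
  have h1 : Ring.inverse S = Ring.inverse S * (R * Ring.inverse R) := by
    rw [mul_ringInverse_self hR, mul_one]
  have h2 : Ring.inverse S * (S * Ring.inverse R) = Ring.inverse R := by
    rw [← mul_assoc, ringInverse_mul_self hS, one_mul]
  rw [h1]
  refine ((EqUpTo.refl N _).mul (h.symm.mul (EqUpTo.refl N _))).trans ?_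
  rw [h2]
  exact EqUpTo.refl _ _

theorem not_mem_topLetters_of_mem_lowLetters {t : Letter n} (ht : t ∈ lowLetters n) :
    t ∉ topLetters n := by
  simp only [lowLetters, topLetters, Finset.mem_filter, Finset.mem_univ, true_and] at ht ⊢
  exact ht

/-- The twisting map conjugates by the starting series. -/
theorem twist_eq_conj (hu : ∀ t, ContinuousOn (u t) (Icc 0 1)) {τ : ℝ}
    (hτ : τ ∈ Icc (0 : ℝ) 1) {t : Letter n} (ht : t ∈ lowLetters n) :
    twist (alpha u τ) t
      = Ring.inverse (startSeries (alpha u τ)) * letter t * startSeries (alpha u τ) := by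
  ext w
  rw [twist, if_neg (not_mem_topLetters_of_mem_lowLetters ht)]
  set E := lyndonProd u τ ((topLyndon n w.length).sort (· ≥ ·)) with hE
  have hE0 : E [] = 1 := lyndonProd_nil_apply _ _
  have h1 : twistUpTo (alpha u τ) w.length (letter t) = Ring.inverse E * letter t * E := by
    rw [mul_assoc, ← lyndonProd_mul_foldl, ← hE, ← mul_assoc, ringInverse_mul_self hE0, one_mul]
    rfl
  have hEV := (startSeries_eqUpTo_lyndonProd hu w.length hτ).symm
  rw [h1]
  exact ((hEV.ringInverse hE0 (startSeries_nil τ)).mul (EqUpTo.refl _ _)).mul hEV w le_rfl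

theorem sum_smul_letter_nil (a : List (Letter n) → ℂ) :
    (∑ t ∈ topLetters n, a [t] • letter t : Series (Letter n)) [] = 0 := by
  rw [sum_apply]
  simp [letter]

theorem startSeriesHat_nil (a : List (Letter n) → ℂ) : startSeriesHat a [] = 1 :=
  seriesExp_nil _

theorem twistHat_eq_conj (a : List (Letter n) → ℂ) {t : Letter n} (ht : t ∈ lowLetters n) :
    twistHat a t = Ring.inverse (startSeriesHat a) * letter t * startSeriesHat a := by
  have h0 := sum_smul_letter_nil a
  rw [twistHat, if_neg (not_mem_topLetters_of_mem_lowLetters ht)]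
  have h : (fun R => ∑ s ∈ topLetters n, ad (-(a [s] • letter s)) R)
      = ad (-∑ s ∈ topLetters n, a [s] • letter s) := by
    funext R
    rw [← Finset.sum_neg_distrib, ad_sum_left]
  rw [h, opExp_ad_eq (by rw [neg_apply, h0, neg_zero]), neg_neg, startSeriesHat,
    ringInverse_seriesExp h0]

end Factorisation

/-! ### The Volterra expansion -/

section Volterra

variable {n : ℕ}

theorem mem_lowWords {k : ℕ} {w : List (Letter n)} :
    w ∈ lowWords n k ↔ w.length = k ∧ ∀ t ∈ w, t ∈ lowLetters n := by
  rw [lowWords, Finset.mem_filter, mem_wordsOfLength]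

theorem sum_lowWords_succ {M : Type*} [AddCommMonoid M] (k : ℕ) (f : List (Letter n) → M) :
    ∑ w ∈ lowWords n (k + 1), f w = ∑ t ∈ lowLetters n, ∑ w ∈ lowWords n k, f (t :: w) := by
  rw [← Finset.sum_product']
  symm
  refine Finset.sum_bij (fun q _ => q.1 :: q.2) ?_ ?_ ?_ fun _ _ => rfl
  · rintro ⟨t, w⟩ h
    rw [Finset.mem_product, mem_lowWords] at h
    rw [mem_lowWords, List.forall_mem_cons, List.length_cons]
    exact ⟨by rw [h.2.1], h.1, h.2.2⟩
  · rintro ⟨t, w⟩ _ ⟨t', w'⟩ _ h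
    simpa using h
  · intro w hw
    rw [mem_lowWords] at hw
    obtain ⟨t, v, rfl⟩ := List.exists_cons_of_length_eq_add_one hw.1
    rw [List.forall_mem_cons, List.length_cons] at hw
    exact ⟨(t, v), Finset.mem_product.2 ⟨hw.2.1, mem_lowWords.2 ⟨by simpa using hw.1, hw.2.2⟩⟩, rfl⟩

/-- The iterated integral `∫ ω_{t₁}(s₁) φ^{(s₁)}(t₁) ∫ ω_{t₂}(s₂) φ^{(s₂)}(t₂) ⋯` attached to a word
`t₁ t₂ ⋯`. -/
def chronSeries (u : Letter n → ℝ → ℂ) (φ : ℝ → Letter n → Series (Letter n)) :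
    List (Letter n) → ℝ → Series (Letter n)
  | [], _ => 1
  | t :: w, τ => ofFun fun v => ∫ s in (0 : ℝ)..τ, u t s * (φ s t * chronSeries u φ w s) v

/-- The sum of the iterated integrals over the words of length `k` in the letters `t_{i,j}`,
`j ≤ n - 1`. -/
def chronSum (u : Letter n → ℝ → ℂ) (φ : ℝ → Letter n → Series (Letter n)) (k : ℕ) (τ : ℝ) :
    Series (Letter n) :=
  ∑ w ∈ lowWords n k, chronSeries u φ w τ

/-- The solution of the twisted equation with initial value `1`, as a sum of iterated integrals. -/
def chronSol (u : Letter n → ℝ → ℂ) (φ : ℝ → Letter n → Series (Letter n)) (τ : ℝ) :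
    Series (Letter n) :=
  gradedSum fun k => chronSum u φ k τ

theorem continuousOn_mul_apply {X : Type*} {F G : ℝ → Series X} {s : Set ℝ}
    (hF : ∀ w, ContinuousOn (fun τ => F τ w) s) (hG : ∀ w, ContinuousOn (fun τ => G τ w) s)
    (w : List X) : ContinuousOn (fun τ => (F τ * G τ) w) s := by
  simp only [mul_apply]
  exact continuousOn_finsetSum _ fun i _ => (hF _).mul (hG _)

variable {u : Letter n → ℝ → ℂ} {φ : ℝ → Letter n → Series (Letter n)}

theorem continuousOn_chronSeries (hu : ∀ t, ContinuousOn (u t) (Icc 0 1))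
    (hφ : ∀ t ∈ lowLetters n, ∀ w, ContinuousOn (fun s => φ s t w) (Icc 0 1))
    {w : List (Letter n)} (hw : ∀ t ∈ w, t ∈ lowLetters n) (v : List (Letter n)) :
    ContinuousOn (fun s => chronSeries u φ w s v) (Icc 0 1) := by
  induction w generalizing v with
  | nil => exact continuousOn_const
  | cons t w ih =>
    rw [List.forall_mem_cons] at hw
    exact fun τ hτ => (hasDerivWithinAt_integral_Icc
      ((hu t).mul (continuousOn_mul_apply (hφ t hw.1) (ih hw.2) v)) hτ).continuousWithinAt

theorem hasDerivWithinAt_chronSeries_cons (hu : ∀ t, ContinuousOn (u t) (Icc 0 1))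
    (hφ : ∀ t ∈ lowLetters n, ∀ w, ContinuousOn (fun s => φ s t w) (Icc 0 1)) {t : Letter n}
    (ht : t ∈ lowLetters n) {w : List (Letter n)} (hw : ∀ t ∈ w, t ∈ lowLetters n)
    (v : List (Letter n)) {τ : ℝ} (hτ : τ ∈ Icc (0 : ℝ) 1) :
    HasDerivWithinAt (fun s => chronSeries u φ (t :: w) s v)
      (u t τ * (φ τ t * chronSeries u φ w τ) v) (Icc 0 1) τ :=
  hasDerivWithinAt_integral_Icc ((hu t).mul
    (continuousOn_mul_apply (hφ t ht) (continuousOn_chronSeries hu hφ hw) v)) hτ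

theorem twistWord_cons (t : Letter n) (w : List (Letter n)) (s : ℝ) (σ : List ℝ) :
    twistWord φ (t :: w) (s :: σ) = φ s t * twistWord φ w σ := by
  simp [twistWord]

theorem iterInt_mul_twistWord (hu : ∀ t, ContinuousOn (u t) (Icc 0 1))
    (hφ : ∀ t ∈ lowLetters n, ∀ w, ContinuousOn (fun s => φ s t w) (Icc 0 1))
    {w : List (Letter n)} (hw : ∀ t ∈ w, t ∈ lowLetters n) (A : Series (Letter n))
    (v : List (Letter n)) {τ : ℝ} (hτ : τ ∈ Icc (0 : ℝ) 1) :
    iterInt u w (fun σ => (A * twistWord φ w σ) v) τ = (A * chronSeries u φ w τ) v := by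
  induction w generalizing A τ with
  | nil => simp [iterInt, twistWord, chronSeries]
  | cons t w ih =>
    rw [List.forall_mem_cons] at hw
    have hc := continuousOn_mul_apply (hφ t hw.1) (continuousOn_chronSeries hu hφ hw.2)
    have h1 : iterInt u (t :: w) (fun σ => (A * twistWord φ (t :: w) σ) v) τ
        = ∫ s in (0 : ℝ)..τ, ∑ i ∈ Finset.range (v.length + 1),
          A (v.take i) * (u t s * (φ s t * chronSeries u φ w s) (v.drop i)) := by
      rw [iterInt]
      refine intervalIntegral.integral_congr fun s hs => ?_
      rw [uIcc_of_le hτ.1] at hs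
      simp only [twistWord_cons, ← mul_assoc]
      rw [ih hw.2 (A * φ s t) ⟨hs.1, hs.2.trans hτ.2⟩, mul_assoc A, mul_apply, Finset.mul_sum]
      exact Finset.sum_congr rfl fun i _ => by ring
    have hint : ∀ i ∈ Finset.range (v.length + 1), IntervalIntegrable
        (fun s => A (v.take i) * (u t s * (φ s t * chronSeries u φ w s) (v.drop i)))
        MeasureTheory.volume 0 τ := fun i _ =>
      intervalIntegrable_of_continuousOn_Icc
        (continuousOn_const.mul ((hu t).mul (hc (v.drop i)))) hτ
    rw [h1, intervalIntegral.integral_finsetSum hint, mul_apply]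
    refine Finset.sum_congr rfl fun i _ => ?_
    rw [intervalIntegral.integral_const_mul]
    rfl

theorem kernelIntegral_eq (hu : ∀ t, ContinuousOn (u t) (Icc 0 1))
    (hφ : ∀ t ∈ lowLetters n, ∀ w, ContinuousOn (fun s => φ s t w) (Icc 0 1))
    (V₀ : ℝ → Series (Letter n)) (k : ℕ) {τ : ℝ} (hτ : τ ∈ Icc (0 : ℝ) 1) :
    kernelIntegral u V₀ φ k τ = V₀ τ * chronSum u φ k τ := by
  ext v
  rw [chronSum, Finset.mul_sum, sum_apply, kernelIntegral]
  exact Finset.sum_congr rfl fun w hw =>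
    iterInt_mul_twistWord hu hφ (mem_lowWords.1 hw).2 (V₀ τ) v hτ

theorem hasDerivWithinAt_chronSum_succ (hu : ∀ t, ContinuousOn (u t) (Icc 0 1))
    (hφ : ∀ t ∈ lowLetters n, ∀ w, ContinuousOn (fun s => φ s t w) (Icc 0 1)) (k : ℕ)
    (v : List (Letter n)) {τ : ℝ} (hτ : τ ∈ Icc (0 : ℝ) 1) :
    HasDerivWithinAt (fun s => chronSum u φ (k + 1) s v)
      (∑ t ∈ lowLetters n, u t τ * (φ τ t * chronSum u φ k τ) v) (Icc 0 1) τ := by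
  simp only [chronSum, sum_lowWords_succ, sum_apply, Finset.mul_sum]
  exact HasDerivWithinAt.fun_sum fun t ht => HasDerivWithinAt.fun_sum fun w hw =>
    hasDerivWithinAt_chronSeries_cons hu hφ ht (mem_lowWords.1 hw).2 v hτ

theorem chronSum_zero (τ : ℝ) : chronSum u φ 0 τ = 1 := by
  have h : lowWords n 0 = {[]} := by
    ext w
    rw [mem_lowWords, Finset.mem_singleton, List.length_eq_zero_iff]
    exact ⟨fun h => h.1, fun h => ⟨h, by simp [h]⟩⟩
  rw [chronSum, h, Finset.sum_singleton]
  rfl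

theorem continuousOn_chronSum (hu : ∀ t, ContinuousOn (u t) (Icc 0 1))
    (hφ : ∀ t ∈ lowLetters n, ∀ w, ContinuousOn (fun s => φ s t w) (Icc 0 1)) (k : ℕ)
    (v : List (Letter n)) : ContinuousOn (fun s => chronSum u φ k s v) (Icc 0 1) := by
  simp only [chronSum, sum_apply]
  exact continuousOn_finsetSum _ fun w hw =>
    continuousOn_chronSeries hu hφ (mem_lowWords.1 hw).2 v

theorem chronSum_succ_apply (hu : ∀ t, ContinuousOn (u t) (Icc 0 1))
    (hφ : ∀ t ∈ lowLetters n, ∀ w, ContinuousOn (fun s => φ s t w) (Icc 0 1)) (k : ℕ)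
    (v : List (Letter n)) {τ : ℝ} (hτ : τ ∈ Icc (0 : ℝ) 1) :
    chronSum u φ (k + 1) τ v
      = ∑ t ∈ lowLetters n, ∫ s in (0 : ℝ)..τ, u t s * (φ s t * chronSum u φ k s) v := by
  refine eqOn_Icc_of_hasDerivWithinAt
    (fun τ hτ => hasDerivWithinAt_chronSum_succ hu hφ k v hτ)
    (fun τ hτ => HasDerivWithinAt.fun_sum fun t ht => hasDerivWithinAt_integral_Icc
      ((hu t).mul (continuousOn_mul_apply (hφ t ht) (continuousOn_chronSum hu hφ k) v)) hτ)
    ?_ τ hτ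
  simp only [chronSum, sum_lowWords_succ, sum_apply, chronSeries, ofFun_apply,
    intervalIntegral.integral_same, Finset.sum_const_zero]

theorem ordGE_chronSeries (hφ0 : ∀ s ∈ Icc (0 : ℝ) 1, ∀ t ∈ lowLetters n, φ s t [] = 0)
    {w : List (Letter n)} (hw : ∀ t ∈ w, t ∈ lowLetters n) {τ : ℝ} (hτ : τ ∈ Icc (0 : ℝ) 1) :
    OrdGE w.length (chronSeries u φ w τ) := by
  induction w generalizing τ with
  | nil => exact ordGE_zero _
  | cons t w ih =>
    rw [List.forall_mem_cons] at hw
    intro v hv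
    have h : ∫ s in (0 : ℝ)..τ, u t s * (φ s t * chronSeries u φ w s) v
        = ∫ s in (0 : ℝ)..τ, (0 : ℂ) := by
      refine intervalIntegral.integral_congr fun s hs => ?_
      rw [uIcc_of_le hτ.1] at hs
      have hs' : s ∈ Icc (0 : ℝ) 1 := ⟨hs.1, hs.2.trans hτ.2⟩
      rw [((ordGE_one (hφ0 s hs' t hw.1)).mul (ih hw.2 hs')) v
        (by rw [List.length_cons] at hv; omega), mul_zero]
    rw [intervalIntegral.integral_zero] at h
    exact h

theorem ordGE_chronSum (hφ0 : ∀ s ∈ Icc (0 : ℝ) 1, ∀ t ∈ lowLetters n, φ s t [] = 0) (k : ℕ)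
    {τ : ℝ} (hτ : τ ∈ Icc (0 : ℝ) 1) : OrdGE k (chronSum u φ k τ) :=
  OrdGE.sum fun w hw => by
    have h := ordGE_chronSeries (u := u) hφ0 (mem_lowWords.1 hw).2 hτ
    rwa [(mem_lowWords.1 hw).1] at h

theorem hasSeriesDeriv_chronSol (hu : ∀ t, ContinuousOn (u t) (Icc 0 1))
    (hφ : ∀ t ∈ lowLetters n, ∀ w, ContinuousOn (fun s => φ s t w) (Icc 0 1))
    (hφ0 : ∀ s ∈ Icc (0 : ℝ) 1, ∀ t ∈ lowLetters n, φ s t [] = 0) :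
    HasSeriesDeriv (chronSol u φ) (twistedRHS u φ (chronSol u φ)) := by
  intro τ hτ v
  have hord := fun k => ordGE_chronSum (u := u) hφ0 k hτ
  have h1 : twistedRHS u φ (chronSol u φ) τ v = ∑ k ∈ Finset.range v.length,
      ∑ t ∈ lowLetters n, u t τ * (φ τ t * chronSum u φ k τ) v := by
    have h2 : twistedRHS u φ (chronSol u φ) τ v = ((∑ t ∈ lowLetters n, u t τ • φ τ t)
        * ∑ k ∈ Finset.range (v.length + 1), chronSum u φ k τ) v :=
      (EqUpTo.refl v.length _).mul (gradedSum_eqUpTo hord v.length le_rfl) v le_rfl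
    rw [h2, Finset.mul_sum, sum_apply, Finset.sum_range_succ]
    simp only [Finset.sum_mul, sum_apply, smul_mul_assoc, smul_apply]
    rw [add_eq_left]
    refine Finset.sum_eq_zero fun t ht => ?_
    rw [((ordGE_one (hφ0 τ hτ t ht)).mul (hord v.length)) v (by omega), mul_zero]
  have h3 : (fun s => chronSol u φ s v) = fun s =>
      (∑ k ∈ Finset.range v.length, chronSum u φ (k + 1) s v) + (1 : Series (Letter n)) v := by
    funext s
    rw [chronSol, gradedSum, Finset.sum_range_succ', chronSum_zero]
  rw [h1, h3]
  exact (HasDerivWithinAt.fun_sum fun k _ =>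
    hasDerivWithinAt_chronSum_succ hu hφ k v hτ).add_const _

/-- The twisting map `φ` conjugates the letters `t_{i,j}`, `j ≤ n - 1`, by the starting series `V₀`,
and depends continuously on the parameter. -/
structure IsConjugation (V₀ : ℝ → Series (Letter n)) (φ : ℝ → Letter n → Series (Letter n)) :
    Prop where
  nil : ∀ s, V₀ s [] = 1
  eq : ∀ s ∈ Icc (0 : ℝ) 1, ∀ t ∈ lowLetters n, φ s t = Ring.inverse (V₀ s) * letter t * V₀ s
  cont : ∀ t ∈ lowLetters n, ∀ w, ContinuousOn (fun s => φ s t w) (Icc 0 1)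

variable {V₀ : ℝ → Series (Letter n)}

theorem IsConjugation.apply_nil (h : IsConjugation V₀ φ) : ∀ s ∈ Icc (0 : ℝ) 1,
    ∀ t ∈ lowLetters n, φ s t [] = 0 := fun s hs t ht => by
  rw [h.eq s hs t ht, mul_nil, mul_nil]
  simp [letter]

theorem IsConjugation.volterra_eq (h : IsConjugation V₀ φ)
    (hu : ∀ t, ContinuousOn (u t) (Icc 0 1)) (k : ℕ) {τ : ℝ} (hτ : τ ∈ Icc (0 : ℝ) 1) :
    volterra u V₀ k τ = V₀ τ * chronSum u φ k τ := by
  induction k generalizing τ with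
  | zero => rw [chronSum_zero, mul_one]; rfl
  | succ k ih =>
    rw [volterra]
    beta_reduce
    congr 1
    ext v
    rw [chronSum_succ_apply hu h.cont k v hτ, ofFun_apply]
    refine Finset.sum_congr rfl fun t ht => intervalIntegral.integral_congr fun s hs => ?_
    rw [uIcc_of_le hτ.1] at hs
    have hs' : s ∈ Icc (0 : ℝ) 1 := ⟨hs.1, hs.2.trans hτ.2⟩
    rw [ih hs', ← mul_assoc, ← h.eq s hs' t ht]

theorem IsConjugation.isSeriesSum (h : IsConjugation V₀ φ)
    (hu : ∀ t, ContinuousOn (u t) (Icc 0 1)) :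
    IsSeriesSum (volterra u V₀) (fun τ => V₀ τ * chronSol u φ τ) := by
  intro m
  refine ⟨m + 1, fun N hN τ hτ w hw => ?_⟩
  obtain ⟨M, rfl⟩ : ∃ M, N = M + 1 := ⟨N - 1, by omega⟩
  rw [Finset.sum_congr rfl fun k _ => h.volterra_eq hu k hτ, ← Finset.mul_sum]
  exact ((EqUpTo.refl m (V₀ τ)).mul (gradedSum_eqUpTo
    (fun k => ordGE_chronSum h.apply_nil k hτ) m (Nat.le_of_succ_le_succ hN)).symm) w hw

theorem IsConjugation.volterraExpansion (h : IsConjugation V₀ φ)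
    (hu : ∀ t, ContinuousOn (u t) (Icc 0 1)) : VolterraExpansion u V₀ φ :=
  ⟨⟨chronSol u φ, hasSeriesDeriv_chronSol hu h.cont h.apply_nil, h.isSeriesSum hu⟩,
    fun k τ hτ => by rw [h.volterra_eq hu k hτ, kernelIntegral_eq hu h.cont V₀ k hτ]⟩

end Volterra

/-! ### Closed ideals -/

section ClosedIdeal

variable {n : ℕ}

/-- The closure of a two-sided ideal for the distance given by the order. -/
def closedIdeal (I : TwoSidedIdeal (Series (Letter n))) : Set (Series (Letter n)) :=
  {S | ∀ m : ℕ, ∃ R ∈ I, EqUpTo m S R}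

variable {I : TwoSidedIdeal (Series (Letter n))}

theorem zero_mem_closedIdeal : (0 : Series (Letter n)) ∈ closedIdeal I := fun _ =>
  ⟨0, I.zero_mem, EqUpTo.refl _ _⟩

theorem add_mem_closedIdeal {S R : Series (Letter n)} (hS : S ∈ closedIdeal I)
    (hR : R ∈ closedIdeal I) : S + R ∈ closedIdeal I := fun m => by
  obtain ⟨S', hS', h⟩ := hS m
  obtain ⟨R', hR', h'⟩ := hR m
  exact ⟨S' + R', I.add_mem hS' hR', h.add h'⟩

theorem mul_left_mem_closedIdeal (A : Series (Letter n)) {S : Series (Letter n)}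
    (hS : S ∈ closedIdeal I) : A * S ∈ closedIdeal I := fun m => by
  obtain ⟨S', hS', h⟩ := hS m
  exact ⟨A * S', I.mul_mem_left _ _ hS', (EqUpTo.refl _ _).mul h⟩

theorem mul_right_mem_closedIdeal (A : Series (Letter n)) {S : Series (Letter n)}
    (hS : S ∈ closedIdeal I) : S * A ∈ closedIdeal I := fun m => by
  obtain ⟨S', hS', h⟩ := hS m
  exact ⟨S' * A, I.mul_mem_right _ _ hS', h.mul (EqUpTo.refl _ _)⟩

theorem smul_mem_closedIdeal (c : ℂ) {S : Series (Letter n)} (hS : S ∈ closedIdeal I) :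
    c • S ∈ closedIdeal I := by
  have h := mul_left_mem_closedIdeal (c • (1 : Series (Letter n))) hS
  rwa [smul_mul_assoc, one_mul] at h

theorem neg_mem_closedIdeal {S : Series (Letter n)} (hS : S ∈ closedIdeal I) :
    -S ∈ closedIdeal I := by
  have h := smul_mem_closedIdeal (-1) hS
  rwa [neg_one_smul] at h

theorem sum_mem_closedIdeal {ι : Type*} {s : Finset ι} {F : ι → Series (Letter n)}
    (h : ∀ i ∈ s, F i ∈ closedIdeal I) : ∑ i ∈ s, F i ∈ closedIdeal I := by
  classical
  induction s using Finset.induction_on with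
  | empty => exact zero_mem_closedIdeal
  | insert i s hi ih =>
    rw [Finset.sum_insert hi]
    exact add_mem_closedIdeal (h i (Finset.mem_insert_self _ _))
      (ih fun j hj => h j (Finset.mem_insert_of_mem hj))

/-- A closed ideal is stable under coefficientwise integration: up to a given degree it is a
subspace of a finite-dimensional space, cut out by linear forms. -/
theorem integral_mem_closedIdeal {f : ℝ → Series (Letter n)}
    (hf : ∀ w, ContinuousOn (fun s => f s w) (Icc 0 1))
    (hmem : ∀ s ∈ Icc (0 : ℝ) 1, f s ∈ closedIdeal I) {τ : ℝ} (hτ : τ ∈ Icc (0 : ℝ) 1) :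
    ofFun (fun w => ∫ s in (0 : ℝ)..τ, f s w) ∈ closedIdeal I := by
  intro m
  set B : Finset (List (Letter n)) := (Finset.range (m + 1)).biUnion (wordsOfLength n) with hB
  have hBmem : ∀ w : List (Letter n), w ∈ B ↔ w.length ≤ m := fun w => by
    simp [hB, mem_wordsOfLength]
  let trunc : Series (Letter n) →ₗ[ℂ] (B → ℂ) := LinearMap.pi fun w => coeffHom w.1
  let I' : Submodule ℂ (Series (Letter n)) :=
    { carrier := {S | S ∈ I}
      add_mem' := fun h h' => I.add_mem h h'
      zero_mem' := I.zero_mem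
      smul_mem' := fun c S hS => by
        have h := I.mul_mem_left (c • (1 : Series (Letter n))) S hS
        rw [smul_mul_assoc, one_mul] at h
        exact h }
  suffices h : trunc (ofFun fun w => ∫ s in (0 : ℝ)..τ, f s w) ∈ I'.map trunc by
    obtain ⟨R, hR, hRt⟩ := h
    exact ⟨R, hR, fun w hw => (congrFun hRt ⟨w, (hBmem w).2 hw⟩).symm⟩
  by_contra hnot
  obtain ⟨ℓ, hℓ, hker⟩ := Submodule.exists_le_ker_of_notMem hnot
  refine hℓ ?_
  have hexpand : ∀ S : Series (Letter n),
      ℓ (trunc S) = ∑ b : B, S b.1 * ℓ (Pi.single b 1) := fun S => by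
    rw [LinearMap.pi_apply_eq_sum_univ]
    refine Finset.sum_congr rfl fun b _ => ?_
    rw [smul_eq_mul]
    congr 2
    funext b'
    simp [Pi.single_apply, eq_comm]
  have hzero : ∀ s ∈ Icc (0 : ℝ) 1, ℓ (trunc (f s)) = 0 := fun s hs => by
    obtain ⟨R, hR, hRs⟩ := hmem s hs m
    have h1 : trunc (f s) = trunc R := funext fun b => hRs b.1 ((hBmem b.1).1 b.2)
    rw [h1]
    exact hker (Submodule.mem_map_of_mem (show R ∈ I' from hR))
  rw [hexpand]
  simp only [ofFun_apply, ← intervalIntegral.integral_mul_const]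
  rw [← intervalIntegral.integral_finsetSum fun b _ =>
    (intervalIntegrable_of_continuousOn_Icc (hf b.1) hτ).mul_const _]
  rw [intervalIntegral.integral_congr (g := fun _ => (0 : ℂ)) fun s hs => ?_]
  · exact intervalIntegral.integral_zero
  · rw [uIcc_of_le hτ.1] at hs
    beta_reduce
    rw [← hexpand]
    exact hzero s ⟨hs.1, hs.2.trans hτ.2⟩

variable {u : Letter n → ℝ → ℂ} {φ ψ : ℝ → Letter n → Series (Letter n)}
  {V₀ : ℝ → Series (Letter n)}

theorem chronSeries_sub_mem_closedIdeal (hu : ∀ t, ContinuousOn (u t) (Icc 0 1))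
    (hφ : ∀ t ∈ lowLetters n, ∀ w, ContinuousOn (fun s => φ s t w) (Icc 0 1))
    (hψ : RepresentsMod (closedIdeal I) φ ψ) {w : List (Letter n)}
    (hw : ∀ t ∈ w, t ∈ lowLetters n) {τ : ℝ} (hτ : τ ∈ Icc (0 : ℝ) 1) :
    chronSeries u φ w τ - chronSeries u ψ w τ ∈ closedIdeal I := by
  induction w generalizing τ with
  | nil =>
    rw [chronSeries, chronSeries, sub_self]
    exact zero_mem_closedIdeal
  | cons t w ih =>
    rw [List.forall_mem_cons] at hw
    have hcφ := continuousOn_mul_apply (hφ t hw.1) (continuousOn_chronSeries hu hφ hw.2)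
    have hcψ := continuousOn_mul_apply (hψ.1 t)
      (continuousOn_chronSeries hu (fun t _ => hψ.1 t) hw.2)
    have h : chronSeries u φ (t :: w) τ - chronSeries u ψ (t :: w) τ
        = ofFun fun v => ∫ s in (0 : ℝ)..τ,
          (u t s • (φ s t * chronSeries u φ w s - ψ s t * chronSeries u ψ w s)) v := by
      ext v
      rw [sub_apply, ofFun_apply]
      simp only [smul_apply, sub_apply, mul_sub]
      exact (intervalIntegral.integral_sub
        (intervalIntegrable_of_continuousOn_Icc ((hu t).mul (hcφ v)) hτ)
        (intervalIntegrable_of_continuousOn_Icc ((hu t).mul (hcψ v)) hτ)).symm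
    rw [h]
    refine integral_mem_closedIdeal (f := fun s =>
      u t s • (φ s t * chronSeries u φ w s - ψ s t * chronSeries u ψ w s))
      (fun v => (hu t).mul ((hcφ v).sub (hcψ v))) (fun s hs => smul_mem_closedIdeal _ ?_) hτ
    have h2 : φ s t * chronSeries u φ w s - ψ s t * chronSeries u ψ w s
        = φ s t * (chronSeries u φ w s - chronSeries u ψ w s)
          + -((ψ s t - φ s t) * chronSeries u ψ w s) := by
      noncomm_ring
    rw [h2]
    exact add_mem_closedIdeal (mul_left_mem_closedIdeal _ (ih hw.2 hs))
      (neg_mem_closedIdeal (mul_right_mem_closedIdeal _ (hψ.2 s hs t)))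

theorem IsConjugation.volterraExpansionMod (h : IsConjugation V₀ φ)
    (hu : ∀ t, ContinuousOn (u t) (Icc 0 1)) (hψ : RepresentsMod (closedIdeal I) φ ψ) :
    VolterraExpansionMod (closedIdeal I) u V₀ ψ := by
  refine ⟨⟨chronSol u φ, _, _, hasSeriesDeriv_chronSol hu h.cont h.apply_nil, h.isSeriesSum hu,
    fun τ hτ => ⟨?_, ?_⟩⟩, fun k τ hτ => ?_⟩
  · rw [twistedRHS, twistedRHS, ← sub_mul, ← Finset.sum_sub_distrib]
    refine mul_right_mem_closedIdeal _ (sum_mem_closedIdeal fun t _ => ?_)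
    rw [← smul_sub, ← neg_sub]
    exact smul_mem_closedIdeal _ (neg_mem_closedIdeal (hψ.2 τ hτ t))
  · rw [sub_self]
    exact zero_mem_closedIdeal
  · rw [h.volterra_eq hu k hτ, kernelIntegral_eq hu (fun t _ => hψ.1 t) V₀ k hτ, ← mul_sub,
      chronSum, chronSum, ← Finset.sum_sub_distrib]
    exact mul_left_mem_closedIdeal _ (sum_mem_closedIdeal fun w hw =>
      chronSeries_sub_mem_closedIdeal hu h.cont hψ (mem_lowWords.1 hw).2 hτ)

end ClosedIdeal

/-! ### Functions that are polynomials in iterated integrals -/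

section Iterated

variable {n : ℕ}

/-- A function of a path and of a parameter that is a linear combination of iterated integrals, with
coefficients independent of the path. -/
def IsIterated (F : (Letter n → ℝ → ℂ) → ℝ → ℂ) : Prop :=
  ∃ Q : List (Letter n) →₀ ℂ, ∀ u : Letter n → ℝ → ℂ, (∀ t, ContinuousOn (u t) (Icc 0 1)) →
    ∀ τ ∈ Icc (0 : ℝ) 1, F u τ = evalPoly (alpha u τ) Q

/-- All coefficients are linear combinations of iterated integrals. -/
def IsIteratedSeries (F : (Letter n → ℝ → ℂ) → ℝ → Series (Letter n)) : Prop :=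
  ∀ w, IsIterated fun u τ => F u τ w

theorem IsIterated.congr {F G : (Letter n → ℝ → ℂ) → ℝ → ℂ} (hF : IsIterated F)
    (h : ∀ u : Letter n → ℝ → ℂ, (∀ t, ContinuousOn (u t) (Icc 0 1)) →
      ∀ τ ∈ Icc (0 : ℝ) 1, G u τ = F u τ) : IsIterated G := by
  obtain ⟨Q, hQ⟩ := hF
  exact ⟨Q, fun u hu τ hτ => (h u hu τ hτ).trans (hQ u hu τ hτ)⟩

theorem isIterated_alpha (w : List (Letter n)) : IsIterated fun u τ => alpha u τ w :=
  ⟨Finsupp.single w 1, fun u _ τ _ => by rw [evalPoly_single, one_mul]⟩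

theorem isIterated_const (c : ℂ) : IsIterated (n := n) fun _ _ => c :=
  ⟨Finsupp.single [] c, fun u _ τ _ => by rw [evalPoly_single, alpha_nil, mul_one]⟩

theorem IsIterated.add {F G : (Letter n → ℝ → ℂ) → ℝ → ℂ} (hF : IsIterated F)
    (hG : IsIterated G) : IsIterated fun u τ => F u τ + G u τ := by
  obtain ⟨P, hP⟩ := hF
  obtain ⟨Q, hQ⟩ := hG
  refine ⟨P + Q, fun u hu τ hτ => ?_⟩
  beta_reduce
  rw [evalPoly_add, hP u hu τ hτ, hQ u hu τ hτ]

theorem IsIterated.mul {F G : (Letter n → ℝ → ℂ) → ℝ → ℂ} (hF : IsIterated F)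
    (hG : IsIterated G) : IsIterated fun u τ => F u τ * G u τ := by
  obtain ⟨P, hP⟩ := hF
  obtain ⟨Q, hQ⟩ := hG
  refine ⟨shuffle P Q, fun u hu τ hτ => ?_⟩
  beta_reduce
  rw [evalPoly_alpha_shuffle hu P Q hτ, hP u hu τ hτ, hQ u hu τ hτ]

theorem IsIterated.sum {ι : Type*} {s : Finset ι} {F : ι → (Letter n → ℝ → ℂ) → ℝ → ℂ}
    (h : ∀ i ∈ s, IsIterated (F i)) : IsIterated fun u τ => ∑ i ∈ s, F i u τ := by
  classical
  induction s using Finset.induction_on with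
  | empty => simpa using isIterated_const 0
  | insert i s hi ih =>
    simp only [Finset.sum_insert hi]
    exact (h i (Finset.mem_insert_self _ _)).add
      (ih fun j hj => h j (Finset.mem_insert_of_mem hj))

theorem IsIterated.integral {F : (Letter n → ℝ → ℂ) → ℝ → ℂ} (hF : IsIterated F)
    (t : Letter n) : IsIterated fun u τ => ∫ s in (0 : ℝ)..τ, u t s * F u s := by
  obtain ⟨Q, hQ⟩ := hF
  refine ⟨Q.mapDomain (List.cons t), fun u hu τ hτ => ?_⟩
  rw [← integral_mul_evalPoly hu t Q hτ]
  refine intervalIntegral.integral_congr fun s hs => ?_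
  rw [uIcc_of_le hτ.1] at hs
  exact congrArg (u t s * ·) (hQ u hu s ⟨hs.1, hs.2.trans hτ.2⟩)

theorem IsIterated.continuousOn {F : (Letter n → ℝ → ℂ) → ℝ → ℂ} (hF : IsIterated F)
    {u : Letter n → ℝ → ℂ} (hu : ∀ t, ContinuousOn (u t) (Icc 0 1)) :
    ContinuousOn (F u) (Icc 0 1) := by
  obtain ⟨Q, hQ⟩ := hF
  exact (continuousOn_evalPoly hu Q).congr fun τ hτ => hQ u hu τ hτ

theorem isIteratedSeries_const (S : Series (Letter n)) : IsIteratedSeries fun _ _ => S :=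
  fun w => isIterated_const (S w)

variable {F G : (Letter n → ℝ → ℂ) → ℝ → Series (Letter n)}

theorem IsIteratedSeries.mul (hF : IsIteratedSeries F) (hG : IsIteratedSeries G) :
    IsIteratedSeries fun u τ => F u τ * G u τ := fun w => by
  simp only [mul_apply]
  exact IsIterated.sum fun i _ => (hF _).mul (hG _)

theorem IsIteratedSeries.pow (hF : IsIteratedSeries F) (k : ℕ) :
    IsIteratedSeries fun u τ => F u τ ^ k := by
  induction k with
  | zero => simpa using isIteratedSeries_const 1
  | succ k ih =>
    simp only [pow_succ]
    exact ih.mul hF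

theorem IsIteratedSeries.seriesExp (hF : IsIteratedSeries F) :
    IsIteratedSeries fun u τ => seriesExp (F u τ) := fun w =>
  IsIterated.sum fun k _ => (isIterated_const _).mul (hF.pow k w)

theorem IsIteratedSeries.ringInverse (hF : IsIteratedSeries F) (h1 : ∀ u τ, F u τ [] = 1) :
    IsIteratedSeries fun u τ => Ring.inverse (F u τ) := by
  have hsub : IsIteratedSeries fun u τ => F u τ - 1 := fun w => by
    simpa [sub_eq_add_neg] using (hF w).add (isIterated_const (-(1 : Series (Letter n)) w))
  have hlog : IsIteratedSeries fun u τ => seriesLog (F u τ) := fun w =>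
    IsIterated.sum fun k _ => (isIterated_const _).mul (hsub.pow k w)
  have hneg : IsIteratedSeries fun u τ => -seriesLog (F u τ) := fun w => by
    simpa using (isIterated_const (-1)).mul (hlog w)
  simp only [ringInverse_eq (h1 _ _)]
  exact hneg.seriesExp

theorem isIteratedSeries_startSeries :
    IsIteratedSeries (n := n) fun u τ => startSeries (alpha u τ) := fun w => by
  simp only [startSeries]
  split_ifs
  · exact isIterated_alpha w
  · exact isIterated_const 0

theorem isIteratedSeries_startSeriesHat :
    IsIteratedSeries (n := n) fun u τ => startSeriesHat (alpha u τ) :=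
  IsIteratedSeries.seriesExp fun w => by
    simp only [sum_apply, smul_apply]
    exact IsIterated.sum fun t _ => (isIterated_alpha [t]).mul (isIterated_const _)

/-- A starting series `Φ` and a twisting map `T`, as functions of the iterated integrals, such that
`T` conjugates by `Φ` along every path. -/
structure IsTwistingPair (Φ : (List (Letter n) → ℂ) → Series (Letter n))
    (T : (List (Letter n) → ℂ) → Letter n → Series (Letter n)) : Prop where
  nil : ∀ (u : Letter n → ℝ → ℂ) τ, Φ (alpha u τ) [] = 1
  iterated : IsIteratedSeries fun u τ => Φ (alpha u τ)
  eq : ∀ u : Letter n → ℝ → ℂ, (∀ t, ContinuousOn (u t) (Icc 0 1)) → ∀ s ∈ Icc (0 : ℝ) 1,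
    ∀ t ∈ lowLetters n,
      T (alpha u s) t = Ring.inverse (Φ (alpha u s)) * letter t * Φ (alpha u s)

theorem isTwistingPair_twist : IsTwistingPair (n := n) startSeries twist where
  nil _ τ := startSeries_nil τ
  iterated := isIteratedSeries_startSeries
  eq _ hu _ hs _ ht := twist_eq_conj hu hs ht

theorem isTwistingPair_twistHat : IsTwistingPair (n := n) startSeriesHat twistHat where
  nil _ _ := startSeriesHat_nil _
  iterated := isIteratedSeries_startSeriesHat
  eq _ _ _ _ _ ht := twistHat_eq_conj _ ht

variable {Φ : (List (Letter n) → ℂ) → Series (Letter n)}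
  {T : (List (Letter n) → ℂ) → Letter n → Series (Letter n)}

theorem IsTwistingPair.isIteratedSeries_twist (h : IsTwistingPair Φ T) {t : Letter n}
    (ht : t ∈ lowLetters n) : IsIteratedSeries fun u τ => T (alpha u τ) t := fun w =>
  (((h.iterated.ringInverse h.nil).mul (isIteratedSeries_const (letter t))).mul
    h.iterated w).congr fun u hu τ hτ => congrFun (h.eq u hu τ hτ t ht) w

theorem IsTwistingPair.isConjugation (h : IsTwistingPair Φ T) {u : Letter n → ℝ → ℂ}
    (hu : ∀ t, ContinuousOn (u t) (Icc 0 1)) :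
    IsConjugation (fun s => Φ (alpha u s)) (fun s => T (alpha u s)) where
  nil s := h.nil u s
  eq := h.eq u hu
  cont _ ht w := (h.isIteratedSeries_twist ht w).continuousOn hu

theorem IsTwistingPair.isIteratedSeries_chronSol (h : IsTwistingPair Φ T) :
    IsIteratedSeries fun u τ => chronSol u (fun s => T (alpha u s)) τ := by
  have hword : ∀ w : List (Letter n), (∀ t ∈ w, t ∈ lowLetters n) →
      IsIteratedSeries fun u τ => chronSeries u (fun s => T (alpha u s)) w τ := by
    intro w
    induction w with
    | nil => exact fun _ => isIteratedSeries_const 1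
    | cons t w ih =>
      intro hw v
      rw [List.forall_mem_cons] at hw
      exact ((h.isIteratedSeries_twist hw.1).mul (ih hw.2) v).integral t
  intro w
  simp only [chronSol, gradedSum, chronSum, sum_apply]
  refine IsIterated.sum fun k _ => ?_
  exact IsIterated.sum fun v hv => hword v (mem_lowWords.1 hv).2 w

end Iterated

/-! ### Differentials and paths on a manifold spread over `ℂⁿ` -/

section Spread

variable {n : ℕ} {V : Type*} [TopologicalSpace V] {p : V → Fin n → ℂ}

theorem HasDifferentialAt.unique (hp : IsLocalHomeomorph p) {f : V → ℂ}
    {L L' : (Fin n → ℂ) →L[ℂ] ℂ} {x : V} (h : HasDifferentialAt p f L x)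
    (h' : HasDifferentialAt p f L' x) : L = L' := by
  obtain ⟨g, hg, hfg⟩ := h
  obtain ⟨g', hg', hfg'⟩ := h'
  have heq : g =ᶠ[𝓝 (p x)] g' := by
    rw [← hp.map_nhds_eq x]
    exact hfg.symm.trans hfg'
  exact hg.unique (hg'.congr_of_eventuallyEq heq)

theorem HasDifferentialAt.differential_eq (hp : IsLocalHomeomorph p) {f : V → ℂ}
    {L : (Fin n → ℂ) →L[ℂ] ℂ} {x : V} (h : HasDifferentialAt p f L x) :
    differential p f x = L := by
  have hex : ∃ L, HasDifferentialAt p f L x := ⟨L, h⟩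
  rw [differential, dif_pos hex]
  exact hex.choose_spec.unique hp h

theorem Holomorphic.hasDifferentialAt (hp : IsLocalHomeomorph p) {f : V → ℂ}
    (hf : Holomorphic p f) (x : V) : HasDifferentialAt p f (differential p f x) x := by
  obtain ⟨g, hg, hfg⟩ := hf x
  have h : HasDifferentialAt p f (fderiv ℂ g (p x)) x :=
    ⟨g, hg.differentiableAt.hasFDerivAt, hfg⟩
  rwa [h.differential_eq hp]

theorem Holomorphic.continuous_differential (hp : IsLocalHomeomorph p) {f : V → ℂ}
    (hf : Holomorphic p f) : Continuous (differential p f) := by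
  refine continuous_iff_continuousAt.2 fun x => ?_
  obtain ⟨g, hg, hfg⟩ := hf x
  have hev : differential p f =ᶠ[𝓝 x] fun y => fderiv ℂ g (p y) := by
    filter_upwards [hfg.eventually_nhds,
      hp.continuous.continuousAt.eventually hg.eventually_analyticAt] with y hy hgy
    exact HasDifferentialAt.differential_eq hp ⟨g, hgy.differentiableAt.hasFDerivAt, hy⟩
  exact (hg.fderiv.continuousAt.comp hp.continuous.continuousAt).congr hev.symm

theorem holomorphic_const (c : ℂ) : Holomorphic p fun _ => c := fun _ =>
  ⟨fun _ => c, analyticAt_const, EventuallyEq.rfl⟩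

theorem Holomorphic.add {f g : V → ℂ} (hf : Holomorphic p f) (hg : Holomorphic p g) :
    Holomorphic p fun x => f x + g x := fun x => by
  obtain ⟨f', hf', hff'⟩ := hf x
  obtain ⟨g', hg', hgg'⟩ := hg x
  exact ⟨fun z => f' z + g' z, hf'.fun_add hg', hff'.add hgg'⟩

theorem Holomorphic.const_mul {f : V → ℂ} (hf : Holomorphic p f) (c : ℂ) :
    Holomorphic p fun x => c * f x := fun x => by
  obtain ⟨f', hf', hff'⟩ := hf x
  exact ⟨fun z => c * f' z, analyticAt_const.fun_mul hf', hff'.fun_comp (c * ·)⟩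

theorem holomorphic_evalPoly {X : Type*} {a : List X → V → ℂ} (ha : ∀ w, Holomorphic p (a w))
    (Q : List X →₀ ℂ) : Holomorphic p fun x => evalPoly (fun w => a w x) Q := by
  induction Q using Finsupp.induction_linear with
  | zero => simpa [evalPoly] using holomorphic_const (p := p) 0
  | add P Q hP hQ =>
    simp only [evalPoly_add]
    exact hP.add hQ
  | single w c =>
    simp only [evalPoly_single]
    exact (ha w).const_mul c

theorem HasDifferentialAt.comp_path {f : V → ℂ} {L : (Fin n → ℂ) →L[ℂ] ℂ} {x₀ : V} {γ : ℝ → V}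
    (hγ : IsPathFrom p x₀ γ) {τ : ℝ} (hτ : τ ∈ Icc (0 : ℝ) 1)
    (h : HasDifferentialAt p f L (γ τ)) :
    HasDerivWithinAt (fun s => f (γ s)) (L (derivWithin (p ∘ γ) (Icc 0 1) τ)) (Icc 0 1) τ := by
  obtain ⟨g, hg, hfg⟩ := h
  have h1 : HasDerivWithinAt (p ∘ γ) (derivWithin (p ∘ γ) (Icc 0 1) τ) (Icc 0 1) τ :=
    (hγ.2.2.differentiableOn one_ne_zero τ hτ).hasDerivWithinAt
  have h2 := (hg.restrictScalars ℝ).comp_hasDerivWithinAt (f := p ∘ γ) τ h1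
  refine h2.congr_of_eventuallyEq ?_ hfg.eq_of_nhds
  exact (hγ.2.1 τ hτ).eventually hfg

theorem continuousOn_formAlong (hp : IsLocalHomeomorph p) {ξ : Letter n → V → ℂ}
    (hξ : ∀ t, Holomorphic p (ξ t)) {x₀ : V} {γ : ℝ → V} (hγ : IsPathFrom p x₀ γ)
    (t : Letter n) : ContinuousOn (formAlong p ξ γ t) (Icc 0 1) :=
  ((hξ t).continuous_differential hp).comp_continuousOn hγ.2.1 |>.clm_apply
    (hγ.2.2.continuousOn_derivWithin (uniqueDiffOn_Icc zero_lt_one) le_rfl)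

theorem hasDerivAt_mul_smoothTransition :
    HasDerivAt (fun τ : ℝ => τ * Real.smoothTransition (2 * τ - 1)) 1 1 := by
  have hst : HasDerivAt Real.smoothTransition 0 1 := by
    have hd : DifferentiableAt ℝ Real.smoothTransition 1 :=
      (Real.smoothTransition.contDiff (n := 1)).differentiable one_ne_zero 1
    have hmax : IsLocalMax Real.smoothTransition 1 := Eventually.of_forall fun x => by
      rw [Real.smoothTransition.one]
      exact Real.smoothTransition.le_one x
    have h0 := hmax.deriv_eq_zero
    rw [← h0]
    exact hd.hasDerivAt
  have hlin : HasDerivAt (fun τ : ℝ => 2 * τ - 1) 2 1 := by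
    simpa using ((hasDerivAt_id (1 : ℝ)).const_mul 2).sub_const 1
  have hcomp : HasDerivAt (fun τ : ℝ => Real.smoothTransition (2 * τ - 1)) (0 * 2) 1 :=
    HasDerivAt.comp (1 : ℝ) (h₂ := Real.smoothTransition) (by norm_num; exact hst) hlin
  refine ((hasDerivAt_id (1 : ℝ)).fun_mul hcomp).congr_deriv ?_
  norm_num [Real.smoothTransition.one]

/-- A path is prolonged by a straight segment of a chart, which it reaches with velocity `v`. The
old path is run through before the parameter `1 / 2`, with a reparametrisation that makes it
stationary afterwards. -/
theorem exists_path_extend {x₀ : V} {γ : ℝ → V} (hγ : IsPathFrom p x₀ γ)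
    (e : OpenPartialHomeomorph V (Fin n → ℂ)) (he : p = e) (hsrc : γ 1 ∈ e.source)
    {v : Fin n → ℂ} (hseg : ∀ r ∈ Icc (0 : ℝ) 1, p (γ 1) + r • v ∈ e.target) :
    ∃ γ' : ℝ → V, IsPathFrom p x₀ γ' ∧ γ' 1 = e.symm (p (γ 1) + v) ∧
      derivWithin (p ∘ γ') (Icc 0 1) 1 = v := by
  set ρ : ℝ → ℝ := fun τ => Real.smoothTransition (2 * τ) with hρ
  set h : ℝ → ℝ := fun τ => τ * Real.smoothTransition (2 * τ - 1) with hh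
  have hρ1 : ∀ τ, 1 / 2 ≤ τ → ρ τ = 1 := fun τ hτ =>
    Real.smoothTransition.one_of_one_le (by linarith)
  have hh0 : ∀ τ, τ ≤ 1 / 2 → h τ = 0 := fun τ hτ => by
    rw [hh]
    simp only
    rw [Real.smoothTransition.zero_of_nonpos (by linarith), mul_zero]
  have hρmem : ∀ τ, ρ τ ∈ Icc (0 : ℝ) 1 := fun τ =>
    ⟨Real.smoothTransition.nonneg _, Real.smoothTransition.le_one _⟩
  have hhmem : ∀ τ ∈ Icc (0 : ℝ) 1, h τ ∈ Icc (0 : ℝ) 1 := fun τ hτ =>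
    ⟨mul_nonneg hτ.1 (Real.smoothTransition.nonneg _),
      mul_le_one₀ hτ.2 (Real.smoothTransition.nonneg _) (Real.smoothTransition.le_one _)⟩
  have hρc : ContDiff ℝ 1 ρ :=
    (Real.smoothTransition.contDiff (n := 1)).comp (contDiff_const.mul contDiff_id)
  have hhc : ContDiff ℝ 1 h := contDiff_id.mul
    ((Real.smoothTransition.contDiff (n := 1)).comp
      ((contDiff_const.mul contDiff_id).sub contDiff_const))
  set γ' : ℝ → V := fun τ => if τ ≤ 1 / 2 then γ (ρ τ) else e.symm (p (γ 1) + h τ • v) with hγ'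
  have hsymm : e.symm (p (γ 1)) = γ 1 := by
    rw [he]
    exact e.left_inv hsrc
  have hlow : ∀ τ, τ ≤ 1 / 2 → γ' τ = γ (ρ τ) := fun τ hτ => if_pos hτ
  have hhigh : ∀ τ, 1 / 2 ≤ τ → γ' τ = e.symm (p (γ 1) + h τ • v) := fun τ hτ => by
    rcases hτ.eq_or_lt with rfl | hτ
    · rw [hlow _ le_rfl, hρ1 _ le_rfl, hh0 _ le_rfl, zero_smul, add_zero, hsymm]
    · exact if_neg (not_le.2 hτ)
  -- in coordinates both pieces are given by one formula
  have hcoord : ∀ τ ∈ Icc (0 : ℝ) 1, (p ∘ γ') τ = (p ∘ γ) (ρ τ) + h τ • v := by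
    intro τ hτ
    rcases le_total τ (1 / 2) with h2 | h2
    · rw [hh0 τ h2, zero_smul, add_zero, Function.comp_apply, hlow τ h2, Function.comp_apply]
    · rw [Function.comp_apply, hhigh τ h2, hρ1 τ h2, Function.comp_apply]
      conv_lhs => rw [he]
      rw [e.right_inv]
      · rw [← he]
      · rw [← he]
        exact hseg _ (hhmem τ hτ)
  refine ⟨γ', ⟨?_, ?_, ?_⟩, ?_, ?_⟩
  · rw [hlow 0 (by norm_num), hρ]
    simp only [mul_zero, Real.smoothTransition.zero]
    exact hγ.1
  · have h1 : ContinuousOn γ' (Icc 0 (1 / 2)) :=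
      (hγ.2.1.comp hρc.continuous.continuousOn fun τ _ => hρmem τ).congr fun τ hτ => hlow τ hτ.2
    have h2 : ContinuousOn γ' (Icc (1 / 2) 1) := by
      refine ContinuousOn.congr (f := fun τ => e.symm (p (γ 1) + h τ • v)) ?_
        fun τ hτ => hhigh τ hτ.1
      refine e.continuousOn_symm.comp
        (continuous_const.add (hhc.continuous.smul continuous_const)).continuousOn fun τ hτ => ?_
      exact hseg _ (hhmem τ ⟨by linarith [hτ.1], hτ.2⟩)
    have h3 := h1.union_of_isClosed h2 isClosed_Icc isClosed_Icc
    rwa [Icc_union_Icc_eq_Icc (by norm_num) (by norm_num)] at h3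
  · refine ContDiffOn.congr ?_ hcoord
    exact (hγ.2.2.comp hρc.contDiffOn fun τ _ => hρmem τ).add
      (hhc.smul contDiff_const).contDiffOn
  · rw [hhigh 1 (by norm_num), hh]
    norm_num [Real.smoothTransition.one]
  · have hone : (1 : ℝ) ∈ Icc (0 : ℝ) 1 := ⟨zero_le_one, le_rfl⟩
    have hd : HasDerivWithinAt (fun τ => (p ∘ γ) 1 + h τ • v) ((1 : ℝ) • v) (Icc 0 1) 1 :=
      ((hasDerivAt_mul_smoothTransition.smul_const v).const_add _).hasDerivWithinAt
    rw [one_smul] at hd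
    have hev : p ∘ γ' =ᶠ[𝓝[Icc 0 1] 1] fun τ => (p ∘ γ) 1 + h τ • v := by
      have hnear : ∀ᶠ τ : ℝ in 𝓝[Icc 0 1] 1, 1 / 2 ≤ τ :=
        mem_nhdsWithin_of_mem_nhds (Ici_mem_nhds (by norm_num))
      filter_upwards [self_mem_nhdsWithin, hnear] with τ hτ hτ2
      rw [hcoord τ hτ, hρ1 τ hτ2]
    refine HasDerivWithinAt.derivWithin ?_ (uniqueDiffOn_Icc zero_lt_one 1 hone)
    exact hd.congr_of_eventuallyEq hev (hev.self_of_nhdsWithin hone)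

theorem isPathFrom_const (x₀ : V) : IsPathFrom p x₀ fun _ => x₀ :=
  ⟨rfl, continuousOn_const, contDiffOn_const⟩

/-- Every point of a connected manifold spread over `ℂⁿ` is the end point of a `C¹` path. -/
theorem exists_path_to [ConnectedSpace V] (hp : IsLocalHomeomorph p) (x₀ x : V) :
    ∃ γ : ℝ → V, IsPathFrom p x₀ γ ∧ γ 1 = x := by
  set S : Set V := {x | ∃ γ : ℝ → V, IsPathFrom p x₀ γ ∧ γ 1 = x} with hS
  have hloc : ∀ x, ∃ U ∈ 𝓝 x, ∀ y ∈ U, ∀ z ∈ U, y ∈ S → z ∈ S := by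
    intro x
    obtain ⟨e, hx, he⟩ := hp x
    obtain ⟨r, hr, hball⟩ := Metric.isOpen_iff.1 e.open_target (e x) (e.map_source hx)
    refine ⟨e.source ∩ e ⁻¹' Metric.ball (e x) r, ?_, ?_⟩
    · exact inter_mem (e.open_source.mem_nhds hx)
        ((e.continuousAt hx).preimage_mem_nhds (Metric.ball_mem_nhds _ hr))
    · rintro y ⟨hy, hyb⟩ z ⟨hz, hzb⟩ ⟨γ, hγ, rfl⟩
      obtain ⟨γ', hγ', hend, -⟩ := exists_path_extend hγ e he hy (v := e z - e (γ 1))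
        fun s hs => hball (by
          rw [he]
          exact (convex_ball (e x) r).add_smul_sub_mem hyb hzb hs)
      refine ⟨γ', hγ', ?_⟩
      rw [hend, he, add_sub_cancel, e.left_inv hz]
  have hclopen : IsClopen S := by
    constructor
    · rw [← isOpen_compl_iff, isOpen_iff_mem_nhds]
      intro x hx
      obtain ⟨U, hU, h⟩ := hloc x
      exact mem_of_superset hU fun y hy hyS => hx (h y hy x (mem_of_mem_nhds hU) hyS)
    · rw [isOpen_iff_mem_nhds]
      intro x hx
      obtain ⟨U, hU, h⟩ := hloc x
      exact mem_of_superset hU fun y hy => h x (mem_of_mem_nhds hU) y hy hx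
  have huniv := hclopen.eq_univ ⟨x₀, fun _ => x₀, isPathFrom_const x₀, rfl⟩
  exact huniv.symm.subset (mem_univ x)

theorem exists_path_to_with_velocity [ConnectedSpace V] (hp : IsLocalHomeomorph p) (x₀ x : V)
    (v : Fin n → ℂ) : ∃ (γ : ℝ → V) (c : ℝ), c ≠ 0 ∧ IsPathFrom p x₀ γ ∧ γ 1 = x ∧
      derivWithin (p ∘ γ) (Icc 0 1) 1 = c • v := by
  obtain ⟨e, hx, he⟩ := hp x
  obtain ⟨r, hr, hball⟩ := Metric.isOpen_iff.1 e.open_target (e x) (e.map_source hx)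
  have hnorm : 0 < ‖v‖ + 1 := by positivity
  set c : ℝ := r / (‖v‖ + 1) with hc
  have hc0 : 0 < c := div_pos hr hnorm
  have hcv : c * ‖v‖ < r := by
    rw [hc, div_mul_eq_mul_div, div_lt_iff₀ hnorm]
    nlinarith
  have hmem : ∀ s ∈ Icc (0 : ℝ) 1, e x - c • v + s • c • v ∈ e.target := by
    intro s hs
    refine hball ?_
    have h1 : e x - c • v + s • c • v = e x + ((s - 1) * c) • v := by
      module
    rw [h1, Metric.mem_ball, dist_self_add_left, norm_smul, Real.norm_eq_abs, abs_mul,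
      abs_of_pos hc0, abs_of_nonpos (by linarith [hs.2])]
    nlinarith [hs.1, hs.2, mul_nonneg hc0.le (norm_nonneg v), mul_nonneg hs.1
      (mul_nonneg hc0.le (norm_nonneg v))]
  have hy : e x - c • v ∈ e.target := by simpa using hmem 0 ⟨le_rfl, zero_le_one⟩
  obtain ⟨γ, hγ, hend⟩ := exists_path_to hp x₀ (e.symm (e x - c • v))
  have hpγ : p (γ 1) = e x - c • v := by rw [hend, he, e.right_inv hy]
  obtain ⟨γ', hγ', hend', hd⟩ := exists_path_extend hγ e he
    (hend ▸ e.map_target hy) (v := c • v) fun s hs => by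
      rw [hpγ]
      exact hmem s hs
  refine ⟨γ', c, hc0.ne', hγ', ?_, hd⟩
  rw [hend', hpγ, sub_add_cancel, e.left_inv hx]

/-- When the iterated integrals are holomorphic functions of the end point, so is the solution of
the twisted equation. Its differential is found by testing it on the velocities of paths. -/
theorem IsTwistingPair.exists_holomorphic_solution [ConnectedSpace V]
    {Φ : (List (Letter n) → ℂ) → Series (Letter n)}
    {T : (List (Letter n) → ℂ) → Letter n → Series (Letter n)} (h : IsTwistingPair Φ T)
    (hp : IsLocalHomeomorph p) {ξ : Letter n → V → ℂ} (hξ : ∀ t, Holomorphic p (ξ t)) {x₀ : V}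
    {a : List (Letter n) → V → ℂ} (ha : ∀ w, Holomorphic p (a w))
    (hint : ∀ γ : ℝ → V, IsPathFrom p x₀ γ → ∀ w, ∀ τ ∈ Icc (0 : ℝ) 1,
      alpha (formAlong p ξ γ) τ w = a w (γ τ)) :
    ∃ H : V → Series (Letter n), (∀ w, Holomorphic p fun x => H x w) ∧
      (∀ x w, HasDifferentialAt p (fun y => H y w) (∑ t ∈ lowLetters n,
        ((T (fun v => a v x) t * H x) w) • differential p (ξ t) x) x) ∧
      ∀ γ : ℝ → V, IsPathFrom p x₀ γ →
        IsSeriesSum (volterra (formAlong p ξ γ) fun s => Φ (alpha (formAlong p ξ γ) s))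
          (fun τ => Φ (fun v => a v (γ τ)) * H (γ τ)) := by
  choose Q hQ using h.isIteratedSeries_chronSol
  set H : V → Series (Letter n) := fun x w => evalPoly (fun v => a v x) (Q w) with hH
  have halpha : ∀ γ : ℝ → V, IsPathFrom p x₀ γ → ∀ τ ∈ Icc (0 : ℝ) 1,
      alpha (formAlong p ξ γ) τ = fun v => a v (γ τ) := fun γ hγ τ hτ =>
    funext fun w => hint γ hγ w τ hτ
  have hu : ∀ γ : ℝ → V, IsPathFrom p x₀ γ →
      ∀ t, ContinuousOn (formAlong p ξ γ t) (Icc 0 1) :=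
    fun γ hγ t => continuousOn_formAlong hp hξ hγ t
  have hsol : ∀ γ : ℝ → V, IsPathFrom p x₀ γ → ∀ τ ∈ Icc (0 : ℝ) 1,
      chronSol (formAlong p ξ γ) (fun s => T (alpha (formAlong p ξ γ) s)) τ = H (γ τ) := by
    intro γ hγ τ hτ
    ext w
    refine (hQ w _ (hu γ hγ) τ hτ).trans ?_
    rw [halpha γ hγ τ hτ]
  have hhol : ∀ w, Holomorphic p fun x => H x w := fun w => holomorphic_evalPoly ha (Q w)
  refine ⟨H, hhol, fun x w => ?_, fun γ hγ => ?_⟩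
  · have hd := (hhol w).hasDifferentialAt hp x
    convert hd using 1
    ext1 v
    obtain ⟨γ, c, hc, hγ, rfl, hvel⟩ := exists_path_to_with_velocity hp x₀ x v
    have hone : (1 : ℝ) ∈ Icc (0 : ℝ) 1 := ⟨zero_le_one, le_rfl⟩
    have hconj := h.isConjugation (hu γ hγ)
    have h1 := hasSeriesDeriv_chronSol (hu γ hγ) hconj.cont hconj.apply_nil 1 hone w
    have h2 := HasDifferentialAt.comp_path hγ hone hd
    have h3 := (uniqueDiffOn_Icc zero_lt_one 1 hone).eq_deriv _
      (h1.congr (fun τ hτ => congrFun (hsol γ hγ τ hτ).symm w)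
        (congrFun (hsol γ hγ 1 hone).symm w)) h2
    have h4 : twistedRHS (formAlong p ξ γ) (fun s => T (alpha (formAlong p ξ γ) s))
        (chronSol (formAlong p ξ γ) fun s => T (alpha (formAlong p ξ γ) s)) 1 w
        = (∑ t ∈ lowLetters n, ((T (fun v => a v (γ 1)) t * H (γ 1)) w) •
          differential p (ξ t) (γ 1)) (c • v) := by
      rw [twistedRHS, hsol γ hγ 1 hone, halpha γ hγ 1 hone, Finset.sum_mul, Series.sum_apply,
        _root_.sum_apply]
      refine Finset.sum_congr rfl fun t _ => ?_
      rw [smul_mul_assoc, Series.smul_apply, formAlong, hvel, _root_.smul_apply,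
        smul_eq_mul, mul_comm]
    rw [h4, hvel] at h3
    have hreal : ∀ M : (Fin n → ℂ) →L[ℂ] ℂ, M (c • v) = c • M v := fun M =>
      (M.restrictScalars ℝ).map_smul c v
    rw [hreal, hreal] at h3
    exact smul_right_injective ℂ hc h3
  · have hsum := (h.isConjugation (hu γ hγ)).isSeriesSum (hu γ hγ)
    intro m
    obtain ⟨K, hK⟩ := hsum m
    refine ⟨K, fun N hN τ hτ w hw => ?_⟩
    rw [hK N hN τ hτ w hw]
    beta_reduce
    rw [hsol γ hγ τ hτ, halpha γ hγ τ hτ]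

end Spread

end NCVolterra

end

theorem mainTheorem9 (n : ℕ) (hn : 2 ≤ n) {V : Type*} [TopologicalSpace V] [T2Space V]
    [SimplyConnectedSpace V] (p : V → Fin n → ℂ) (hp : IsLocalHomeomorph p)
    (ξ : Letter n → V → ℂ) (hξ : ∀ t, Holomorphic p (ξ t)) (x₀ : V) :
    -- along every path starting at the base point
    (∀ γ : ℝ → V, IsPathFrom p x₀ γ →
      ∀ u : Letter n → ℝ → ℂ, u = formAlong p ξ γ →
      ∀ V₀ Vh₀ : ℝ → Series (Letter n), (∀ s, V₀ s = startSeries (alpha u s)) →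
        (∀ s, Vh₀ s = startSeriesHat (alpha u s)) →
      ∀ φ φh : ℝ → Letter n → Series (Letter n), (∀ s, φ s = twist (alpha u s)) →
        (∀ s, φh s = twistHat (alpha u s)) →
      -- the twisting maps on letters
      (∀ s ∈ Icc (0 : ℝ) 1, ∀ t ∈ lowLetters n,
        (φ s t = opExp (ad (-seriesLog (V₀ s))) (letter t) ∧
          φ s t = Ring.inverse (V₀ s) * letter t * V₀ s) ∧
        (φh s t = opExp (ad (-seriesLog (Vh₀ s))) (letter t) ∧
          φh s t = Ring.inverse (Vh₀ s) * letter t * Vh₀ s)) ∧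
      -- the expansions
      VolterraExpansion u V₀ φ ∧ VolterraExpansion u Vh₀ φh ∧
      -- the reduction modulo the ideal of relators
      (∀ ψ : ℝ → Letter n → Series (Letter n), RepresentsMod (relatorIdeal p ξ) φ ψ →
        (∀ s ∈ Icc (0 : ℝ) 1, ∀ t ∈ lowLetters n,
          ψ s t - opExp (ad (-seriesLog (V₀ s))) (letter t) ∈ relatorIdeal p ξ) ∧
        VolterraExpansionMod (relatorIdeal p ξ) u V₀ ψ) ∧
      (∀ ψ : ℝ → Letter n → Series (Letter n), RepresentsMod (relatorIdeal p ξ) φh ψ →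
        (∀ s ∈ Icc (0 : ℝ) 1, ∀ t ∈ lowLetters n,
          ψ s t - opExp (ad (-seriesLog (Vh₀ s))) (letter t) ∈ relatorIdeal p ξ) ∧
        VolterraExpansionMod (relatorIdeal p ξ) u Vh₀ ψ)) ∧
    -- if the iterated integrals are holomorphic functions of the end point
    (∀ a : List (Letter n) → V → ℂ, (∀ w, Holomorphic p (a w)) →
      (∀ γ : ℝ → V, IsPathFrom p x₀ γ → ∀ w, ∀ τ ∈ Icc (0 : ℝ) 1,
        alpha (formAlong p ξ γ) τ w = a w (γ τ)) →
      ∃ H Hh : V → Series (Letter n),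
        (∀ w, Holomorphic p (fun x => H x w) ∧ Holomorphic p (fun x => Hh x w)) ∧
        (∀ x w,
          HasDifferentialAt p (fun y => H y w) (∑ t ∈ lowLetters n,
            ((twist (fun v => a v x) t * H x) w) • differential p (ξ t) x) x ∧
          HasDifferentialAt p (fun y => Hh y w) (∑ t ∈ lowLetters n,
            ((twistHat (fun v => a v x) t * Hh x) w) • differential p (ξ t) x) x) ∧
        ∀ γ : ℝ → V, IsPathFrom p x₀ γ →
          IsSeriesSum
            (volterra (formAlong p ξ γ) fun s => startSeries (alpha (formAlong p ξ γ) s))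
            (fun τ => startSeries (fun v => a v (γ τ)) * H (γ τ)) ∧
          IsSeriesSum
            (volterra (formAlong p ξ γ) fun s => startSeriesHat (alpha (formAlong p ξ γ) s))
            (fun τ => startSeriesHat (fun v => a v (γ τ)) * Hh (γ τ))) := by
  refine ⟨?_, fun a ha hint => ?_⟩
  · rintro γ hγ u rfl V₀ Vh₀ hV₀ hVh₀ φ φh hφ hφh
    obtain rfl : V₀ = _ := funext hV₀
    obtain rfl : Vh₀ = _ := funext hVh₀
    obtain rfl : φ = _ := funext hφ
    obtain rfl : φh = _ := funext hφh
    have hu := fun t => continuousOn_formAlong hp hξ hγ t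
    have hc := isTwistingPair_twist.isConjugation hu
    have hch := isTwistingPair_twistHat.isConjugation hu
    have hlog : ∀ {W : ℝ → Series (Letter n)} {χ : ℝ → Letter n → Series (Letter n)},
        IsConjugation W χ → ∀ s ∈ Icc (0 : ℝ) 1, ∀ t ∈ lowLetters n,
          χ s t = opExp (ad (-seriesLog (W s))) (letter t) := fun h s hs t ht => by
      rw [opExp_ad_neg_seriesLog (h.nil s), h.eq s hs t ht]
    refine ⟨fun s hs t ht => ⟨⟨hlog hc s hs t ht, hc.eq s hs t ht⟩,
      ⟨hlog hch s hs t ht, hch.eq s hs t ht⟩⟩, hc.volterraExpansion hu,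
      hch.volterraExpansion hu, fun ψ hψ => ⟨fun s hs t ht => ?_, hc.volterraExpansionMod hu hψ⟩,
      fun ψ hψ => ⟨fun s hs t ht => ?_, hch.volterraExpansionMod hu hψ⟩⟩
    · rw [← hlog hc s hs t ht]
      exact hψ.2 s hs t
    · rw [← hlog hch s hs t ht]
      exact hψ.2 s hs t
  · obtain ⟨H, hH, hHd, hHs⟩ :=
      isTwistingPair_twist.exists_holomorphic_solution hp hξ ha hint
    obtain ⟨Hh, hHh, hHhd, hHhs⟩ :=
      isTwistingPair_twistHat.exists_holomorphic_solution hp hξ ha hint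
    exact ⟨H, Hh, fun w => ⟨hH w, hHh w⟩, fun x w => ⟨hHd x w, hHhd x w⟩,
      fun γ hγ => ⟨hHs γ hγ, hHhs γ hγ⟩⟩
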